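/- Let $(\varepsilon_u)_{u\in\mathbb Z}$ be i.i.d. real random variables, $f\colon\mathbb R^{\mathbb Z}\to\mathbb R$ measurable, and $X_t=f((\varepsilon_{t-u})_{u\in\mathbb Z})$. For a process of the form $Y_t=F((\varepsilon_{t-u})_{u\in\mathbb Z})$ put $\delta_i(Y)=\|Y_0-Y_0^{*,i}\|_2$, where $Y_0^{*,i}$ is obtained from $Y_0$ by replacing $\varepsilon_i$ by $\varepsilon_i'$, with $(\varepsilon'_u)$ an independent copy of $(\varepsilon_u)$. Let $m\in\mathbb N$, let $g\colon\mathbb R^m\to\mathbb R$ be measurable, let $h\colon\mathbb R^2\to\mathbb R$ be symmetric, and let $b_n,\ell_n$ be sequences of natural numbers. With the blocks $B_{n,j}=\{(j-1)\ell_n+1,\dots,j\ell_n\}$ set $$W_{n,j}=\sqrt{\ell_n}\,g\Big(\frac1{\ell_n}\sum_{t\in B_{n,j}}X_t,\dots,\frac1{\ell_n}\sum_{t\in B_{n,j}}X_t^m\Big),\qquad U_n=\frac1{b_n(b_n-1)}\sum_{1\le j\ne k\le b_n}h(W_{n,j},W_{n,k}).$$ Assume: 1. $h$ is Lipschitz continuous.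 2. $E[X_1^{2m}]<\infty$ and $\sum_{i\in\mathbb Z}\sum_{k=1}^m i^2\,\delta_i((X_t^k)_{t\in\mathbb Z})<\infty$. 3. With $v_0=(E[X_1^k])_{k=1}^m$, $g(v_0)=0$, and there is $a>0$ such that $g$ is differentiable with bounded gradient on $\prod_{k=1}^m(E[X_1^k]-2a,E[X_1^k]+2a)$. 4. $b_n\to\infty$, $\ell_n\to\infty$ and $b_n/\ell_n\to0$. 5. $\sigma^2:=\sum_{t\in\mathbb Z}\mathrm{Cov}\Big(\sum_{k=1}^m\frac{\partial g}{\partial x_k}(v_0)X_0^k,\ \sum_{k=1}^m\frac{\partial g}{\partial x_k}(v_0)X_t^k\Big)>0$. 6. $g$ is twice differentiable at $v_0$ (that is, the first order partial derivatives of $g$ are differentiable at $v_0$). 7. There is $\kappa\in(0,1)$ such that $\sum_{i\in\mathbb Z}\sum_{k=1}^m|i|^{\frac12+\frac1{2\kappa}}\delta_i((X_t^k)_{t\in\mathbb Z})<\infty$ and $b_n/\ell_n^{1-\kappa}\to0$. Let $$Z_n=\frac1{\sqrt{\ell_n}}\sum_{k=1}^m\frac{\partial g}{\partial x_k}(v_0)\sum_{t=1}^{\ell_n}\big(X_t^k-E[X_1^k]\big)$$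 and let $Z_n'$ be an independent copy of $Z_n$. Then $h(Z_n,Z_n')$ is integrable for every $n$, and $$\sqrt{b_n}\,\big(U_n-E[h(Z_n,Z_n')]\big)\longrightarrow N(0,4\gamma^2)\quad\text{in distribution},$$ where $\gamma^2=\mathrm{Cov}\big(h(\sigma N,\sigma N'),h(\sigma N',\sigma N'')\big)\ge 0$ for independent standard normal $N,N',N''$ (and $N(0,0)$ is the point mass at $0$). -/

import Mathlib

open MeasureTheory ProbabilityTheory Filter Topology

noncomputable section

namespace BlockUStat

/-- The Bernoulli shift `X_t = f((ε_{t-u})_{u ∈ ℤ})`. -/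
def shift {Ω : Type*} (f : (ℤ → ℝ) → ℝ) (ε : ℤ → Ω → ℝ) (t : ℤ) (ω : Ω) : ℝ :=
  f (fun u => ε (t - u) ω)

/-- The physical dependence measure `δ_i` of the process `F((ε_{t-u})_{u ∈ ℤ})`, `t ∈ ℤ`: the
`L²` distance between its value at time `0` and the value obtained when `ε_i` is replaced by
`ε'_i`. On the product space the innovations are `ε_u(p.1)`, and `ε'_u = ε_u(p.2)` is an
independent copy of them. -/
def physDep {Ω : Type*} [MeasurableSpace Ω] (P : Measure Ω) (ε : ℤ → Ω → ℝ)
    (F : (ℤ → ℝ) → ℝ) (i : ℤ) : ENNReal :=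
  eLpNorm (fun p : Ω × Ω =>
    F (fun u => ε (-u) p.1) - F (fun u => if -u = i then ε i p.2 else ε (-u) p.1)) 2 (P.prod P)

/-- `v₀ = (E[X_1^k])_{k=1}^m`; the index `k : Fin m` stands for the exponent `k + 1`. -/
def momentVec {Ω : Type*} [MeasurableSpace Ω] (P : Measure Ω) (m : ℕ) (X : ℤ → Ω → ℝ) :
    Fin m → ℝ :=
  fun k => ∫ ω, X 1 ω ^ ((k : ℕ) + 1) ∂P

/-- The partial derivative `∂g/∂x_k` at `x`. -/
def partialDeriv {m : ℕ} (g : (Fin m → ℝ) → ℝ) (k : Fin m) (x : Fin m → ℝ) : ℝ :=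
  lineDeriv ℝ g x (Pi.single k 1)

/-- The block `{(j-1)ℓ + 1, …, jℓ}`. -/
def block (l : ℕ) (j : ℤ) : Finset ℤ :=
  Finset.Icc ((j - 1) * (l : ℤ) + 1) (j * (l : ℤ))

/-- The normalised block statistic
`W_j = √ℓ g((1/ℓ) ∑_{t ∈ B_j} X_t, …, (1/ℓ) ∑_{t ∈ B_j} X_t^m)` for blocks of length `ℓ`. -/
def blockStat {Ω : Type*} {m : ℕ} (g : (Fin m → ℝ) → ℝ) (X : ℤ → Ω → ℝ) (l : ℕ) (j : ℤ)
    (ω : Ω) : ℝ :=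
  √(l : ℝ) * g (fun k => (1 / (l : ℝ)) * ∑ t ∈ block l j, X t ω ^ ((k : ℕ) + 1))

/-- The U-statistic `(1/(b(b-1))) ∑_{1 ≤ j ≠ k ≤ b} h(W_j, W_k)` over `b` blocks of length `ℓ`. -/
def uStat {Ω : Type*} {m : ℕ} (h : ℝ → ℝ → ℝ) (g : (Fin m → ℝ) → ℝ) (X : ℤ → Ω → ℝ)
    (b l : ℕ) (ω : Ω) : ℝ :=
  (1 / ((b : ℝ) * ((b : ℝ) - 1))) *
    ∑ p ∈ (Finset.Icc (1 : ℤ) (b : ℤ)).offDiag,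
      h (blockStat g X l p.1 ω) (blockStat g X l p.2 ω)

/-- The linearised process `∑_{k=1}^m (∂g/∂x_k)(v₀) X_t^k`. -/
def linProc {Ω : Type*} [MeasurableSpace Ω] (P : Measure Ω) {m : ℕ} (g : (Fin m → ℝ) → ℝ)
    (X : ℤ → Ω → ℝ) (t : ℤ) (ω : Ω) : ℝ :=
  ∑ k : Fin m, partialDeriv g k (momentVec P m X) * X t ω ^ ((k : ℕ) + 1)

/-- The long-run variance `σ² = ∑_{t ∈ ℤ} Cov(Y_0, Y_t)` of the linearised process `Y`. -/
def sigmaSq {Ω : Type*} [MeasurableSpace Ω] (P : Measure Ω) {m : ℕ} (g : (Fin m → ℝ) → ℝ)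
    (X : ℤ → Ω → ℝ) : ℝ :=
  ∑' t : ℤ, covariance (linProc P g X 0) (linProc P g X t) P

/-- The linearised normalised block sum
`Z = ℓ^{-1/2} ∑_{k=1}^m (∂g/∂x_k)(v₀) ∑_{t=1}^ℓ (X_t^k - E[X_1^k])`. -/
def linSum {Ω : Type*} [MeasurableSpace Ω] (P : Measure Ω) {m : ℕ} (g : (Fin m → ℝ) → ℝ)
    (X : ℤ → Ω → ℝ) (l : ℕ) (ω : Ω) : ℝ :=
  (1 / √(l : ℝ)) * ∑ k : Fin m, partialDeriv g k (momentVec P m X) *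
    ∑ t ∈ Finset.Icc (1 : ℤ) (l : ℤ), (X t ω ^ ((k : ℕ) + 1) - momentVec P m X k)

/-- `γ² = Cov(h(sN, sN'), h(sN', sN''))` for independent standard normal `N, N', N''`, realised
as the coordinates of `ℝ³` under the product of three standard normal laws. -/
def gammaSq (h : ℝ → ℝ → ℝ) (s : ℝ) : ℝ :=
  covariance (fun x : Fin 3 → ℝ => h (s * x 0) (s * x 1))
    (fun x : Fin 3 → ℝ => h (s * x 1) (s * x 2))
    (Measure.pi (fun _ : Fin 3 => gaussianReal 0 1))

end BlockUStat

end

namespace BlockUStat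

open scoped ENNReal

/-! Everything is transported to the space of innovation sequences, where the process is one
functional composed with the shift. All couplings are reindexings of a larger family of independent
coordinates, so that sequences reading disjoint sets of coordinates are independent.

The quantitative core is `eLpNorm_exchange_partSum_le`. If innovations outside an interval of times
are replaced by fresh copies, lag `i` feels the change only at times `t` for which `t + i` leaves
the interval, and there are at most `|i|` of them. A sum over the interval therefore changes in `L²`
by at most `D = ∑ i² δ_i`, whatever its length, and by at most `D / (g + 1)` if a margin `g` is also
left untouched. Three consequences follow. Autocovariances decay like `1 / t²`, so variances of
normalised sums converge to the long-run variance. Normalised sums satisfy a central limit theorem,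
by Bernstein blocking for bounded functionals and by truncation in general
(`tendsto_charFun_normSum`). Adjacent normalised block sums lie within `D / √ℓ` of independent
variables with the same law, without any gap between blocks; as `h` is Lipschitz, `√b` times the
U-statistic then moves by `O(√(b/ℓ))`, which tends to zero (`tendsto_charFun_uAvg_blockSum`).

For independent blocks, Hoeffding's decomposition splits the U-statistic into a sum of i.i.d.
projections and a degenerate part. The summands of the latter are orthogonal up to swapping the
pair, so after scaling it is `O(b^{-1/2})` in `L²`. The projections depend on the law of `Z_n`,
which varies with `n`, so Lindeberg's theorem for arrays is used (`tendsto_charFun_uAvg`). Because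
`h` grows at most linearly, weak convergence of the laws together with their second moments gives
both convergence of the variances and the tail condition. The centring `E[h(Z_n, Z_n')]` is exactly
the mean for the independent blocks, so no bias has to be estimated.

It remains to pass from `W_{n,j}` to its linear part. Differentiability of the partial derivatives
at `v₀` gives a quadratic remainder near `v₀`. The squared deviations of the block averages, summed
over all `b` blocks, have mean `O(b/ℓ)`. Hence with probability tending to one every block average
lies in the Taylor region, and the total remainder is again `O(√(b/ℓ))` in probability
(`tendstoInMeasure_uAvg_linearisation`). -/

/-- The law of an i.i.d. family with marginal law `μ`, on the space of all families. -/
noncomputable abbrev iidLaw (ι : Type*) (μ : Measure ℝ) : Measure (ι → ℝ) :=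
  Measure.infinitePi fun _ => μ

/-- The `L²` size of the change of `G` when the coordinate `i` is replaced by an independent
copy. -/
noncomputable def dep (μ : Measure ℝ) (G : (ℤ → ℝ) → ℝ) (i : ℤ) : ℝ≥0∞ :=
  eLpNorm (fun p : (ℤ → ℝ) × ℝ => G p.1 - G (Function.update p.1 i p.2)) 2
    ((iidLaw ℤ μ).prod μ)

/-! ### Coupling by reindexing, and the cost of exchanging innovations -/

section Coupling

variable {ι : Type*} {μ : Measure ℝ} [IsProbabilityMeasure μ]

/-- Distinct coordinates of an i.i.d. family again form an i.i.d. family. A larger index set `ι`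
thus provides any number of independent copies of the innovations, and a coupling is just a choice
of injections `ℤ → ι`. -/
lemma measurePreserving_reindex {α : Type*} {e : α → ι} (he : e.Injective) :
    MeasurePreserving (fun (ω : ι → ℝ) a => ω (e a)) (iidLaw ι μ) (iidLaw α μ) :=
  ⟨by fun_prop, Measure.map_infinitePi_infinitePi_of_inj he⟩

lemma iIndepFun_coord : iIndepFun (fun (i : ι) (ω : ι → ℝ) => ω i) (iidLaw ι μ) :=
  iIndepFun_infinitePi (X := fun (_ : ι) (x : ℝ) => x) (fun _ => measurable_id)

lemma comap_reindex_le {α : Type*} (e : α → ι) :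
    MeasurableSpace.comap (fun (ω : ι → ℝ) a => ω (e a)) MeasurableSpace.pi ≤
      ⨆ i ∈ Set.range e, MeasurableSpace.comap (fun ω : ι → ℝ => ω i) inferInstance := by
  simp only [MeasurableSpace.pi, MeasurableSpace.comap_iSup]
  refine iSup_le fun a => ?_
  rw [MeasurableSpace.comap_comp]
  exact le_iSup₂_of_le (e a) ⟨a, rfl⟩ le_rfl

lemma indepFun_reindex {α β : Type*} (e : α → ι) (e' : β → ι)
    (h : ∀ a b, e a ≠ e' b) :
    IndepFun (fun (ω : ι → ℝ) a => ω (e a)) (fun (ω : ι → ℝ) b => ω (e' b)) (iidLaw ι μ) := by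
  have hm : ∀ i : ι, MeasurableSpace.comap (fun ω : ι → ℝ => ω i) inferInstance
      ≤ (MeasurableSpace.pi : MeasurableSpace (ι → ℝ)) := fun i =>
    (measurable_pi_apply i).comap_le
  have key := indep_iSup_of_disjoint hm (iIndepFun_coord (ι := ι) (μ := μ))
    (S := Set.range e) (T := Set.range e') (by
      rw [Set.disjoint_left]
      rintro _ ⟨a, rfl⟩ ⟨b, hb⟩
      exact h a b hb.symm)
  rw [IndepFun_iff_Indep]
  exact indep_of_indep_of_le_left (indep_of_indep_of_le_right key (comap_reindex_le e'))
    (comap_reindex_le e)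

lemma measurePreserving_reindex_prod {e : ℤ → ι} (he : e.Injective) {c : ι}
    (hc : ∀ u, e u ≠ c) :
    MeasurePreserving (fun ω : ι → ℝ => ((fun u => ω (e u)), ω c)) (iidLaw ι μ)
      ((iidLaw ℤ μ).prod μ) := by
  refine ⟨by fun_prop, ?_⟩
  have h1 : IndepFun (fun (ω : ι → ℝ) u => ω (e u)) (fun ω : ι → ℝ => ω c) (iidLaw ι μ) :=
    (indepFun_reindex e (fun _ : Unit => c) (fun a _ => hc a)).comp measurable_id
      (measurable_pi_apply ())
  rw [h1.map_prod_eq_prod_map_map (Measurable.aemeasurable (by fun_prop))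
    (Measurable.aemeasurable (by fun_prop)), (measurePreserving_reindex he).map_eq,
    Measure.infinitePi_map_eval]

/-- Since `c` is not in the range of `e`, the coordinate `ω c` is an innovation independent of the
whole sequence `ω ∘ e`, which is the situation in the definition of `dep`. -/
lemma eLpNorm_reindex_update {G : (ℤ → ℝ) → ℝ} (hG : Measurable G) {e : ℤ → ι}
    (he : e.Injective) {c : ι} (hc : ∀ u, e u ≠ c) (i : ℤ) :
    eLpNorm (fun ω : ι → ℝ => G (fun u => ω (e u)) - G (fun u => ω (Function.update e i c u))) 2
      (iidLaw ι μ) = dep μ G i := by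
  rw [dep, ← eLpNorm_comp_measurePreserving (by fun_prop)
    (measurePreserving_reindex_prod (μ := μ) he hc)]
  congr 1
  funext ω
  simp only [Function.comp_apply]
  congr 2
  funext u
  rcases eq_or_ne u i with rfl | hu
  · simp
  · simp [Function.update_of_ne hu]

/-- Exchange of finitely many innovations, one at a time. -/
lemma eLpNorm_exchange_finset {G : (ℤ → ℝ) → ℝ} (hG : Measurable G) {e e' : ℤ → ι}
    [DecidableEq ι] (he : e.Injective) (he' : e'.Injective) (hee : ∀ u v, u ≠ v → e u ≠ e' v)
    (s : Finset ℤ) :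
    eLpNorm (fun ω : ι → ℝ => G (fun u => ω (e u)) - G (fun u => ω (if u ∈ s then e' u else e u)))
      2 (iidLaw ι μ) ≤ ∑ u ∈ s, if e u = e' u then 0 else dep μ G u := by
  induction s using Finset.induction_on with
  | empty => simp
  | insert a s ha ih =>
    set es : ℤ → ι := fun u => if u ∈ s then e' u else e u with hes
    -- Enlarging the exchanged set by `a` is a single further update, so the triangle inequality
    -- adds one dependence coefficient, or nothing if both index maps agree at `a`.
    have hup : (fun u => if u ∈ insert a s then e' u else e u) = Function.update es a (e' a) := by
      funext u
      rcases eq_or_ne u a with rfl | hu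
      · simp
      · simp [hes, hu]
    have hinj : es.Injective := by
      intro u v huv
      by_contra hne
      simp only [hes] at huv
      split_ifs at huv with h1 h2 h2
      · exact hne (he' huv)
      · exact hee v u (Ne.symm hne) huv.symm
      · exact hee u v hne huv
      · exact hne (he huv)
    have hstep : eLpNorm (fun ω : ι → ℝ => G (fun u => ω (es u)) -
        G (fun u => ω (Function.update es a (e' a) u))) 2 (iidLaw ι μ)
        ≤ if e a = e' a then 0 else dep μ G a := by
      split_ifs with h
      · have : Function.update es a (e' a) = es := by
          rw [Function.update_eq_self_iff]
          simp [hes, ha, h]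
        simp [this]
      · refine (eLpNorm_reindex_update hG hinj (fun u hu => ?_) a).le
        simp only [hes] at hu
        split_ifs at hu with h1
        · exact ha (he' hu ▸ h1)
        · rcases eq_or_ne u a with rfl | hua
          · exact h hu
          · exact hee u a hua hu
    have hsum : (fun ω : ι → ℝ => G (fun u => ω (e u)) -
        G (fun u => ω (if u ∈ insert a s then e' u else e u))) =
        (fun ω : ι → ℝ => G (fun u => ω (e u)) - G (fun u => ω (es u))) +
        (fun ω : ι → ℝ => G (fun u => ω (es u)) -
          G (fun u => ω (Function.update es a (e' a) u))) := by
      have := fun u => congrFun hup u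
      funext ω
      simp only [Pi.add_apply, ← this]
      ring
    rw [hsum, Finset.sum_insert ha, add_comm (ite _ _ _)]
    refine (eLpNorm_add_le (by fun_prop) (by fun_prop) (by norm_num)).trans ?_
    exact add_le_add ih hstep

/-- The filtration generated by the coordinates in `[-n, n]`. -/
noncomputable def coordFiltration : Filtration ℕ (MeasurableSpace.pi : MeasurableSpace (ℤ → ℝ)) where
  seq n := Filtration.piFinset (X := fun _ : ℤ => ℝ) (Finset.Icc (-(n : ℤ)) n)
  mono' n m hnm := Filtration.piFinset.mono (Finset.Icc_subset_Icc (by simpa using hnm)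
    (by simpa using hnm))
  le' _ := Filtration.piFinset.le _

lemma iSup_coordFiltration :
    (⨆ n, coordFiltration n) = (MeasurableSpace.pi : MeasurableSpace (ℤ → ℝ)) := by
  refine le_antisymm (iSup_le fun n => coordFiltration.le n) ?_
  change (⨆ u, MeasurableSpace.comap (fun x : ℤ → ℝ => x u) inferInstance) ≤ _
  refine iSup_le fun u => le_iSup_of_le u.natAbs ?_
  change _ ≤ MeasurableSpace.comap _ _
  have hu : u ∈ ((Finset.Icc (-(u.natAbs : ℤ)) u.natAbs : Finset ℤ) : Set ℤ) := by
    simp only [Finset.coe_Icc, Set.mem_Icc]; omega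
  simp only [MeasurableSpace.pi, MeasurableSpace.comap_iSup]
  refine le_iSup_of_le ⟨u, hu⟩ ?_
  rw [MeasurableSpace.comap_comp]
  rfl

/-- Lévy's martingale convergence theorem: `G` is the `L¹` limit of its conditional expectations on
the coordinates in `[-n, n]`, where both index maps agree. Both reindexings preserve the law, so the
error is at most twice the approximation error. -/
lemma tendsto_exchange {G : (ℤ → ℝ) → ℝ} (hG : Measurable G)
    (hGi : Integrable G (iidLaw ℤ μ)) {e' : ℤ → ι} (en : ℕ → ℤ → ι)
    (he' : e'.Injective) (hen : ∀ n, (en n).Injective)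
    (hagree : ∀ n : ℕ, ∀ u ∈ Finset.Icc (-(n : ℤ)) n, en n u = e' u) :
    Tendsto (fun n => eLpNorm (fun ω : ι → ℝ => G (fun u => ω (en n u)) - G (fun u => ω (e' u))) 1
      (iidLaw ι μ)) atTop (𝓝 0) := by
  have hlim := hGi.tendsto_eLpNorm_condExp (ℱ := coordFiltration)
    (by rw [iSup_coordFiltration]; exact hG.stronglyMeasurable)
  set H : ℕ → (ℤ → ℝ) → ℝ := fun n => (iidLaw ℤ μ)[G | coordFiltration n] with hH
  have hHm : ∀ n, Measurable (H n) := fun n =>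
    (stronglyMeasurable_condExp.mono (coordFiltration.le n)).measurable
  have hdep : ∀ n, DependsOn (H n) (Finset.Icc (-(n : ℤ)) n : Finset ℤ) := fun n =>
    StronglyMeasurable.dependsOn_of_piFinset (stronglyMeasurable_condExp)
  have hle : ∀ n, eLpNorm (fun ω : ι → ℝ => G (fun u => ω (en n u)) - G (fun u => ω (e' u))) 1
      (iidLaw ι μ) ≤ 2 * eLpNorm (H n - G) 1 (iidLaw ℤ μ) := by
    intro n
    have hsplit : (fun ω : ι → ℝ => G (fun u => ω (en n u)) - G (fun u => ω (e' u))) =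
        ((H n - G) ∘ fun (ω : ι → ℝ) u => ω (e' u)) -
        ((H n - G) ∘ fun (ω : ι → ℝ) u => ω (en n u)) := by
      funext ω
      have : H n (fun u => ω (en n u)) = H n (fun u => ω (e' u)) :=
        hdep n fun u hu => by rw [hagree n u (by simpa using hu)]
      simp only [Pi.sub_apply, Function.comp_apply, this]
      ring
    rw [hsplit]
    refine (eLpNorm_sub_le ?_ ?_ le_rfl).trans (le_of_eq ?_)
    · exact (((hHm n).sub hG).comp (by fun_prop)).aestronglyMeasurable
    · exact (((hHm n).sub hG).comp (by fun_prop)).aestronglyMeasurable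
    · rw [eLpNorm_comp_measurePreserving ((hHm n).sub hG).aestronglyMeasurable
        (measurePreserving_reindex he'),
        eLpNorm_comp_measurePreserving ((hHm n).sub hG).aestronglyMeasurable
        (measurePreserving_reindex (hen n)), two_mul]
  refine tendsto_of_tendsto_of_tendsto_of_le_of_le tendsto_const_nhds ?_ (fun _ => zero_le) hle
  have := ENNReal.Tendsto.const_mul (a := 2) hlim (Or.inr (by norm_num))
  simpa using this

/-- Exchanging the innovations on an arbitrary set of indices costs at most the sum of the
dependence coefficients over that set. -/
theorem eLpNorm_exchange_le [Countable ι] {G : (ℤ → ℝ) → ℝ} (hG : Measurable G)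
    [DecidableEq ι] (hGi : Integrable G (iidLaw ℤ μ)) {e e' : ℤ → ι} (he : e.Injective)
    (he' : e'.Injective) (hee : ∀ u v, u ≠ v → e u ≠ e' v) :
    eLpNorm (fun ω : ι → ℝ => G (fun u => ω (e u)) - G (fun u => ω (e' u))) 2 (iidLaw ι μ)
      ≤ ∑' u, if e u = e' u then 0 else dep μ G u := by
  set en : ℕ → ℤ → ι := fun n u => if u ∈ Finset.Icc (-(n : ℤ)) n then e' u else e u with hen
  have hinj : ∀ n, (en n).Injective := by
    intro n u v huv
    by_contra hne
    simp only [hen] at huv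
    split_ifs at huv with h1 h2 h2
    · exact hne (he' huv)
    · exact hee v u (Ne.symm hne) huv.symm
    · exact hee u v hne huv
    · exact hne (he huv)
  have hlim := tendsto_exchange hG hGi en he' hinj (fun n u hu => by simp only [hen, if_pos hu])
  -- The finite exchanges are bounded uniformly in `n`; they converge in `L¹`, hence in measure, and
  -- the `L²` norm is lower semicontinuous under convergence in measure.
  refine eLpNorm_le_of_tendstoInMeasure (u := atTop)
    (f := fun n (ω : ι → ℝ) => G (fun u => ω (e u)) - G (fun u => ω (en n u)))
    (Eventually.of_forall fun n => ?_) ?_ (fun n => by fun_prop)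
  · exact (eLpNorm_exchange_finset hG he he' hee _).trans (ENNReal.sum_le_tsum _)
  · refine tendstoInMeasure_of_tendsto_eLpNorm (p := 1) (by norm_num)
      (fun n => by fun_prop) (by fun_prop) ?_
    refine hlim.congr fun n => ?_
    rw [← eLpNorm_neg]
    congr 1
    funext ω
    simp

end Coupling

end BlockUStat

namespace BlockUStat

open scoped ENNReal

/-! ### Preliminaries on `L²` norms, variances and covariances -/

section L2

variable {α : Type*} [MeasurableSpace α] {ν : Measure α}

lemma lpNorm_two_sq {f : α → ℝ} (hf : MemLp f 2 ν) : lpNorm f 2 ν ^ 2 = ∫ x, f x ^ 2 ∂ν := by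
  rw [lpNorm_eq_integral_norm_rpow_toReal (by norm_num) (by norm_num) hf.aestronglyMeasurable]
  simp only [ENNReal.toReal_ofNat, Real.norm_eq_abs, Real.rpow_two, sq_abs]
  rw [← Real.rpow_natCast, ← Real.rpow_mul (integral_nonneg fun _ => sq_nonneg _)]
  norm_num

lemma integral_abs_le_lpNorm_two [IsProbabilityMeasure ν] {f : α → ℝ} (hf : MemLp f 2 ν) :
    ∫ x, |f x| ∂ν ≤ lpNorm f 2 ν := by
  have h := lpNorm_one_eq_integral_norm hf.aestronglyMeasurable
  simp only [Real.norm_eq_abs] at h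
  rw [← h, ← toReal_eLpNorm hf.aestronglyMeasurable, ← toReal_eLpNorm hf.aestronglyMeasurable]
  exact ENNReal.toReal_mono hf.eLpNorm_ne_top
    (eLpNorm_le_eLpNorm_of_exponent_le (by norm_num) hf.aestronglyMeasurable)

lemma lpNorm_const_mul (c : ℝ) (f : α → ℝ) : lpNorm (fun x => c * f x) 2 ν = |c| * lpNorm f 2 ν := by
  have := lpNorm_const_smul (p := 2) c f ν
  rw [coe_nnnorm, Real.norm_eq_abs] at this
  exact this

lemma lpNorm_reindex {β : Type*} [MeasurableSpace β] {η : Measure β} {φ : β → α}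
    (hφ : MeasurePreserving φ η ν) {f : α → ℝ} (hf : AEStronglyMeasurable f ν) :
    lpNorm (fun x => f (φ x)) 2 η = lpNorm f 2 ν := by
  change lpNorm (f ∘ φ) 2 η = _
  rw [← toReal_eLpNorm (hf.comp_measurePreserving hφ), ← toReal_eLpNorm hf]
  congr 1
  exact eLpNorm_comp_measurePreserving hf hφ

lemma variance_le_lpNorm_sq [IsProbabilityMeasure ν] {f : α → ℝ} (hf : MemLp f 2 ν) :
    Var[f; ν] ≤ lpNorm f 2 ν ^ 2 := by
  rw [lpNorm_two_sq hf]
  exact variance_le_expectation_sq hf.aestronglyMeasurable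

lemma abs_covariance_le_sqrt [IsProbabilityMeasure ν] {X Y : α → ℝ} (hX : MemLp X 2 ν)
    (hY : MemLp Y 2 ν) : |cov[X, Y; ν]| ≤ √(Var[X; ν]) * √(Var[Y; ν]) := by
  have hX' : MemLp (fun x => X x - ∫ y, X y ∂ν) 2 ν := hX.sub (memLp_const _)
  have hY' : MemLp (fun x => Y x - ∫ y, Y y ∂ν) 2 ν := hY.sub (memLp_const _)
  have h := integral_mul_norm_le_Lp_mul_Lq (μ := ν) (p := 2) (q := 2)
    Real.HolderConjugate.two_two (f := fun x => X x - ∫ y, X y ∂ν)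
    (g := fun x => Y x - ∫ y, Y y ∂ν) (by simpa using hX') (by simpa using hY')
  rw [variance_eq_integral hX.aemeasurable, variance_eq_integral hY.aemeasurable,
    Real.sqrt_eq_rpow, Real.sqrt_eq_rpow]
  simp only [Real.norm_eq_abs, Real.rpow_two, sq_abs] at h
  refine le_trans ?_ h
  rw [covariance]
  refine (abs_integral_le_integral_abs).trans (le_of_eq ?_)
  simp_rw [abs_mul]

lemma abs_covariance_le [IsProbabilityMeasure ν] {X Y : α → ℝ} (hX : MemLp X 2 ν)
    (hY : MemLp Y 2 ν) : |cov[X, Y; ν]| ≤ lpNorm X 2 ν * lpNorm Y 2 ν := by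
  refine (abs_covariance_le_sqrt hX hY).trans ?_
  have h1 := Real.sqrt_le_sqrt (variance_le_lpNorm_sq hX)
  have h2 := Real.sqrt_le_sqrt (variance_le_lpNorm_sq hY)
  rw [Real.sqrt_sq lpNorm_nonneg] at h1 h2
  exact mul_le_mul h1 h2 (Real.sqrt_nonneg _) lpNorm_nonneg

lemma covariance_comp_measurePreserving {β : Type*} [MeasurableSpace β] {η : Measure β}
    {φ : β → α} (hφ : MeasurePreserving φ η ν) {X Y : α → ℝ} (hX : Measurable X)
    (hY : Measurable Y) : cov[fun x => X (φ x), fun x => Y (φ x); η] = cov[X, Y; ν] := by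
  rw [← hφ.map_eq, covariance_map hX.aestronglyMeasurable hY.aestronglyMeasurable
    hφ.measurable.aemeasurable]
  rfl

/-- The triangle inequality for standard deviations, from Cauchy-Schwarz for the covariance. -/
lemma abs_sqrt_variance_sub_le [IsProbabilityMeasure ν] {X Y : α → ℝ} (hX : MemLp X 2 ν)
    (hY : MemLp Y 2 ν) : √(Var[X + Y; ν]) ≤ √(Var[X; ν]) + √(Var[Y; ν]) := by
  rw [variance_add hX hY]
  refine Real.sqrt_le_iff.mpr ⟨by positivity, ?_⟩
  have h := (le_abs_self _).trans (abs_covariance_le_sqrt hX hY)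
  nlinarith [Real.sq_sqrt (variance_nonneg X ν), Real.sq_sqrt (variance_nonneg Y ν)]

end L2

/-! ### Stationary sequences and the effect of distant innovations on sums -/

/-- The shift of a sequence. -/
def shiftSeq (t : ℤ) (x : ℤ → ℝ) : ℤ → ℝ := fun u => x (t + u)

/-- The sum of the stationary process `G ∘ shiftSeq t` over a finite set of times. -/
noncomputable def partSum (G : (ℤ → ℝ) → ℝ) (A : Finset ℤ) (x : ℤ → ℝ) : ℝ :=
  ∑ t ∈ A, G (shiftSeq t x)

/-- The weighted sum `∑ i² δ_i` of the dependence coefficients. -/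
noncomputable def totalDep (μ : Measure ℝ) (G : (ℤ → ℝ) → ℝ) : ℝ≥0∞ :=
  ∑' i : ℤ, ENNReal.ofReal ((i : ℝ) ^ 2) * dep μ G i

@[fun_prop]
lemma measurable_shiftSeq (t : ℤ) : Measurable (shiftSeq t) := by
  unfold shiftSeq; fun_prop

@[fun_prop]
lemma measurable_partSum {G : (ℤ → ℝ) → ℝ} (hG : Measurable G) (A : Finset ℤ) :
    Measurable (partSum G A) := by
  unfold partSum; fun_prop

section Stationary

variable {ι : Type*} {μ : Measure ℝ} [IsProbabilityMeasure μ]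

lemma measurePreserving_shiftSeq (t : ℤ) :
    MeasurePreserving (shiftSeq t) (iidLaw ℤ μ) (iidLaw ℤ μ) :=
  measurePreserving_reindex (add_right_injective t)

lemma memLp_shift {G : (ℤ → ℝ) → ℝ} (hG2 : MemLp G 2 (iidLaw ℤ μ)) (t : ℤ) :
    MemLp (fun x => G (shiftSeq t x)) 2 (iidLaw ℤ μ) :=
  hG2.comp_measurePreserving (measurePreserving_shiftSeq t)

lemma memLp_partSum {G : (ℤ → ℝ) → ℝ} (hG2 : MemLp G 2 (iidLaw ℤ μ)) (A : Finset ℤ) :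
    MemLp (partSum G A) 2 (iidLaw ℤ μ) :=
  memLp_finsetSum _ fun t _ => memLp_shift hG2 t

lemma eLpNorm_exchange_shift_le [Countable ι] {G : (ℤ → ℝ) → ℝ} (hG : Measurable G)
    [DecidableEq ι] (hGi : Integrable G (iidLaw ℤ μ)) {e e' : ℤ → ι} (he : e.Injective)
    (he' : e'.Injective) (hee : ∀ u v, u ≠ v → e u ≠ e' v) (t : ℤ) :
    eLpNorm (fun ω : ι → ℝ => G (shiftSeq t fun u => ω (e u)) - G (shiftSeq t fun u => ω (e' u))) 2
      (iidLaw ι μ) ≤ ∑' i, if e (t + i) = e' (t + i) then 0 else dep μ G i :=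
  eLpNorm_exchange_le hG hGi (e := fun i => e (t + i)) (e' := fun i => e' (t + i))
    (he.comp (add_right_injective t)) (he'.comp (add_right_injective t))
    (fun u v huv => hee _ _ (by simpa using huv))

lemma ofReal_intCast_sq (i : ℤ) : ENNReal.ofReal ((i : ℝ) ^ 2) = ((i.natAbs ^ 2 : ℕ) : ℝ≥0∞) := by
  rw [← ENNReal.ofReal_natCast]
  congr 1
  push_cast
  rw [Nat.cast_natAbs, Int.cast_abs, sq_abs]

/-- If the innovations are unchanged within distance `r` of the time `t`, the value at time `t`
changes by at most `D / r²`. -/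
lemma eLpNorm_exchange_time_le [Countable ι] {G : (ℤ → ℝ) → ℝ} (hG : Measurable G)
    [DecidableEq ι] (hGi : Integrable G (iidLaw ℤ μ)) {e e' : ℤ → ι} (he : e.Injective)
    (he' : e'.Injective) (hee : ∀ u v, u ≠ v → e u ≠ e' v) (t : ℤ) (r : ℕ)
    (hr : ∀ i : ℤ, i.natAbs < r → e (t + i) = e' (t + i)) :
    eLpNorm (fun ω : ι → ℝ => G (shiftSeq t fun u => ω (e u)) - G (shiftSeq t fun u => ω (e' u))) 2
      (iidLaw ι μ) * ((r ^ 2 : ℕ) : ℝ≥0∞) ≤ totalDep μ G := by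
  refine (mul_le_mul_left (eLpNorm_exchange_shift_le hG hGi he he' hee t) _).trans ?_
  rw [← ENNReal.tsum_mul_right]
  refine ENNReal.tsum_le_tsum fun i => ?_
  split_ifs with h
  · simp
  · rw [mul_comm, ofReal_intCast_sq]
    gcongr
    by_contra hlt
    exact h (hr i (not_le.mp hlt))

/-- A shift by at most `g` cannot leave the enlarged interval. A longer shift pushes out at most
`|i|` times, all at one end, and then `g + 1 ≤ |i|`. This product of two factors `|i|` is the source
of the weight `i²`. -/
lemma card_exit_le (a c : ℤ) (g : ℕ) (i : ℤ) :
    ((Finset.Icc a c).filter fun t => t + i ∉ Finset.Icc (a - g) (c + g)).card * (g + 1)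
      ≤ i.natAbs ^ 2 := by
  set F := (Finset.Icc a c).filter fun t => t + i ∉ Finset.Icc (a - g) (c + g) with hF
  by_cases hi : i.natAbs ≤ g
  · have : F = ∅ := by
      rw [hF, Finset.filter_eq_empty_iff]
      intro t ht
      simp only [Finset.mem_Icc, not_not] at ht ⊢
      omega
    simp [this]
  · push Not at hi
    have hcard : F.card ≤ i.natAbs := by
      rcases le_total 0 i with h0 | h0
      · have hsub : F ⊆ Finset.Ioc (c - i) c := by
          intro t ht
          simp only [hF, Finset.mem_filter, Finset.mem_Icc, Finset.mem_Ioc] at ht ⊢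
          omega
        refine (Finset.card_le_card hsub).trans ?_
        rw [Int.card_Ioc]; omega
      · have hsub : F ⊆ Finset.Ico a (a - i) := by
          intro t ht
          simp only [hF, Finset.mem_filter, Finset.mem_Icc, Finset.mem_Ico] at ht ⊢
          omega
        refine (Finset.card_le_card hsub).trans ?_
        rw [Int.card_Ico]; omega
    calc F.card * (g + 1) ≤ i.natAbs * i.natAbs := Nat.mul_le_mul hcard hi
      _ = i.natAbs ^ 2 := (sq _).symm

/-- If the innovations are unchanged in the `g`-neighbourhood of an interval of times, the sum over
this interval changes by at most `D / (g + 1)`. -/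
theorem eLpNorm_exchange_partSum_le [Countable ι] {G : (ℤ → ℝ) → ℝ} (hG : Measurable G)
    [DecidableEq ι] (hGi : Integrable G (iidLaw ℤ μ)) {e e' : ℤ → ι} (he : e.Injective)
    (he' : e'.Injective) (hee : ∀ u v, u ≠ v → e u ≠ e' v) (a c : ℤ) (g : ℕ)
    (hg : ∀ u ∈ Finset.Icc (a - g) (c + g), e u = e' u) :
    eLpNorm (fun ω : ι → ℝ => partSum G (Finset.Icc a c) (fun u => ω (e u)) -
      partSum G (Finset.Icc a c) (fun u => ω (e' u))) 2 (iidLaw ι μ) * ((g + 1 : ℕ) : ℝ≥0∞)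
      ≤ totalDep μ G := by
  have h1 : eLpNorm (fun ω : ι → ℝ => partSum G (Finset.Icc a c) (fun u => ω (e u)) -
      partSum G (Finset.Icc a c) (fun u => ω (e' u))) 2 (iidLaw ι μ) ≤
      ∑ t ∈ Finset.Icc a c, ∑' i, if e (t + i) = e' (t + i) then 0 else dep μ G i := by
    have : (fun ω : ι → ℝ => partSum G (Finset.Icc a c) (fun u => ω (e u)) -
        partSum G (Finset.Icc a c) (fun u => ω (e' u))) = ∑ t ∈ Finset.Icc a c, fun ω : ι → ℝ =>
        G (shiftSeq t fun u => ω (e u)) - G (shiftSeq t fun u => ω (e' u)) := by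
      funext ω
      simp only [partSum, Finset.sum_apply, Finset.sum_sub_distrib]
    rw [this]
    refine (eLpNorm_sum_le (fun t _ => by fun_prop) (by norm_num)).trans ?_
    exact Finset.sum_le_sum fun t _ => eLpNorm_exchange_shift_le hG hGi he he' hee t
  refine (mul_le_mul_left h1 _).trans ?_
  rw [← Summable.tsum_finsetSum (fun _ _ => ENNReal.summable), ← ENNReal.tsum_mul_right]
  refine ENNReal.tsum_le_tsum fun i => ?_
  have h2 : (∑ t ∈ Finset.Icc a c, if e (t + i) = e' (t + i) then 0 else dep μ G i) ≤
      (((Finset.Icc a c).filter fun t => t + i ∉ Finset.Icc (a - g) (c + g)).card : ℝ≥0∞) *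
        dep μ G i := by
    rw [← nsmul_eq_mul, ← Finset.sum_const, Finset.sum_filter]
    refine Finset.sum_le_sum fun t _ => ?_
    by_cases ht : t + i ∈ Finset.Icc (a - g) (c + g)
    · rw [if_pos (hg _ ht)]; exact zero_le
    · rw [if_pos ht]; split_ifs <;> simp
  calc _ ≤ (((Finset.Icc a c).filter fun t => t + i ∉ Finset.Icc (a - g) (c + g)).card : ℝ≥0∞) *
        dep μ G i * ((g + 1 : ℕ) : ℝ≥0∞) := mul_le_mul_left h2 _
    _ = ((((Finset.Icc a c).filter fun t => t + i ∉ Finset.Icc (a - g) (c + g)).card * (g + 1) : ℕ)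
        : ℝ≥0∞) * dep μ G i := by push_cast; ring
    _ ≤ _ := by
        rw [ofReal_intCast_sq]
        gcongr
        exact card_exit_le a c g i

end Stationary

end BlockUStat

/-! ### Autocovariances and the long-run variance -/

namespace BlockUStat

open scoped ENNReal

/-- The autocovariance function of the process `G ∘ shiftSeq t`. -/
noncomputable def autoCov (μ : Measure ℝ) (G : (ℤ → ℝ) → ℝ) (t : ℤ) : ℝ :=
  cov[G, fun x => G (shiftSeq t x); iidLaw ℤ μ]

lemma shiftSeq_shiftSeq (s t : ℤ) (x : ℤ → ℝ) :
    shiftSeq s (shiftSeq t x) = shiftSeq (t + s) x := by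
  funext u; simp only [shiftSeq, add_assoc]

lemma shiftSeq_zero (x : ℤ → ℝ) : shiftSeq 0 x = x := by
  funext u; simp [shiftSeq]

lemma toReal_le_div {a D : ℝ≥0∞} {n : ℕ} (hn : n ≠ 0) (hD : D ≠ ⊤) (h : a * (n : ℝ≥0∞) ≤ D) :
    a.toReal ≤ D.toReal / n := by
  have hn' : (0 : ℝ) < n := by exact_mod_cast Nat.pos_of_ne_zero hn
  rw [le_div_iff₀ hn']
  have := ENNReal.toReal_mono hD h
  simpa using this

section Stationary

variable {μ : Measure ℝ} [IsProbabilityMeasure μ] {G : (ℤ → ℝ) → ℝ}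

lemma cov_shift_shift (hG : Measurable G) (s t : ℤ) :
    cov[fun x => G (shiftSeq s x), fun x => G (shiftSeq t x); iidLaw ℤ μ] = autoCov μ G (t - s) := by
  rw [autoCov, ← covariance_comp_measurePreserving (measurePreserving_shiftSeq s) hG
    (by fun_prop)]
  simp only [shiftSeq_shiftSeq, add_sub_cancel]

lemma autoCov_neg (hG : Measurable G) (t : ℤ) : autoCov μ G (-t) = autoCov μ G t := by
  have h1 := cov_shift_shift (μ := μ) hG 0 t
  have h2 := cov_shift_shift (μ := μ) hG t 0
  rw [covariance_comm] at h2
  simp only [sub_zero, zero_sub] at h1 h2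
  rw [← h1, ← h2]

/-- The innovations are cut half-way between times `0` and `t`. The value at `0` receives a fresh
copy beyond the cut and the value at `t` another one up to the cut. The two modified values are
independent, and each modification costs at most `D / r²`, where `r` is about `t / 2`. -/
lemma abs_autoCov_natCast_le (hG : Measurable G) (hG2 : MemLp G 2 (iidLaw ℤ μ))
    (hD : totalDep μ G ≠ ⊤) (t : ℕ) (ht : 1 ≤ t) :
    |autoCov μ G t| ≤ 8 * lpNorm G 2 (iidLaw ℤ μ) * (totalDep μ G).toReal / (t : ℝ) ^ 2 := by
  have hGi : Integrable G (iidLaw ℤ μ) := hG2.integrable (by norm_num)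
  set s : ℤ := ((t / 2 : ℕ) : ℤ) with hs
  set r : ℕ := t - t / 2 with hr
  have hr0 : 1 ≤ r := by omega
  let e0 : ℤ → Fin 3 × ℤ := fun u => (0, u)
  let e1 : ℤ → Fin 3 × ℤ := fun u => (if u ≤ s then 0 else 1, u)
  let e2 : ℤ → Fin 3 × ℤ := fun u => (if s < u then 0 else 2, u)
  have h0 : e0.Injective := fun u v h => congrArg Prod.snd h
  have h1 : e1.Injective := fun u v h => congrArg Prod.snd h
  have h2 : e2.Injective := fun u v h => congrArg Prod.snd h
  have h01 : ∀ u v, u ≠ v → e0 u ≠ e1 v := fun u v huv h => huv (congrArg Prod.snd h)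
  have h02 : ∀ u v, u ≠ v → e0 u ≠ e2 v := fun u v huv h => huv (congrArg Prod.snd h)
  set Q := iidLaw (Fin 3 × ℤ) μ with hQ
  let X : (Fin 3 × ℤ → ℝ) → ℝ := fun ω => G fun u => ω (e0 u)
  let X' : (Fin 3 × ℤ → ℝ) → ℝ := fun ω => G fun u => ω (e1 u)
  let Y : (Fin 3 × ℤ → ℝ) → ℝ := fun ω => G (shiftSeq t fun u => ω (e0 u))
  let Y' : (Fin 3 × ℤ → ℝ) → ℝ := fun ω => G (shiftSeq t fun u => ω (e2 u))
  have hX : MemLp X 2 Q := hG2.comp_measurePreserving (measurePreserving_reindex h0)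
  have hX' : MemLp X' 2 Q := hG2.comp_measurePreserving (measurePreserving_reindex h1)
  have hY : MemLp Y 2 Q := (memLp_shift hG2 t).comp_measurePreserving (measurePreserving_reindex h0)
  have hY' : MemLp Y' 2 Q :=
    (memLp_shift hG2 t).comp_measurePreserving (measurePreserving_reindex h2)
  have hcov : autoCov μ G t = cov[X, Y; Q] :=
    (covariance_comp_measurePreserving (measurePreserving_reindex h0) hG (by fun_prop)).symm
  have hind : cov[X', Y'; Q] = 0 := by
    refine IndepFun.covariance_eq_zero ?_ hX' hY'
    refine (indepFun_reindex e1 e2 (fun u v h => ?_)).comp hG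
      (hG.comp (measurable_shiftSeq t))
    have huv : u = v := congrArg Prod.snd h
    have hf := congrArg Prod.fst h
    subst huv
    simp only [e1, e2] at hf
    by_cases hus : u ≤ s
    · rw [if_pos hus, if_neg (by omega)] at hf
      exact absurd hf (by decide)
    · rw [if_neg hus, if_pos (by omega)] at hf
      exact absurd hf (by decide)
  have hdec : cov[X, Y; Q] = cov[X - X', Y; Q] + cov[X', Y - Y'; Q] := by
    rw [covariance_sub_left hX hX' hY, covariance_sub_right hX' hY hY', hind]
    ring
  have hNX' : lpNorm X' 2 Q = lpNorm G 2 (iidLaw ℤ μ) :=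
    lpNorm_reindex (measurePreserving_reindex h1) hG.aestronglyMeasurable
  have hNY : lpNorm Y 2 Q = lpNorm G 2 (iidLaw ℤ μ) :=
    (lpNorm_reindex (measurePreserving_reindex h0) (f := fun x => G (shiftSeq t x))
      (Measurable.aestronglyMeasurable (by fun_prop))).trans
    (lpNorm_reindex (measurePreserving_shiftSeq t) hG.aestronglyMeasurable)
  have hr2 : r ^ 2 ≠ 0 := by positivity
  have hXX : lpNorm (X - X') 2 Q ≤ (totalDep μ G).toReal / ((r ^ 2 : ℕ) : ℝ) := by
    rw [← toReal_eLpNorm (hX.sub hX').aestronglyMeasurable]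
    refine toReal_le_div hr2 hD ?_
    have := eLpNorm_exchange_time_le hG hGi h0 h1 h01 0 r (fun i hi => by
      simp only [e0, e1]
      rw [if_pos (by omega)])
    simp only [shiftSeq_zero] at this
    exact this
  have hYY : lpNorm (Y - Y') 2 Q ≤ (totalDep μ G).toReal / ((r ^ 2 : ℕ) : ℝ) := by
    rw [← toReal_eLpNorm (hY.sub hY').aestronglyMeasurable]
    refine toReal_le_div hr2 hD ?_
    exact eLpNorm_exchange_time_le hG hGi h0 h2 h02 t r (fun i hi => by
      simp only [e0, e2]
      rw [if_pos (by omega)])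
  set N := lpNorm G 2 (iidLaw ℤ μ) with hN
  have hN0 : 0 ≤ N := lpNorm_nonneg
  set D := (totalDep μ G).toReal with hDdef
  have hD0 : 0 ≤ D := ENNReal.toReal_nonneg
  -- From `t ≤ 2r` comes the factor `4`; the two modifications together give `8`.
  have hrt : D / ((r ^ 2 : ℕ) : ℝ) ≤ 4 * D / (t : ℝ) ^ 2 := by
    have h2r : t ≤ 2 * r := by omega
    have h2r' : (t : ℝ) ≤ 2 * r := by exact_mod_cast h2r
    have ht' : (0 : ℝ) < t := by exact_mod_cast ht
    have hr' : (0 : ℝ) < r := by exact_mod_cast hr0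
    push_cast
    rw [div_le_div_iff₀ (by positivity) (by positivity)]
    nlinarith [mul_nonneg hD0 (sub_nonneg.mpr (mul_self_le_mul_self ht'.le h2r'))]
  rw [hcov, hdec]
  calc |cov[X - X', Y; Q] + cov[X', Y - Y'; Q]|
      ≤ |cov[X - X', Y; Q]| + |cov[X', Y - Y'; Q]| := abs_add_le _ _
    _ ≤ lpNorm (X - X') 2 Q * lpNorm Y 2 Q + lpNorm X' 2 Q * lpNorm (Y - Y') 2 Q :=
        add_le_add (abs_covariance_le (hX.sub hX') hY) (abs_covariance_le hX' (hY.sub hY'))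
    _ ≤ (4 * D / (t : ℝ) ^ 2) * N + N * (4 * D / (t : ℝ) ^ 2) := by
        rw [hNX', hNY]
        gcongr
        · exact hXX.trans hrt
        · exact hYY.trans hrt
    _ = 8 * N * D / (t : ℝ) ^ 2 := by ring

lemma abs_autoCov_le (hG : Measurable G) (hG2 : MemLp G 2 (iidLaw ℤ μ))
    (hD : totalDep μ G ≠ ⊤) (t : ℤ) (ht : t ≠ 0) :
    |autoCov μ G t| ≤ 8 * lpNorm G 2 (iidLaw ℤ μ) * (totalDep μ G).toReal * (1 / (t : ℝ) ^ 2) := by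
  have key := abs_autoCov_natCast_le hG hG2 hD t.natAbs (by omega)
  have h1 : autoCov μ G (t.natAbs : ℤ) = autoCov μ G t := by
    rcases Int.natAbs_eq t with h | h
    · rw [← h]
    · conv_rhs => rw [h]
      rw [autoCov_neg hG]
  have h2 : ((t.natAbs : ℕ) : ℝ) ^ 2 = (t : ℝ) ^ 2 := by
    rw [Nat.cast_natAbs, Int.cast_abs, sq_abs]
  rw [h1, h2] at key
  rwa [mul_one_div]

lemma summable_one_div_int_sq : Summable fun t : ℤ => 1 / (t : ℝ) ^ 2 :=
  Real.summable_one_div_int_pow.mpr (by norm_num)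

/-- At lag zero the second summand is `1 / 0 = 0` by convention, so the first one carries the whole
bound there. -/
lemma abs_autoCov_le' (hG : Measurable G) (hG2 : MemLp G 2 (iidLaw ℤ μ))
    (hD : totalDep μ G ≠ ⊤) (t : ℤ) :
    |autoCov μ G t| ≤ (if t = 0 then lpNorm G 2 (iidLaw ℤ μ) ^ 2 else 0) +
      8 * lpNorm G 2 (iidLaw ℤ μ) * (totalDep μ G).toReal * (1 / (t : ℝ) ^ 2) := by
  split_ifs with h
  · subst h
    simp only [Int.cast_zero, ne_eq, OfNat.ofNat_ne_zero, not_false_eq_true, zero_pow, div_zero,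
      mul_zero, add_zero]
    refine (abs_covariance_le hG2 (memLp_shift hG2 0)).trans (le_of_eq ?_)
    rw [lpNorm_reindex (measurePreserving_shiftSeq 0) hG.aestronglyMeasurable, sq]
  · rw [zero_add]
    exact abs_autoCov_le hG hG2 hD t h

lemma summable_autoCov (hG : Measurable G) (hG2 : MemLp G 2 (iidLaw ℤ μ))
    (hD : totalDep μ G ≠ ⊤) : Summable fun t => |autoCov μ G t| := by
  refine Summable.of_nonneg_of_le (fun _ => abs_nonneg _) (abs_autoCov_le' hG hG2 hD) ?_
  exact (summable_of_hasFiniteSupport ((Set.finite_singleton 0).subset fun t ht => by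
    by_contra h; simp at h; simp [h] at ht)).add (summable_one_div_int_sq.mul_left _)

/-- The factor `‖G‖₂` stands in front: the sum vanishes with `‖G‖₂` as long as `totalDep` stays
bounded. This is what controls the remainder of the truncation. -/
lemma tsum_abs_autoCov_le (hG : Measurable G) (hG2 : MemLp G 2 (iidLaw ℤ μ))
    (hD : totalDep μ G ≠ ⊤) :
    ∑' t, |autoCov μ G t| ≤ lpNorm G 2 (iidLaw ℤ μ) * (lpNorm G 2 (iidLaw ℤ μ) +
      8 * (totalDep μ G).toReal * ∑' t : ℤ, 1 / (t : ℝ) ^ 2) := by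
  have hs : HasSum (fun t : ℤ => (if t = 0 then lpNorm G 2 (iidLaw ℤ μ) ^ 2 else 0) +
      8 * lpNorm G 2 (iidLaw ℤ μ) * (totalDep μ G).toReal * (1 / (t : ℝ) ^ 2))
      (lpNorm G 2 (iidLaw ℤ μ) ^ 2 + 8 * lpNorm G 2 (iidLaw ℤ μ) * (totalDep μ G).toReal *
        ∑' t : ℤ, 1 / (t : ℝ) ^ 2) :=
    (hasSum_ite_eq (0 : ℤ) _).add (summable_one_div_int_sq.hasSum.mul_left _)
  refine (Summable.tsum_le_tsum (abs_autoCov_le' hG hG2 hD) (summable_autoCov hG hG2 hD)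
    hs.summable).trans (le_of_eq ?_)
  rw [hs.tsum_eq]
  ring

lemma variance_partSum (hG : Measurable G) (hG2 : MemLp G 2 (iidLaw ℤ μ)) (A : Finset ℤ) :
    Var[partSum G A; iidLaw ℤ μ] = ∑ s ∈ A, ∑ t ∈ A, autoCov μ G (t - s) := by
  have : partSum G A = fun x => ∑ t ∈ A, G (shiftSeq t x) := rfl
  rw [this, variance_fun_sum' (fun t _ => memLp_shift hG2 t)]
  simp_rw [cov_shift_shift hG]

/-- Arbitrary finite sets of times are allowed, since the times left over by Bernstein blocking do
not form an interval. -/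
lemma variance_partSum_le (hG : Measurable G) (hG2 : MemLp G 2 (iidLaw ℤ μ))
    (hD : totalDep μ G ≠ ⊤) (A : Finset ℤ) :
    Var[partSum G A; iidLaw ℤ μ] ≤ A.card * ∑' t, |autoCov μ G t| := by
  rw [variance_partSum hG hG2, ← nsmul_eq_mul, ← Finset.sum_const]
  refine Finset.sum_le_sum fun s _ => ?_
  have hs := summable_autoCov hG hG2 hD
  have : ∑ t ∈ A, |autoCov μ G (t - s)| = ∑ t ∈ A.map (Equiv.subRight s).toEmbedding,
      |autoCov μ G t| := by simp [Finset.sum_map]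
  refine (Finset.sum_le_sum fun t _ => le_abs_self _).trans ?_
  rw [this]
  exact hs.sum_le_tsum _ fun _ _ => abs_nonneg _

lemma tendsto_variance_partSum (hG : Measurable G) (hG2 : MemLp G 2 (iidLaw ℤ μ))
    (hD : totalDep μ G ≠ ⊤) :
    Tendsto (fun l : ℕ => Var[partSum G (Finset.Icc 1 (l : ℤ)); iidLaw ℤ μ] / l) atTop
      (𝓝 (∑' t, autoCov μ G t)) := by
  -- `c l d` counts the pairs of times at lag `d` inside `[1, l]`. It lies between `l - |d|` and
  -- `l`, so `c l d / l` tends to `1`, and dominated convergence over the lags applies.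
  let c : ℕ → ℤ → ℕ := fun l d => ((Finset.Icc 1 (l : ℤ)).filter fun s => s + d ∈ Finset.Icc 1 (l : ℤ)).card
  have hc1 : ∀ l d, c l d ≤ l := fun l d =>
    (Finset.card_filter_le _ _).trans (by rw [Int.card_Icc]; omega)
  have hc2 : ∀ l d, l ≤ c l d + d.natAbs := by
    intro l d
    rcases le_total 0 d with h | h
    · have hsub : Finset.Icc 1 ((l : ℤ) - d) ⊆
          ((Finset.Icc 1 (l : ℤ)).filter fun s => s + d ∈ Finset.Icc 1 (l : ℤ)) := by
        intro s hs
        simp only [Finset.mem_filter, Finset.mem_Icc] at hs ⊢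
        omega
      have := Finset.card_le_card hsub
      rw [Int.card_Icc] at this
      simp only [c]
      omega
    · have hsub : Finset.Icc (1 - d) (l : ℤ) ⊆
          ((Finset.Icc 1 (l : ℤ)).filter fun s => s + d ∈ Finset.Icc 1 (l : ℤ)) := by
        intro s hs
        simp only [Finset.mem_filter, Finset.mem_Icc] at hs ⊢
        omega
      have := Finset.card_le_card hsub
      rw [Int.card_Icc] at this
      simp only [c]
      omega
  have hvar : ∀ l : ℕ, Var[partSum G (Finset.Icc 1 (l : ℤ)); iidLaw ℤ μ] / l =
      ∑' d, (c l d / l : ℝ) * autoCov μ G d := by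
    intro l
    have hsum : ∀ s ∈ Finset.Icc 1 (l : ℤ), ∑ t ∈ Finset.Icc 1 (l : ℤ), autoCov μ G (t - s) =
        ∑ d ∈ Finset.Icc (-(l : ℤ)) l, if s + d ∈ Finset.Icc 1 (l : ℤ) then autoCov μ G d else 0 := by
      intro s hs
      rw [← Finset.sum_filter]
      refine Finset.sum_nbij' (fun t => t - s) (fun d => s + d) ?_ ?_ ?_ ?_ ?_
      · intro t ht
        simp only [Finset.mem_filter, Finset.mem_Icc] at hs ht ⊢
        omega
      · intro d hd
        simp only [Finset.mem_filter] at hd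
        exact hd.2
      · intro t _; simp
      · intro d _; simp
      · intro t _; rfl
    rw [variance_partSum hG hG2, Finset.sum_congr rfl hsum, Finset.sum_comm]
    rw [tsum_eq_sum (s := Finset.Icc (-(l : ℤ)) l), Finset.sum_div]
    · refine Finset.sum_congr rfl fun d _ => ?_
      rw [← Finset.sum_filter, Finset.sum_const, nsmul_eq_mul]
      ring
    · intro d hd
      have : c l d = 0 := by
        simp only [c, Finset.card_eq_zero, Finset.filter_eq_empty_iff]
        intro s hs
        simp only [Finset.mem_Icc] at hs hd ⊢
        omega
      simp [this]
  simp_rw [hvar]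
  refine tendsto_tsum_of_dominated_convergence (bound := fun d => |autoCov μ G d|)
    (summable_autoCov hG hG2 hD) (fun d => ?_) (Eventually.of_forall fun l d => ?_)
  · have hlim : Tendsto (fun l : ℕ => (c l d / l : ℝ)) atTop (𝓝 1) := by
      have hlow : Tendsto (fun l : ℕ => 1 - (d.natAbs : ℝ) / l) atTop (𝓝 1) := by
        have := tendsto_const_div_atTop_nhds_zero_nat (d.natAbs : ℝ)
        simpa using this.const_sub 1
      refine tendsto_of_tendsto_of_tendsto_of_le_of_le' hlow tendsto_const_nhds ?_ ?_
      · filter_upwards [eventually_gt_atTop 0] with l hl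
        have hl' : (0 : ℝ) < l := by exact_mod_cast hl
        have h2 : (l : ℝ) ≤ c l d + d.natAbs := by exact_mod_cast hc2 l d
        rw [le_div_iff₀ hl', sub_mul, div_mul_cancel₀ _ hl'.ne']
        linarith
      · filter_upwards [eventually_gt_atTop 0] with l hl
        have hl' : (0 : ℝ) < l := by exact_mod_cast hl
        rw [div_le_one hl']
        exact_mod_cast hc1 l d
    simpa using hlim.mul_const (autoCov μ G d)
  · rw [Real.norm_eq_abs, abs_mul]
    have h1 : |(c l d / l : ℝ)| ≤ 1 := by
      rw [abs_of_nonneg (by positivity)]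
      exact div_le_one_of_le₀ (by exact_mod_cast hc1 l d) (by positivity)
    exact mul_le_of_le_one_left (abs_nonneg _) h1

end Stationary

end BlockUStat

namespace BlockUStat

/-! ### Lindeberg's theorem through characteristic functions -/

section ArrayCLT

-- The crude quadratic bound serves on the tail, where `y` may be large; the cubic bound below
-- serves where `|y| ≤ 1`.
open Complex in
lemma norm_exp_mul_I_taylor_le (y : ℝ) :
    ‖exp (y * I) - (1 + y * I - (y ^ 2 / 2 : ℝ))‖ ≤ 4 * y ^ 2 := by
  rcases le_total |y| 1 with h | h
  · have := exp_bound (x := y * I) (by simpa using h) (n := 3) (by norm_num)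
    simp only [Finset.sum_range_succ, Finset.sum_range_zero, norm_mul, norm_real, norm_I] at this
    norm_num [mul_pow, Nat.factorial] at this
    have h2 : |y| ^ 3 ≤ y ^ 2 := by
      calc |y| ^ 3 = |y| ^ 2 * |y| := by ring
        _ ≤ |y| ^ 2 * 1 := by gcongr
        _ = y ^ 2 := by rw [mul_one, sq_abs]
    have e : (1 + (y : ℂ) * I - ((y ^ 2 / 2 : ℝ) : ℂ)) = 1 + (y : ℂ) * I + -(y : ℂ) ^ 2 / 2 := by
      push_cast; ring
    rw [e]
    nlinarith [sq_nonneg y]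
  · have h1 : ‖exp (y * I)‖ = 1 := norm_exp_ofReal_mul_I y
    have h2 : ‖(1 + y * I - (y ^ 2 / 2 : ℝ) : ℂ)‖ ≤ 1 + |y| + y ^ 2 / 2 := by
      refine (norm_sub_le _ _).trans (add_le_add ((norm_add_le _ _).trans ?_) ?_)
      · simp
      · rw [norm_real, Real.norm_eq_abs, abs_of_nonneg (by positivity)]
    have h3 : |y| ≤ y ^ 2 := by rw [← sq_abs]; nlinarith
    calc _ ≤ 1 + (1 + |y| + y ^ 2 / 2) := (norm_sub_le _ _).trans (add_le_add h1.le h2)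
      _ ≤ 4 * y ^ 2 := by nlinarith

open Complex in
lemma norm_exp_mul_I_taylor_le_cube {y : ℝ} (h : |y| ≤ 1) :
    ‖exp (y * I) - (1 + y * I - (y ^ 2 / 2 : ℝ))‖ ≤ |y| ^ 3 := by
  have := exp_bound (x := y * I) (by simpa using h) (n := 3) (by norm_num)
  simp only [Finset.sum_range_succ, Finset.sum_range_zero, norm_mul, norm_real, norm_I] at this
  norm_num [mul_pow, Nat.factorial] at this
  have e : (1 + (y : ℂ) * I - ((y ^ 2 / 2 : ℝ) : ℂ)) = 1 + (y : ℂ) * I + -(y : ℂ) ^ 2 / 2 := by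
    push_cast; ring
  rw [e]
  nlinarith [pow_nonneg (abs_nonneg y) 3]

/-- Telescoping in the closed unit disc; it reduces the comparison of products to that of a single
factor. -/
lemma norm_pow_sub_pow_le {z w : ℂ} (hz : ‖z‖ ≤ 1) (hw : ‖w‖ ≤ 1) (k : ℕ) :
    ‖z ^ k - w ^ k‖ ≤ k * ‖z - w‖ := by
  induction k with
  | zero => simp
  | succ k ih =>
    have : z ^ (k + 1) - w ^ (k + 1) = z ^ k * (z - w) + (z ^ k - w ^ k) * w := by ring
    rw [this]
    refine (norm_add_le _ _).trans ?_
    rw [norm_mul, norm_mul, norm_pow]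
    have h1 : ‖z‖ ^ k ≤ 1 := pow_le_one₀ (norm_nonneg _) hz
    push_cast
    nlinarith [norm_nonneg (z - w), norm_nonneg (z ^ k - w ^ k)]

/-- Second order expansion of the characteristic function of a centred law. -/
lemma norm_charFun_sub_le {ν : Measure ℝ} [IsProbabilityMeasure ν] (hmean : ∫ x, x ∂ν = 0)
    (hL2 : MemLp id 2 ν) (t : ℝ) {ε : ℝ} (hε0 : 0 < ε) (hε : |t| * ε ≤ 1) :
    ‖charFun ν t - (1 - (t ^ 2 * (∫ x, x ^ 2 ∂ν) / 2 : ℝ))‖ ≤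
      |t| ^ 3 * ε * (∫ x, x ^ 2 ∂ν) + 4 * t ^ 2 * ∫ x in {x | ε < |x|}, x ^ 2 ∂ν := by
  have hi1 : Integrable (fun x : ℝ => x) ν := hL2.integrable (by norm_num)
  have hi2 : Integrable (fun x : ℝ => x ^ 2) ν := hL2.integrable_sq
  have hms : MeasurableSet {x : ℝ | ε < |x|} := measurableSet_lt measurable_const (by fun_prop)
  have hexp : Integrable (fun x : ℝ => Complex.exp ((t * x : ℝ) * Complex.I)) ν := by
    refine Integrable.of_bound (C := 1) (by fun_prop) (ae_of_all _ fun x => ?_)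
    rw [Complex.norm_exp_ofReal_mul_I]
  have h1 : Integrable (fun x : ℝ => ((t * x : ℝ) : ℂ) * Complex.I) ν :=
    ((hi1.const_mul t).ofReal).mul_const _
  have h2 : Integrable (fun x : ℝ => (((t * x) ^ 2 / 2 : ℝ) : ℂ)) ν := by
    have : Integrable (fun x : ℝ => (t * x) ^ 2 / 2) ν :=
      (hi2.const_mul (t ^ 2 / 2)).congr (ae_of_all _ fun x => by ring)
    exact this.ofReal
  have h01 : Integrable (fun x : ℝ => (1 + (t * x : ℝ) * Complex.I : ℂ)) ν :=
    (integrable_const _).add h1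
  have hpoly : Integrable (fun x : ℝ => (1 + (t * x : ℝ) * Complex.I - ((t * x) ^ 2 / 2 : ℝ) : ℂ))
      ν := h01.sub h2
  have hval : ∫ x : ℝ, (1 + (t * x : ℝ) * Complex.I - ((t * x) ^ 2 / 2 : ℝ) : ℂ) ∂ν =
      1 - (t ^ 2 * (∫ x, x ^ 2 ∂ν) / 2 : ℝ) := by
    rw [integral_sub h01 h2, integral_add (integrable_const _) h1,
      integral_mul_const, integral_complex_ofReal, integral_complex_ofReal, integral_const_mul,
      hmean]
    have h3 : ∫ x : ℝ, (t * x) ^ 2 / 2 ∂ν = t ^ 2 * (∫ x, x ^ 2 ∂ν) / 2 := by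
      simp_rw [mul_pow]
      rw [integral_div, integral_const_mul]
    simp [h3]
  have hchar : charFun ν t = ∫ x : ℝ, Complex.exp ((t * x : ℝ) * Complex.I) ∂ν := by
    rw [charFun_apply_real]; push_cast; rfl
  rw [hchar, ← hval, ← integral_sub hexp hpoly]
  refine (norm_integral_le_integral_norm _).trans ?_
  rw [← integral_const_mul, ← integral_const_mul, ← integral_indicator hms, ← integral_add]
  rotate_left
  · exact hi2.const_mul _
  · exact (hi2.const_mul _).indicator hms
  refine integral_mono (hexp.sub hpoly).norm
    ((hi2.const_mul _).add ((hi2.const_mul _).indicator hms)) fun x => ?_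
  simp only [Set.indicator_apply, Set.mem_ofPred_eq]
  -- Beyond `ε` the quadratic Taylor bound is used; below `ε` one factor of the cube is estimated by
  -- `ε`.
  split_ifs with hx
  · refine (norm_exp_mul_I_taylor_le (t * x)).trans ?_
    have h0 : 0 ≤ |t| ^ 3 * ε * x ^ 2 := by positivity
    nlinarith
  · refine (norm_exp_mul_I_taylor_le_cube ?_).trans ?_
    · rw [abs_mul]
      exact (mul_le_mul_of_nonneg_left (not_lt.mp hx) (abs_nonneg t)).trans hε
    · rw [abs_mul, mul_pow, add_zero, mul_assoc]
      refine mul_le_mul_of_nonneg_left ?_ (by positivity)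
      calc |x| ^ 3 = |x| * x ^ 2 := by rw [← sq_abs x]; ring
        _ ≤ ε * x ^ 2 := by gcongr; exact not_lt.mp hx

lemma abs_one_sub_sub_exp_neg_le {a : ℝ} (ha : 0 ≤ a) : |1 - a - Real.exp (-a)| ≤ a ^ 2 := by
  rcases le_total a 1 with h | h
  · have := Real.abs_exp_sub_one_sub_id_le (x := -a) (by rw [abs_neg, abs_of_nonneg ha]; exact h)
    rw [abs_sub_comm, ← neg_sq a]
    convert this using 2
    ring
  · have h1 := Real.add_one_le_exp (-a)
    have h2 : Real.exp (-a) ≤ 1 := Real.exp_le_one_iff.mpr (by linarith)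
    rw [abs_le]
    constructor <;> nlinarith

/-- **Lindeberg's central limit theorem** for arrays with i.i.d. rows, in terms of characteristic
functions. -/
theorem tendsto_charFun_pow_of_lindeberg {ν : ℕ → Measure ℝ} [∀ n, IsProbabilityMeasure (ν n)]
    (k : ℕ → ℕ) {v : ℝ} (hmean : ∀ n, ∫ x, x ∂(ν n) = 0) (hL2 : ∀ n, MemLp id 2 (ν n))
    (hvar : Tendsto (fun n => (k n : ℝ) * ∫ x, x ^ 2 ∂(ν n)) atTop (𝓝 v))
    (hlind : ∀ ε > 0, Tendsto (fun n => (k n : ℝ) * ∫ x in {x | ε < |x|}, x ^ 2 ∂(ν n)) atTop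
      (𝓝 0)) (t : ℝ) :
    Tendsto (fun n => charFun (ν n) t ^ k n) atTop (𝓝 (Complex.exp (-(v * t ^ 2 / 2 : ℝ)))) := by
  set σ : ℕ → ℝ := fun n => ∫ x, x ^ 2 ∂(ν n) with hσ
  have hσ0 : ∀ n, 0 ≤ σ n := fun n => integral_nonneg fun x => sq_nonneg x
  set L : ℝ → ℕ → ℝ := fun ε n => ∫ x in {x | ε < |x|}, x ^ 2 ∂(ν n) with hL
  have hL0 : ∀ ε n, 0 ≤ L ε n := fun ε n => integral_nonneg fun x => sq_nonneg x
  have hσL : ∀ ε n, 0 < ε → σ n ≤ ε ^ 2 + L ε n := by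
    intro ε n hε
    have hi2 : Integrable (fun x : ℝ => x ^ 2) (ν n) := (hL2 n).integrable_sq
    have hms : MeasurableSet {x : ℝ | ε < |x|} := measurableSet_lt measurable_const (by fun_prop)
    have : ε ^ 2 = ∫ _, ε ^ 2 ∂(ν n) := by simp
    simp only [hσ, hL]
    rw [this, ← integral_indicator hms, ← integral_add (integrable_const _) (hi2.indicator hms)]
    refine integral_mono hi2 ((integrable_const _).add (hi2.indicator hms)) fun x => ?_
    simp only [Set.indicator_apply, Set.mem_ofPred_eq]
    split_ifs with hx
    · nlinarith
    · rw [add_zero, ← sq_abs x]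
      exact pow_le_pow_left₀ (abs_nonneg x) (not_lt.mp hx) 2
  -- Each factor is compared with the characteristic function at `t` of the centred Gaussian law of
  -- the same variance.
  set w : ℕ → ℝ := fun n => Real.exp (-(t ^ 2 * σ n / 2)) with hw
  have hbound : ∀ ε > 0, |t| * ε ≤ 1 → ∀ n, ‖charFun (ν n) t ^ k n - (w n : ℂ) ^ k n‖ ≤
      |t| ^ 3 * ε * (k n * σ n) + 4 * t ^ 2 * (k n * L ε n) +
        t ^ 4 * (k n * σ n) * (ε ^ 2 + k n * L ε n) := by
    intro ε hε hε1 n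
    have ha : 0 ≤ t ^ 2 * σ n / 2 := by have := hσ0 n; positivity
    have hw1 : ‖(w n : ℂ)‖ ≤ 1 := by
      rw [Complex.norm_real, Real.norm_eq_abs, abs_of_pos (Real.exp_pos _)]
      exact Real.exp_le_one_iff.mpr (by linarith)
    refine (norm_pow_sub_pow_le (norm_charFun_le_one _) hw1 _).trans ?_
    have h1 := norm_charFun_sub_le (hmean n) (hL2 n) t hε hε1
    have h2 : ‖((1 - (t ^ 2 * σ n / 2 : ℝ) : ℂ) - (w n : ℂ))‖ ≤ (t ^ 2 * σ n / 2) ^ 2 := by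
      have := abs_one_sub_sub_exp_neg_le ha
      rw [← Real.norm_eq_abs, ← Complex.norm_real] at this
      convert this using 2
      push_cast [hw]; ring
    have h3 : ‖charFun (ν n) t - w n‖ ≤
        |t| ^ 3 * ε * σ n + 4 * t ^ 2 * L ε n + (t ^ 2 * σ n / 2) ^ 2 := by
      have := norm_add_le (charFun (ν n) t - (1 - (t ^ 2 * σ n / 2 : ℝ) : ℂ))
        ((1 - (t ^ 2 * σ n / 2 : ℝ) : ℂ) - (w n : ℂ))
      rw [sub_add_sub_cancel] at this
      exact this.trans (add_le_add h1 h2)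
    have hk0 : (0 : ℝ) ≤ k n := Nat.cast_nonneg _
    -- The error `k σ²` is of second order in the variance. One factor `σ` is replaced by `ε² + L`,
    -- and `k ≤ k²` turns the result into the products `k σ` and `k L`, whose limits are known.
    have hkk : (k n : ℝ) ≤ k n * k n := by exact_mod_cast Nat.le_mul_self (k n)
    have h4 : (k n : ℝ) * (t ^ 2 * σ n / 2) ^ 2 ≤
        t ^ 4 * (k n * σ n) * (ε ^ 2 + k n * L ε n) := by
      have h5 : (k n : ℝ) * σ n ^ 2 ≤ (k n * σ n) * (ε ^ 2 + k n * L ε n) := by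
        have h6 := hσL ε n hε
        calc (k n : ℝ) * σ n ^ 2 = (k n * σ n) * σ n := by ring
          _ ≤ (k n * σ n) * (ε ^ 2 + L ε n) :=
              mul_le_mul_of_nonneg_left h6 (mul_nonneg hk0 (hσ0 n))
          _ = (k n * σ n) * ε ^ 2 + k n * (σ n * L ε n) := by ring
          _ ≤ (k n * σ n) * ε ^ 2 + k n * k n * (σ n * L ε n) :=
              add_le_add le_rfl (mul_le_mul_of_nonneg_right hkk (mul_nonneg (hσ0 n) (hL0 ε n)))
          _ = _ := by ring
      have h7 : (k n : ℝ) * (t ^ 2 * σ n / 2) ^ 2 = t ^ 4 / 4 * (k n * σ n ^ 2) := by ring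
      rw [h7]
      have h8 : 0 ≤ (k n * σ n) * (ε ^ 2 + k n * L ε n) := by
        have := hσ0 n; have := hL0 ε n; positivity
      calc t ^ 4 / 4 * (k n * σ n ^ 2) ≤ t ^ 4 / 4 * ((k n * σ n) * (ε ^ 2 + k n * L ε n)) := by
            gcongr
        _ ≤ t ^ 4 * ((k n * σ n) * (ε ^ 2 + k n * L ε n)) := by
            gcongr; have : 0 ≤ t ^ 4 := by positivity
            linarith
        _ = _ := by ring
    calc (k n : ℝ) * ‖charFun (ν n) t - w n‖
        ≤ k n * (|t| ^ 3 * ε * σ n + 4 * t ^ 2 * L ε n + (t ^ 2 * σ n / 2) ^ 2) := by gcongr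
      _ = |t| ^ 3 * ε * (k n * σ n) + 4 * t ^ 2 * (k n * L ε n) +
            k n * (t ^ 2 * σ n / 2) ^ 2 := by ring
      _ ≤ _ := by gcongr
  have hdiff : Tendsto (fun n => charFun (ν n) t ^ k n - (w n : ℂ) ^ k n) atTop (𝓝 0) := by
    rw [Metric.tendsto_atTop']
    simp only [dist_zero_right]
    intro η hη
    have hpoly : Tendsto (fun ε : ℝ => |t| ^ 3 * ε * v + t ^ 4 * v * ε ^ 2) (𝓝[>] 0) (𝓝 0) := by
      have : Continuous fun ε : ℝ => |t| ^ 3 * ε * v + t ^ 4 * v * ε ^ 2 := by fun_prop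
      have := this.tendsto 0
      simp only [mul_zero, zero_mul, ne_eq, OfNat.ofNat_ne_zero, not_false_eq_true, zero_pow,
        add_zero] at this
      exact this.mono_left nhdsWithin_le_nhds
    have hsmall : Tendsto (fun ε : ℝ => |t| * ε) (𝓝[>] 0) (𝓝 0) := by
      have : Continuous fun ε : ℝ => |t| * ε := by fun_prop
      have := this.tendsto 0
      rw [mul_zero] at this
      exact this.mono_left nhdsWithin_le_nhds
    -- The level `ε` is fixed first, so that the limit in `n` of the error bound is already below
    -- `η`.
    obtain ⟨ε, hε1, hε2, hε0⟩ := ((hpoly.eventually_lt_const hη).and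
      ((hsmall.eventually_le_const (zero_lt_one)).and self_mem_nhdsWithin)).exists
    have hA : Tendsto (fun n => |t| ^ 3 * ε * (k n * σ n) + 4 * t ^ 2 * (k n * L ε n) +
        t ^ 4 * (k n * σ n) * (ε ^ 2 + k n * L ε n)) atTop
        (𝓝 (|t| ^ 3 * ε * v + 4 * t ^ 2 * 0 + t ^ 4 * v * (ε ^ 2 + 0))) :=
      ((hvar.const_mul _).add ((hlind ε hε0).const_mul _)).add
        ((hvar.const_mul _).mul ((hlind ε hε0).const_add _))
    simp only [mul_zero, add_zero] at hA
    obtain ⟨N, hN⟩ := eventually_atTop.mp (hA.eventually_lt_const hε1)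
    exact ⟨N, fun n hn => (hbound ε hε0 hε2 n).trans_lt (hN n hn.le)⟩
  have hwlim : Tendsto (fun n => (w n : ℂ) ^ k n) atTop
      (𝓝 (Complex.exp (-(v * t ^ 2 / 2 : ℝ)))) := by
    have h1 : ∀ n, (w n : ℂ) ^ k n = ((Real.exp (-((k n * σ n) * t ^ 2 / 2)) : ℝ) : ℂ) := by
      intro n
      rw [← Complex.ofReal_pow, hw, ← Real.exp_nat_mul]
      congr 2; ring
    simp_rw [h1]
    rw [← Complex.ofReal_neg, ← Complex.ofReal_exp]
    refine (Complex.continuous_ofReal.tendsto _).comp ?_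
    exact (Real.continuous_exp.tendsto _).comp ((hvar.mul_const _).div_const _).neg
  simpa using hdiff.add hwlim

end ArrayCLT

end BlockUStat

namespace BlockUStat

open scoped ENNReal

/-! ### Characteristic functions and `L²` distance -/

section CharFunDistance

variable {α : Type*} [MeasurableSpace α] {ν : Measure α} [IsProbabilityMeasure ν]

/-- The map `x ↦ exp(itx)` is `|t|`-Lipschitz, and the `L¹` norm is at most the `L²` norm. All
replacements of variables by `L²`-close ones rest on this bound. -/
lemma norm_charFun_map_sub_le {X Y : α → ℝ} (hX : MemLp X 2 ν) (hY : MemLp Y 2 ν) (t : ℝ) :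
    ‖charFun (ν.map X) t - charFun (ν.map Y) t‖ ≤ |t| * lpNorm (X - Y) 2 ν := by
  have hint : ∀ {Z : α → ℝ}, MemLp Z 2 ν →
      Integrable (fun ω => Complex.exp ((t * Z ω : ℝ) * Complex.I)) ν := by
    intro Z hZ
    have hZm := hZ.aestronglyMeasurable
    refine Integrable.of_bound (C := 1) ?_ (ae_of_all _ fun x => ?_)
    · refine Continuous.comp_aestronglyMeasurable
        (g := fun z : ℝ => Complex.exp ((t * z : ℝ) * Complex.I)) (by fun_prop) hZm
    · rw [Complex.norm_exp_ofReal_mul_I]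
  have hchar : ∀ {Z : α → ℝ}, MemLp Z 2 ν →
      charFun (ν.map Z) t = ∫ ω, Complex.exp ((t * Z ω : ℝ) * Complex.I) ∂ν := by
    intro Z hZ
    rw [charFun_apply_real, integral_map hZ.aemeasurable (by fun_prop)]
    push_cast; rfl
  rw [hchar hX, hchar hY, ← integral_sub (hint hX) (hint hY)]
  refine (norm_integral_le_integral_norm _).trans ?_
  have hXY : MemLp (X - Y) 2 ν := hX.sub hY
  calc ∫ ω, ‖Complex.exp ((t * X ω : ℝ) * Complex.I) - Complex.exp ((t * Y ω : ℝ) * Complex.I)‖ ∂ν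
      ≤ ∫ ω, |t| * |(X - Y) ω| ∂ν := by
        refine integral_mono ((hint hX).sub (hint hY)).norm
          (((hXY.integrable (by norm_num)).abs).const_mul _) fun ω => ?_
        have h1 : Complex.exp ((t * X ω : ℝ) * Complex.I) - Complex.exp ((t * Y ω : ℝ) * Complex.I)
            = Complex.exp ((t * Y ω : ℝ) * Complex.I) *
              (Complex.exp (Complex.I * ((t * (X ω - Y ω) : ℝ) : ℂ)) - 1) := by
          rw [mul_sub, ← Complex.exp_add, mul_one]
          congr 2
          push_cast; ring
        change ‖Complex.exp ((t * X ω : ℝ) * Complex.I) - Complex.exp ((t * Y ω : ℝ) * Complex.I)‖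
          ≤ |t| * |X ω - Y ω|
        rw [h1, norm_mul, Complex.norm_exp_ofReal_mul_I, one_mul, ← abs_mul]
        exact Real.norm_exp_I_mul_ofReal_sub_one_le
    _ = |t| * ∫ ω, |(X - Y) ω| ∂ν := integral_const_mul _ _
    _ ≤ |t| * lpNorm (X - Y) 2 ν := by
        gcongr
        exact integral_abs_le_lpNorm_two hXY

end CharFunDistance

/-! ### Independence of families built from disjoint innovations, and moments of sums -/

section Independence

variable {ι κ : Type*} {μ : Measure ℝ} [IsProbabilityMeasure μ]

/-- Sequences built from disjoint sets of innovations are independent. -/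
lemma iIndepFun_reindex_family (e : κ → ℤ → ι)
    (he : Function.Injective fun p : κ × ℤ => e p.1 p.2) :
    iIndepFun (fun (j : κ) (ω : ι → ℝ) u => ω (e j u)) (iidLaw ι μ) := by
  have hej : ∀ j, (e j).Injective := fun j u v h => by
    have := he (a₁ := (j, u)) (a₂ := (j, v)) h
    exact congrArg Prod.snd this
  -- The joint law is the image under currying of the i.i.d. law indexed by `κ × ℤ`, hence a product
  -- of copies of the i.i.d. law on `ℤ`.
  rw [iIndepFun_iff_map_fun_eq_infinitePi_map (fun j => by fun_prop)]
  simp_rw [fun j => (measurePreserving_reindex (μ := μ) (hej j)).map_eq]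
  have h := Measure.infinitePi_map_curry (X := ℝ) (fun (_ : κ) (_ : ℤ) => μ)
  rw [← h]
  have h2 : Measure.infinitePi (fun _ : κ × ℤ => μ) = _ :=
    (measurePreserving_reindex (μ := μ) he).map_eq.symm
  rw [h2, Measure.map_map (by fun_prop) (by fun_prop)]
  rfl

end Independence

section Bounded

variable {μ : Measure ℝ} [IsProbabilityMeasure μ] {G : (ℤ → ℝ) → ℝ}

lemma integral_partSum (hG2 : MemLp G 2 (iidLaw ℤ μ))
    (A : Finset ℤ) : ∫ x, partSum G A x ∂(iidLaw ℤ μ) = A.card * ∫ x, G x ∂(iidLaw ℤ μ) := by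
  simp only [partSum]
  rw [integral_finsetSum _ fun t _ => (memLp_shift hG2 t).integrable (by norm_num)]
  have : ∀ t, ∫ x, G (shiftSeq t x) ∂(iidLaw ℤ μ) = ∫ x, G x ∂(iidLaw ℤ μ) := by
    intro t
    conv_rhs => rw [← (measurePreserving_shiftSeq (μ := μ) t).map_eq]
    rw [integral_map (by fun_prop)]
    rw [(measurePreserving_shiftSeq (μ := μ) t).map_eq]
    exact hG2.aestronglyMeasurable
  simp [this]

lemma lpNorm_partSum_sq (hG2 : MemLp G 2 (iidLaw ℤ μ)) (h0 : ∫ x, G x ∂(iidLaw ℤ μ) = 0)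
    (A : Finset ℤ) : lpNorm (partSum G A) 2 (iidLaw ℤ μ) ^ 2 = Var[partSum G A; iidLaw ℤ μ] := by
  rw [lpNorm_two_sq (memLp_partSum hG2 A), variance_eq_integral (memLp_partSum hG2 A).aemeasurable,
    integral_partSum hG2, h0]
  simp

lemma partSum_shift (A : Finset ℤ) (s : ℤ) (x : ℤ → ℝ) :
    partSum G (A.map (Equiv.addLeft s).toEmbedding) x = partSum G A (shiftSeq s x) := by
  simp [partSum, Finset.sum_map, shiftSeq_shiftSeq]

lemma partSum_Icc_shift (s : ℤ) (n : ℕ) (x : ℤ → ℝ) :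
    partSum G (Finset.Icc (s + 1) (s + n)) x = partSum G (Finset.Icc 1 (n : ℤ)) (shiftSeq s x) := by
  rw [← partSum_shift]
  congr 1
  ext t
  simp only [Finset.mem_Icc, Finset.mem_map, Equiv.coe_toEmbedding, Equiv.coe_addLeft]
  constructor
  · intro h; exact ⟨t - s, by omega, by omega⟩
  · rintro ⟨a, ha, rfl⟩; omega

end Bounded

end BlockUStat

namespace BlockUStat

open scoped ENNReal

/-! ### Simultaneous coupling of all blocks with independent ones -/

section BlockIndex

variable {κ : Type*}

/-- The innovations of the original sequence. -/
def mainIndex (κ : Type*) (u : ℤ) : Option κ × ℤ := (none, u)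

/-- The innovations of the `j`-th coupled sequence: the original ones on `E j`, and a separate
independent copy elsewhere. -/
def blockIndex (E : κ → Finset ℤ) (j : κ) (u : ℤ) : Option κ × ℤ :=
  (if u ∈ E j then none else some j, u)

lemma mainIndex_injective : (mainIndex κ).Injective := fun _ _ h => congrArg Prod.snd h

lemma blockIndex_injective (E : κ → Finset ℤ) (j : κ) : (blockIndex E j).Injective :=
  fun _ _ h => congrArg Prod.snd h

/-- Two sequences can only share a coordinate at the same time `u`: either an original innovation,
which puts `u` in two of the disjoint sets, or a private copy, whose label determines the block. -/
lemma blockIndex_uncurry_injective {E : κ → Finset ℤ}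
    (hE : Pairwise fun i j => Disjoint (E i) (E j)) :
    Function.Injective fun p : κ × ℤ => blockIndex E p.1 p.2 := by
  rintro ⟨i, u⟩ ⟨j, v⟩ h
  have huv : u = v := congrArg Prod.snd h
  have hf := congrArg Prod.fst h
  subst huv
  simp only [blockIndex] at hf
  by_cases hi : u ∈ E i <;> by_cases hj : u ∈ E j
  · by_contra hne
    have hij : i ≠ j := fun h' => hne (by rw [h'])
    exact Finset.disjoint_left.mp (hE hij) hi hj
  · simp [hi, hj] at hf
  · simp [hi, hj] at hf
  · simp [hi, hj] at hf
    rw [hf]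

variable {μ : Measure ℝ} [IsProbabilityMeasure μ] {G : (ℤ → ℝ) → ℝ}

lemma memLp_partSum_reindex {ι : Type*} (hG2 : MemLp G 2 (iidLaw ℤ μ)) (A : Finset ℤ)
    {e : ℤ → ι} (he : e.Injective) :
    MemLp (fun ω : ι → ℝ => partSum G A fun u => ω (e u)) 2 (iidLaw ι μ) :=
  (memLp_partSum hG2 A).comp_measurePreserving (measurePreserving_reindex he)

lemma lpNorm_block_coupling_le [Countable κ] (hG : Measurable G) (hG2 : MemLp G 2 (iidLaw ℤ μ))
    (hD : totalDep μ G ≠ ⊤) (E : κ → Finset ℤ) (j : κ) (a c : ℤ) (g : ℕ)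
    (hsub : Finset.Icc (a - g) (c + g) ⊆ E j) :
    lpNorm (fun ω : Option κ × ℤ → ℝ => partSum G (Finset.Icc a c) (fun u => ω (mainIndex κ u)) -
      partSum G (Finset.Icc a c) (fun u => ω (blockIndex E j u))) 2 (iidLaw (Option κ × ℤ) μ)
      ≤ (totalDep μ G).toReal / ((g + 1 : ℕ) : ℝ) := by
  classical
  have hmem := (memLp_partSum_reindex hG2 (Finset.Icc a c) (mainIndex_injective (κ := κ))).sub
    (memLp_partSum_reindex hG2 (Finset.Icc a c) (blockIndex_injective E j))
  refine le_trans (le_of_eq (toReal_eLpNorm hmem.aestronglyMeasurable).symm) ?_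
  refine toReal_le_div (by omega) hD ?_
  refine eLpNorm_exchange_partSum_le hG (hG2.integrable (by norm_num)) mainIndex_injective
    (blockIndex_injective E j) (fun u v huv h => huv (congrArg Prod.snd h)) a c g fun u hu => ?_
  simp [mainIndex, blockIndex, hsub hu]

/-- The characteristic function of a sum of block sums over coupled sequences. -/
lemma charFun_sum_blocks (hG : Measurable G) {E : κ → Finset ℤ}
    (hE : Pairwise fun i j => Disjoint (E i) (E j)) (a : κ → ℤ) (n : ℕ) (c : ℝ) (J : Finset κ)
    (t : ℝ) :
    charFun ((iidLaw (Option κ × ℤ) μ).map fun ω => ∑ j ∈ J,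
      c * partSum G (Finset.Icc (a j + 1) (a j + n)) fun u => ω (blockIndex E j u)) t =
    charFun ((iidLaw ℤ μ).map fun x => c * partSum G (Finset.Icc 1 (n : ℤ)) x) t ^ J.card := by
  have hind := (iIndepFun_reindex_family (μ := μ) (blockIndex E)
    (blockIndex_uncurry_injective hE)).comp
    (fun j x => c * partSum G (Finset.Icc (a j + 1) (a j + n)) x) (fun j => by fun_prop)
  have h1 := (hind.restrict J).charFun_map_fun_finsetSum_eq_prod (s := J)
    (fun j _ => Measurable.aemeasurable (by fun_prop))
  simp only [Function.comp_def] at h1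
  rw [h1, Finset.prod_apply]
  refine Finset.prod_eq_pow_card fun j _ => ?_
  congr 1
  have h2 := ((measurePreserving_shiftSeq (μ := μ) (a j)).comp
    (measurePreserving_reindex (blockIndex_injective E j))).map_eq
  rw [← h2, Measure.map_map (by fun_prop) (by fun_prop)]
  congr 1
  funext ω
  simp only [Function.comp_apply, partSum_Icc_shift]

end BlockIndex

/-! ### Bernstein blocking -/

section Bernstein

variable {μ : Measure ℝ} [IsProbabilityMeasure μ] {G : (ℤ → ℝ) → ℝ}

/-- Neighbourhoods of length `q` of Bernstein blocks. -/
noncomputable def bernsteinNbhd (q g n : ℕ) (j : ℕ) : Finset ℤ :=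
  Finset.Icc ((j : ℤ) * q + 1 - g) (j * q + n + g)

lemma bernsteinNbhd_disjoint {q g n : ℕ} (hq : n + 2 * g ≤ q) :
    Pairwise fun i j => Disjoint (bernsteinNbhd q g n i) (bernsteinNbhd q g n j) := by
  intro i j hij
  wlog hlt : i < j generalizing i j
  · exact (this hij.symm (by omega)).symm
  rw [Finset.disjoint_left]
  intro u hu hv
  simp only [bernsteinNbhd, Finset.mem_Icc] at hu hv
  have h1 : ((i : ℤ) + 1) * q ≤ j * q := by
    apply mul_le_mul_of_nonneg_right <;> omega
  rw [add_mul, one_mul] at h1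
  omega

/-- The times outside the cores number `l - pn` and contribute through their variance. Each of the
`p` cores has a private margin `g` on both sides, so coupling it costs at most `D / (g + 1)`. -/
lemma lpNorm_bernstein_le (hG : Measurable G) (hG2 : MemLp G 2 (iidLaw ℤ μ))
    (h0 : ∫ x, G x ∂(iidLaw ℤ μ) = 0) (hD : totalDep μ G ≠ ⊤) {q g n p l : ℕ}
    (hq : n + 2 * g ≤ q) (hl : p * q ≤ l) :
    lpNorm (fun ω : Option ℕ × ℤ → ℝ => partSum G (Finset.Icc 1 (l : ℤ)) (fun u => ω (mainIndex ℕ u))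
      - ∑ j ∈ Finset.range p, partSum G (Finset.Icc ((j : ℤ) * q + 1) (j * q + n))
        (fun u => ω (blockIndex (bernsteinNbhd q g n) j u))) 2 (iidLaw (Option ℕ × ℤ) μ) ≤
    √(((l : ℝ) - p * n) * ∑' t, |autoCov μ G t|) + p * ((totalDep μ G).toReal / (g + 1)) := by
  set core : ℕ → Finset ℤ := fun j => Finset.Icc ((j : ℤ) * q + 1) (j * q + n) with hcore
  have hcdisj : (Finset.range p : Set ℕ).PairwiseDisjoint core := by
    intro i _ j _ hij
    refine Disjoint.mono ?_ ?_ (bernsteinNbhd_disjoint hq hij)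
    · exact Finset.Icc_subset_Icc (by omega) (by omega)
    · exact Finset.Icc_subset_Icc (by omega) (by omega)
  set U := (Finset.range p).biUnion core with hU
  have hUsub : U ⊆ Finset.Icc 1 (l : ℤ) := by
    intro t ht
    simp only [hU, Finset.mem_biUnion, Finset.mem_range, hcore, Finset.mem_Icc] at ht ⊢
    obtain ⟨j, hj, h1, h2⟩ := ht
    have h3 : ((j : ℤ) + 1) * q ≤ p * q := by
      apply mul_le_mul_of_nonneg_right <;> omega
    have h4 : (p : ℤ) * q ≤ l := by exact_mod_cast hl
    have h5 : (0 : ℤ) ≤ j * q := by positivity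
    rw [add_mul, one_mul] at h3
    omega
  have hUcard : U.card = p * n := by
    rw [hU, Finset.card_biUnion hcdisj]
    simp [hcore]
  set R := Finset.Icc 1 (l : ℤ) \ U with hR
  have hRcard : (R.card : ℝ) = l - p * n := by
    have := Finset.card_sdiff_add_card_eq_card hUsub
    rw [Int.card_Icc, hUcard] at this
    have h' : R.card + p * n = l := by rw [hR]; omega
    have h'' : (R.card : ℝ) + p * n = l := by exact_mod_cast h'
    linarith
  have hsplit : ∀ x, partSum G (Finset.Icc 1 (l : ℤ)) x =
      partSum G R x + ∑ j ∈ Finset.range p, partSum G (core j) x := by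
    intro x
    simp only [partSum]
    rw [← Finset.sum_biUnion hcdisj, Finset.sum_sdiff hUsub]
  set Q := iidLaw (Option ℕ × ℤ) μ with hQ
  have hmemj : ∀ j, MemLp (fun ω : Option ℕ × ℤ → ℝ => partSum G (core j) (fun u => ω (mainIndex ℕ u)) -
      partSum G (core j) (fun u => ω (blockIndex (bernsteinNbhd q g n) j u))) 2 Q := fun j =>
    (memLp_partSum_reindex hG2 _ mainIndex_injective).sub
      (memLp_partSum_reindex hG2 _ (blockIndex_injective _ j))
  have hmemR : MemLp (fun ω : Option ℕ × ℤ → ℝ => partSum G R (fun u => ω (mainIndex ℕ u))) 2 Q :=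
    memLp_partSum_reindex hG2 _ mainIndex_injective
  have heq : (fun ω : Option ℕ × ℤ → ℝ => partSum G (Finset.Icc 1 (l : ℤ)) (fun u => ω (mainIndex ℕ u))
      - ∑ j ∈ Finset.range p, partSum G (core j)
        (fun u => ω (blockIndex (bernsteinNbhd q g n) j u))) =
      (fun ω : Option ℕ × ℤ → ℝ => partSum G R (fun u => ω (mainIndex ℕ u))) +
      ∑ j ∈ Finset.range p, fun ω : Option ℕ × ℤ → ℝ =>
        partSum G (core j) (fun u => ω (mainIndex ℕ u)) -
        partSum G (core j) (fun u => ω (blockIndex (bernsteinNbhd q g n) j u)) := by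
    funext ω
    simp only [Pi.add_apply, Finset.sum_apply, Finset.sum_sub_distrib, hsplit]
    ring
  change lpNorm (fun ω : Option ℕ × ℤ → ℝ => partSum G (Finset.Icc 1 (l : ℤ))
    (fun u => ω (mainIndex ℕ u)) - ∑ j ∈ Finset.range p, partSum G (core j)
        (fun u => ω (blockIndex (bernsteinNbhd q g n) j u))) 2 Q ≤ _
  rw [heq]
  refine (lpNorm_add_le hmemR (by norm_num)).trans (add_le_add ?_ ?_)
  · have h1 : lpNorm (fun ω : Option ℕ × ℤ → ℝ => partSum G R (fun u => ω (mainIndex ℕ u))) 2 Q =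
        lpNorm (partSum G R) 2 (iidLaw ℤ μ) :=
      lpNorm_reindex (measurePreserving_reindex mainIndex_injective)
        (measurable_partSum hG R).aestronglyMeasurable
    rw [h1, ← hRcard]
    refine Real.le_sqrt_of_sq_le ?_
    rw [lpNorm_partSum_sq hG2 h0]
    exact variance_partSum_le hG hG2 hD R
  · refine (lpNorm_sum_le (fun j _ => hmemj j) (by norm_num)).trans ?_
    refine (Finset.sum_le_card_nsmul _ _ ((totalDep μ G).toReal / (g + 1)) fun j _ => ?_).trans
      (le_of_eq (by simp))
    have := lpNorm_block_coupling_le hG hG2 hD (bernsteinNbhd q g n) j ((j : ℤ) * q + 1)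
      (j * q + n) g (Finset.Subset.refl _)
    push_cast at this
    exact this

end Bernstein

end BlockUStat

/-! ### Block sizes and the central limit theorem for bounded functionals -/

namespace BlockUStat

open scoped ENNReal

/-- The normalised sum `l^{-1/2} ∑_{t=1}^l G ∘ shiftSeq t`. -/
noncomputable def normSum (G : (ℤ → ℝ) → ℝ) (l : ℕ) (x : ℤ → ℝ) : ℝ :=
  (1 / √(l : ℝ)) * partSum G (Finset.Icc 1 (l : ℤ)) x

/-- The integer part of the twelfth root. -/
noncomputable def twelfthRoot (l : ℕ) : ℕ := Nat.findGreatest (fun r => r ^ 12 ≤ l) l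

lemma twelfthRoot_pow_le (l : ℕ) : twelfthRoot l ^ 12 ≤ l :=
  Nat.findGreatest_spec (P := fun r => r ^ 12 ≤ l) (m := 0) (Nat.zero_le _) (by simp)

lemma le_twelfthRoot {l r : ℕ} (h : r ^ 12 ≤ l) : r ≤ twelfthRoot l :=
  Nat.le_findGreatest ((Nat.le_self_pow (by norm_num) r).trans h) h

lemma lt_twelfthRoot_succ_pow (l : ℕ) : l < (twelfthRoot l + 1) ^ 12 := by
  by_contra h
  have := le_twelfthRoot (not_lt.mp h)
  omega

lemma tendsto_twelfthRoot : Tendsto twelfthRoot atTop atTop :=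
  tendsto_atTop.mpr fun r => (eventually_ge_atTop (r ^ 12)).mono fun _ h => le_twelfthRoot h

/-- The sizes in Bernstein's blocking. -/
lemma bernstein_sizes {l r : ℕ} (hr : 3 ≤ r) (h1 : r ^ 12 ≤ l) (h2 : l < (r + 1) ^ 12) :
    r ≤ r ^ 4 - 2 * r ^ 3 ∧ r ^ 4 - 2 * r ^ 3 + 2 * r ^ 3 = r ^ 4 ∧
    (l : ℝ) - (l / r ^ 4 : ℕ) * (r ^ 4 - 2 * r ^ 3 : ℕ) ≤ 3 * l / r ∧
    (l / r ^ 4 : ℕ) / (√(l : ℝ) * r ^ 3) ≤ 64 / r ∧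
    (r ^ 4 - 2 * r ^ 3 : ℕ) / √(l : ℝ) ≤ 1 / r := by
  have hr0 : 0 < r := by omega
  have hrR : (0 : ℝ) < r := by exact_mod_cast hr0
  have hr1 : (1 : ℝ) ≤ r := by exact_mod_cast hr0
  have h4 : 2 * r ^ 3 + r ^ 3 ≤ r ^ 4 := by
    calc 2 * r ^ 3 + r ^ 3 = 3 * r ^ 3 := by ring
      _ ≤ r * r ^ 3 := Nat.mul_le_mul_right _ hr
      _ = r ^ 4 := by ring
  have h3 : r ≤ r ^ 3 := Nat.le_self_pow (by norm_num) r
  have hq0 : 0 < r ^ 4 := by positivity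
  have hlR : (r : ℝ) ^ 12 ≤ l := by exact_mod_cast h1
  have hl0 : (0 : ℝ) < l := lt_of_lt_of_le (by positivity) hlR
  have hs1 : (r : ℝ) ^ 6 ≤ √(l : ℝ) := by
    refine Real.le_sqrt_of_sq_le ?_
    rw [← pow_mul]; exact hlR
  -- From `l < (r + 1)^12 ≤ (2r)^12` one gets `√l ≤ 64 r^6`, the origin of the constant `64`.
  have hs2 : √(l : ℝ) ≤ 64 * (r : ℝ) ^ 6 := by
    refine Real.sqrt_le_iff.mpr ⟨by positivity, ?_⟩
    have h2' : (l : ℝ) ≤ ((r : ℝ) + 1) ^ 12 := by exact_mod_cast h2.le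
    calc (l : ℝ) ≤ ((r : ℝ) + 1) ^ 12 := h2'
      _ ≤ (2 * (r : ℝ)) ^ 12 := by gcongr; linarith
      _ = (64 * (r : ℝ) ^ 6) ^ 2 := by ring
  have hs0 : 0 < √(l : ℝ) := Real.sqrt_pos.mpr hl0
  have hpq : ((l / r ^ 4 : ℕ) : ℝ) * (r : ℝ) ^ 4 ≤ l := by
    exact_mod_cast Nat.div_mul_le_self l (r ^ 4)
  have hpq' : (l : ℝ) ≤ ((l / r ^ 4 : ℕ) : ℝ) * (r : ℝ) ^ 4 + (r : ℝ) ^ 4 := by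
    have := Nat.lt_div_mul_add (a := l) hq0
    exact_mod_cast this.le
  have hn : ((r ^ 4 - 2 * r ^ 3 : ℕ) : ℝ) = (r : ℝ) ^ 4 - 2 * (r : ℝ) ^ 3 := by
    rw [Nat.cast_sub (by omega)]; push_cast; ring
  refine ⟨by omega, by omega, ?_, ?_, ?_⟩
  · rw [hn, le_div_iff₀ hrR]
    have h5 : (r : ℝ) ^ 4 * r ≤ l := by
      calc (r : ℝ) ^ 4 * r = (r : ℝ) ^ 5 := by ring
        _ ≤ (r : ℝ) ^ 12 := pow_le_pow_right₀ hr1 (by norm_num)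
        _ ≤ l := hlR
    nlinarith
  · rw [div_le_div_iff₀ (by positivity) hrR]
    have h6 : ((l / r ^ 4 : ℕ) : ℝ) * r ^ 4 ≤ √(l : ℝ) * (64 * (r : ℝ) ^ 6) :=
      hpq.trans (by
        calc (l : ℝ) = √(l : ℝ) * √(l : ℝ) := (Real.mul_self_sqrt hl0.le).symm
          _ ≤ _ := by gcongr)
    have h7 : (((l / r ^ 4 : ℕ) : ℝ) * r) * r ^ 3 ≤ (64 * (√(l : ℝ) * r ^ 3)) * r ^ 3 := by
      calc (((l / r ^ 4 : ℕ) : ℝ) * r) * r ^ 3 = ((l / r ^ 4 : ℕ) : ℝ) * r ^ 4 := by ring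
        _ ≤ _ := h6
        _ = _ := by ring
    exact le_of_mul_le_mul_right h7 (by positivity)
  · rw [hn, div_le_div_iff₀ hs0 hrR]
    calc ((r : ℝ) ^ 4 - 2 * (r : ℝ) ^ 3) * r ≤ (r : ℝ) ^ 4 * r := by
          gcongr; linarith [pow_pos hrR 3]
      _ = (r : ℝ) ^ 5 := by ring
      _ ≤ (r : ℝ) ^ 6 := pow_le_pow_right₀ hr1 (by norm_num)
      _ ≤ 1 * √(l : ℝ) := by rw [one_mul]; exact hs1

section CLT

variable {μ : Measure ℝ} [IsProbabilityMeasure μ] {G : (ℤ → ℝ) → ℝ}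

@[fun_prop]
lemma measurable_normSum (hG : Measurable G) (l : ℕ) : Measurable (normSum G l) := by
  unfold normSum; fun_prop

lemma memLp_normSum (hG2 : MemLp G 2 (iidLaw ℤ μ)) (l : ℕ) :
    MemLp (normSum G l) 2 (iidLaw ℤ μ) := (memLp_partSum hG2 _).const_mul _

lemma abs_partSum_le {K : ℝ} (hK : ∀ x, |G x| ≤ K) (A : Finset ℤ) (x : ℤ → ℝ) :
    |partSum G A x| ≤ A.card * K := by
  refine (Finset.abs_sum_le_sum_abs _ _).trans ?_
  refine (Finset.sum_le_card_nsmul _ _ K fun t _ => hK _).trans (le_of_eq (by simp))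

/-- The central limit theorem for bounded Bernoulli shifts. -/
theorem tendsto_charFun_normSum_of_bounded (hG : Measurable G) {K : ℝ} (hK : ∀ x, |G x| ≤ K)
    (h0 : ∫ x, G x ∂(iidLaw ℤ μ) = 0) (hD : totalDep μ G ≠ ⊤) (t : ℝ) :
    Tendsto (fun l : ℕ => charFun ((iidLaw ℤ μ).map (normSum G l)) t) atTop
      (𝓝 (Complex.exp (-((∑' s, autoCov μ G s) * t ^ 2 / 2 : ℝ)))) := by
  have hG2 : MemLp G 2 (iidLaw ℤ μ) :=
    MemLp.of_bound hG.aestronglyMeasurable K (ae_of_all _ hK)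
  set r := twelfthRoot with hr
  -- With `r` about `l^{1/12}` the blocks have period `r^4` and margins `r^3`, leaving cores of
  -- length `r^4 - 2r^3`. The margins then occupy a fraction of order `1/r`; the `p` couplings cost
  -- `p / (√l r^3)`, also of order `1/r`; and a core sum over `√l` is at most `K/r`.
  set n : ℕ → ℕ := fun l => r l ^ 4 - 2 * r l ^ 3 with hn
  set p : ℕ → ℕ := fun l => l / r l ^ 4 with hp
  set c : ℕ → ℝ := fun l => 1 / √(l : ℝ) with hc
  set V := ∑' s, |autoCov μ G s| with hV
  have hV0 : 0 ≤ V := tsum_nonneg fun _ => abs_nonneg _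
  set D := (totalDep μ G).toReal with hDdef
  have hD0 : 0 ≤ D := ENNReal.toReal_nonneg
  have hrlim : Tendsto (fun l => (r l : ℝ)) atTop atTop :=
    tendsto_natCast_atTop_atTop.comp tendsto_twelfthRoot
  have hev : ∀ᶠ l in atTop, 3 ≤ r l := tendsto_twelfthRoot.eventually_ge_atTop 3
  have hsize := fun l (h : 3 ≤ r l) =>
    bernstein_sizes h (twelfthRoot_pow_le l) (lt_twelfthRoot_succ_pow l)
  have hinv : ∀ a : ℝ, Tendsto (fun l => a / (r l : ℝ)) atTop (𝓝 0) := fun a =>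
    hrlim.const_div_atTop a
  -- the law of a single block
  set ν : ℕ → Measure ℝ := fun l =>
    (iidLaw ℤ μ).map fun x => c l * partSum G (Finset.Icc 1 (n l : ℤ)) x with hν
  have hνprob : ∀ l, IsProbabilityMeasure (ν l) := fun l =>
    Measure.isProbabilityMeasure_map (Measurable.aemeasurable (by fun_prop))
  have hνsq : ∀ l, ∫ x, x ^ 2 ∂(ν l) =
      c l ^ 2 * Var[partSum G (Finset.Icc 1 (n l : ℤ)); iidLaw ℤ μ] := by
    intro l
    rw [hν, integral_map (Measurable.aemeasurable (by fun_prop)) (by fun_prop),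
      ← lpNorm_partSum_sq hG2 h0, lpNorm_two_sq (memLp_partSum hG2 _), ← integral_const_mul]
    simp_rw [mul_pow]
  have hpn : Tendsto (fun l => (p l : ℝ) * n l / l) atTop (𝓝 1) := by
    have hlow : Tendsto (fun l => 1 - 3 / (r l : ℝ)) atTop (𝓝 1) := by
      simpa using (hinv 3).const_sub 1
    refine tendsto_of_tendsto_of_tendsto_of_le_of_le' hlow tendsto_const_nhds ?_ ?_
    · filter_upwards [hev, eventually_gt_atTop 0] with l hl hl0
      have hl0' : (0 : ℝ) < l := by exact_mod_cast hl0
      have h := (hsize l hl).2.2.1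
      rw [le_div_iff₀ hl0', sub_mul, one_mul]
      have : 3 / (r l : ℝ) * l = 3 * l / r l := by ring
      rw [this]
      linarith
    · filter_upwards [hev, eventually_gt_atTop 0] with l hl hl0
      have hl0' : (0 : ℝ) < l := by exact_mod_cast hl0
      rw [div_le_one hl0']
      have h := (hsize l hl).2.1
      have h2 : p l * n l ≤ l :=
        (Nat.mul_le_mul_left _ (by simp only [hn]; omega)).trans (Nat.div_mul_le_self l (r l ^ 4))
      exact_mod_cast h2
  have hnlim : Tendsto n atTop atTop := by
    refine tendsto_atTop_mono' _ ?_ tendsto_twelfthRoot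
    filter_upwards [hev] with l hl using (hsize l hl).1
  have hblock : Tendsto (fun l => charFun (ν l) t ^ p l) atTop
      (𝓝 (Complex.exp (-((∑' s, autoCov μ G s) * t ^ 2 / 2 : ℝ)))) := by
    refine tendsto_charFun_pow_of_lindeberg p (fun l => ?_) (fun l => ?_) ?_ (fun ε hε => ?_) t
    · rw [hν, integral_map (Measurable.aemeasurable (by fun_prop)) (by fun_prop),
        integral_const_mul, integral_partSum hG2, h0]
      simp
    · rw [hν, memLp_map_measure_iff (by fun_prop) (Measurable.aemeasurable (by fun_prop))]
      exact (memLp_partSum hG2 _).const_mul _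
    · have h1 := ((tendsto_variance_partSum hG hG2 hD).comp hnlim).mul hpn
      rw [mul_one] at h1
      refine h1.congr' ?_
      filter_upwards [hev, eventually_gt_atTop 0] with l hl hl0
      have hl0' : (0 : ℝ) < l := by exact_mod_cast hl0
      have hn0 : (0 : ℝ) < n l := by
        have := (hsize l hl).1
        have : 0 < n l := by simp only [hn]; omega
        exact_mod_cast this
      rw [hνsq]
      simp only [Function.comp_apply, hc, div_pow, one_pow, Real.sq_sqrt hl0'.le]
      field_simp
    -- A normalised core sum is bounded by `K / r`, so the tail event is eventually empty and the
    -- Lindeberg integrals vanish.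
    · refine tendsto_const_nhds.congr' ?_
      have hKr : ∀ᶠ l in atTop, K / (r l : ℝ) < ε := (hinv K).eventually_lt_const hε
      filter_upwards [hev, hKr] with l hl hKl
      have hK0 : 0 ≤ K := (abs_nonneg _).trans (hK 0)
      have hzero : ν l {x | ε < |x|} = 0 := by
        rw [hν, Measure.map_apply (by fun_prop)
          (measurableSet_lt measurable_const (by fun_prop))]
        convert measure_empty (μ := iidLaw ℤ μ)
        ext x
        simp only [Set.mem_preimage, Set.mem_ofPred_eq, Set.mem_empty_iff_false, iff_false, not_lt]
        have h1 : |partSum G (Finset.Icc 1 (n l : ℤ)) x| ≤ n l * K := by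
          have := abs_partSum_le hK (Finset.Icc 1 (n l : ℤ)) x
          rwa [Int.card_Icc, add_sub_cancel_right, Int.toNat_natCast] at this
        rw [abs_mul, abs_of_nonneg (by positivity : 0 ≤ c l)]
        calc c l * |partSum G (Finset.Icc 1 (n l : ℤ)) x| ≤ c l * (n l * K) := by gcongr
          _ = (n l / √(l : ℝ)) * K := by simp only [hc]; ring
          _ ≤ (1 / r l) * K := mul_le_mul_of_nonneg_right (hsize l hl).2.2.2.2 hK0
          _ = K / r l := by ring
          _ ≤ ε := hKl.le
      rw [Measure.restrict_eq_zero.mpr hzero]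
      simp
  -- comparison with the sum over independent blocks
  have hdiff : Tendsto (fun l => charFun ((iidLaw ℤ μ).map (normSum G l)) t -
      charFun (ν l) t ^ p l) atTop (𝓝 0) := by
    have hbd : Tendsto (fun l => |t| * (√(3 / (r l : ℝ) * V) + 64 / r l * D)) atTop (𝓝 0) := by
      have h1 := ((hinv 3).mul_const V).sqrt
      have h2 := (h1.add ((hinv 64).mul_const D)).const_mul |t|
      simpa using h2
    refine squeeze_zero_norm' ?_ hbd
    filter_upwards [hev, eventually_gt_atTop 0] with l hl hl0
    have hl0' : (0 : ℝ) < l := by exact_mod_cast hl0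
    obtain ⟨h1, h2, h3, h4, h5⟩ := hsize l hl
    have hr0 : (0 : ℝ) < r l := by exact_mod_cast (by omega : 0 < r l)
    set Q := iidLaw (Option ℕ × ℤ) μ with hQ
    set E := bernsteinNbhd (r l ^ 4) (r l ^ 3) (n l) with hE
    have hmain : (iidLaw ℤ μ).map (normSum G l) =
        Q.map fun ω => normSum G l fun u => ω (mainIndex ℕ u) := by
      rw [← (measurePreserving_reindex (μ := μ) (mainIndex_injective (κ := ℕ))).map_eq,
        Measure.map_map (by fun_prop) (by fun_prop)]
      rfl
    have hpow := charFun_sum_blocks (μ := μ) hG (E := E) (bernsteinNbhd_disjoint h2.le)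
      (fun j : ℕ => (j : ℤ) * (r l ^ 4 : ℕ)) (n l) (c l) (Finset.range (p l)) t
    rw [Finset.card_range] at hpow
    rw [hmain, hν, ← hpow]
    have hX : MemLp (fun ω : Option ℕ × ℤ → ℝ => normSum G l fun u => ω (mainIndex ℕ u)) 2 Q :=
      (memLp_normSum hG2 l).comp_measurePreserving (measurePreserving_reindex mainIndex_injective)
    have hY : MemLp (fun ω : Option ℕ × ℤ → ℝ => ∑ j ∈ Finset.range (p l), c l *
        partSum G (Finset.Icc ((j : ℤ) * (r l ^ 4 : ℕ) + 1) (j * (r l ^ 4 : ℕ) + n l))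
        fun u => ω (blockIndex E j u)) 2 Q :=
      memLp_finsetSum _ fun j _ =>
        (memLp_partSum_reindex hG2 _ (blockIndex_injective E j)).const_mul _
    refine (norm_charFun_map_sub_le hX hY t).trans ?_
    refine mul_le_mul_of_nonneg_left ?_ (abs_nonneg t)
    have hXY : (fun ω : Option ℕ × ℤ → ℝ => normSum G l fun u => ω (mainIndex ℕ u)) -
        (fun ω : Option ℕ × ℤ → ℝ => ∑ j ∈ Finset.range (p l), c l *
        partSum G (Finset.Icc ((j : ℤ) * (r l ^ 4 : ℕ) + 1) (j * (r l ^ 4 : ℕ) + n l))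
        fun u => ω (blockIndex E j u)) = fun ω : Option ℕ × ℤ → ℝ => c l * (
        partSum G (Finset.Icc 1 (l : ℤ)) (fun u => ω (mainIndex ℕ u)) -
        ∑ j ∈ Finset.range (p l),
          partSum G (Finset.Icc ((j : ℤ) * (r l ^ 4 : ℕ) + 1) (j * (r l ^ 4 : ℕ) + n l))
          fun u => ω (blockIndex E j u)) := by
      funext ω
      simp only [Pi.sub_apply, normSum, Finset.mul_sum, mul_sub]
      rfl
    rw [hXY, lpNorm_const_mul, abs_of_nonneg (by positivity : 0 ≤ c l)]
    have hB := lpNorm_bernstein_le hG hG2 h0 hD h2.le (Nat.div_mul_le_self l (r l ^ 4))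
    refine (mul_le_mul_of_nonneg_left hB (by positivity)).trans ?_
    rw [mul_add]
    refine add_le_add ?_ ?_
    · have hcs : c l = √(1 / l) := by simp only [hc]; rw [Real.sqrt_div' _ hl0'.le, Real.sqrt_one]
      rw [hcs, ← Real.sqrt_mul (by positivity)]
      refine Real.sqrt_le_sqrt ?_
      rw [← mul_assoc]
      refine mul_le_mul_of_nonneg_right ?_ hV0
      rw [one_div_mul_eq_div, div_le_iff₀ hl0']
      refine h3.trans (le_of_eq (by ring))
    · have h6 : (p l : ℝ) * (D / ((r l ^ 3 : ℕ) + 1)) ≤ p l * (D / (r l : ℝ) ^ 3) := by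
        push_cast
        gcongr
        linarith
      calc c l * ((p l : ℝ) * (D / ((r l ^ 3 : ℕ) + 1))) ≤ c l * (p l * (D / (r l : ℝ) ^ 3)) := by
            gcongr
        _ = (p l) / (√(l : ℝ) * r l ^ 3) * D := by
            simp only [hc]; field_simp
        _ ≤ 64 / r l * D := by gcongr
  simpa using hdiff.add hblock

end CLT

end BlockUStat

namespace BlockUStat

open scoped ENNReal

/-! ### Truncation -/

section Truncation

/-- Truncation at the levels `±K`. -/
noncomputable def clip (K y : ℝ) : ℝ := max (-K) (min y K)

@[fun_prop]
lemma measurable_clip (K : ℝ) : Measurable (clip K) := by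
  unfold clip; fun_prop

lemma abs_clip_le {K : ℝ} (hK : 0 ≤ K) (y : ℝ) : |clip K y| ≤ K := by
  unfold clip
  rw [abs_le]
  exact ⟨le_max_left _ _, max_le (by linarith) (min_le_right _ _)⟩

lemma clip_eq {K y : ℝ} (h : |y| ≤ K) : clip K y = y := by
  rw [abs_le] at h
  unfold clip
  rw [min_eq_left h.2, max_eq_right h.1]

lemma monotone_clip (K : ℝ) : Monotone (clip K) := fun x y h => by
  unfold clip
  exact max_le_max le_rfl (min_le_min h le_rfl)

/-- Both `clip K` and its complement are nondecreasing and they add up to the identity, so both are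
`1`-Lipschitz. Hence neither the truncated process nor the remainder has larger dependence
coefficients than the original. -/
lemma monotone_sub_clip {K : ℝ} (hK : 0 ≤ K) : Monotone fun y => y - clip K y := by
  intro x y h
  simp only [clip]
  rcases le_total x K with h1 | h1 <;> rcases le_total y K with h2 | h2 <;>
  rcases le_total x (-K) with h3 | h3 <;> rcases le_total y (-K) with h4 | h4 <;>
  simp only [min_eq_left, min_eq_right, h1, h2, max_eq_left, max_eq_right, h3, h4,
    (by linarith : -K ≤ K)] <;> linarith

lemma abs_clip_sub_clip_le {K : ℝ} (hK : 0 ≤ K) (x y : ℝ) : |clip K x - clip K y| ≤ |x - y| := by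
  wlog h : y ≤ x generalizing x y
  · rw [abs_sub_comm, abs_sub_comm x]; exact this y x (le_of_not_ge h)
  rw [abs_of_nonneg (sub_nonneg.mpr (monotone_clip K h)), abs_of_nonneg (sub_nonneg.mpr h)]
  have := monotone_sub_clip hK h
  simp only at this
  linarith

lemma abs_sub_clip_sub_le {K : ℝ} (hK : 0 ≤ K) (x y : ℝ) :
    |(x - clip K x) - (y - clip K y)| ≤ |x - y| := by
  wlog h : y ≤ x generalizing x y
  · rw [abs_sub_comm, abs_sub_comm x]; exact this y x (le_of_not_ge h)
  rw [abs_of_nonneg (sub_nonneg.mpr (monotone_sub_clip hK h)), abs_of_nonneg (sub_nonneg.mpr h)]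
  have := monotone_clip K h
  linarith

lemma abs_sub_clip_le {K : ℝ} (hK : 0 ≤ K) (y : ℝ) : |y - clip K y| ≤ |y| := by
  have := abs_sub_clip_sub_le hK y 0
  rwa [clip_eq (by simpa using hK : |(0 : ℝ)| ≤ K), sub_zero, sub_zero, sub_zero] at this

variable {μ : Measure ℝ} {G : (ℤ → ℝ) → ℝ}

lemma totalDep_comp_le {φ : ℝ → ℝ} (hφ : ∀ x y, |φ x - φ y| ≤ |x - y|) :
    totalDep μ (fun x => φ (G x)) ≤ totalDep μ G := by
  refine ENNReal.tsum_le_tsum fun i => ?_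
  gcongr
  exact eLpNorm_mono fun p => hφ _ _

lemma autoCov_sub_const [IsProbabilityMeasure μ] (hG2 : MemLp G 2 (iidLaw ℤ μ)) (a : ℝ) (t : ℤ) :
    autoCov μ (fun x => G x - a) t = autoCov μ G t := by
  rw [autoCov, covariance_sub_const_left (hG2.integrable (by norm_num)),
    covariance_sub_const_right ((memLp_shift hG2 t).integrable (by norm_num)), autoCov]

lemma tendsto_lpNorm_sub_clip (hG : Measurable G) (hG2 : MemLp G 2 (iidLaw ℤ μ)) :
    Tendsto (fun K : ℕ => lpNorm (fun x => G x - clip K (G x)) 2 (iidLaw ℤ μ)) atTop (𝓝 0) := by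
  have hmem : ∀ K : ℕ, MemLp (fun x => G x - clip K (G x)) 2 (iidLaw ℤ μ) := fun K =>
    hG2.mono (Measurable.aestronglyMeasurable (by fun_prop))
      (ae_of_all _ fun x => abs_sub_clip_le (Nat.cast_nonneg K) _)
  have hsq : Tendsto (fun K : ℕ => ∫ x, (G x - clip K (G x)) ^ 2 ∂(iidLaw ℤ μ)) atTop (𝓝 0) := by
    have h := tendsto_integral_of_dominated_convergence (μ := iidLaw ℤ μ)
      (F := fun (K : ℕ) x => (G x - clip K (G x)) ^ 2) (f := fun _ => 0) (fun x => G x ^ 2)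
      (fun K => Measurable.aestronglyMeasurable (by fun_prop)) hG2.integrable_sq
      (fun K => ae_of_all _ fun x => ?_) (ae_of_all _ fun x => ?_)
    · simpa using h
    · rw [Real.norm_eq_abs, abs_pow, ← sq_abs (G x)]
      exact pow_le_pow_left₀ (abs_nonneg _) (abs_sub_clip_le (Nat.cast_nonneg K) _) 2
    · refine tendsto_const_nhds.congr' ?_
      filter_upwards [eventually_ge_atTop ⌈|G x|⌉₊] with K hK
      have : |G x| ≤ K := (Nat.le_ceil _).trans (by exact_mod_cast hK)
      rw [clip_eq this, sub_self]
      norm_num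
  have := hsq.sqrt
  rw [Real.sqrt_zero] at this
  refine this.congr fun K => ?_
  rw [← lpNorm_two_sq (hmem K), Real.sqrt_sq lpNorm_nonneg]

end Truncation

/-! ### The central limit theorem without boundedness -/

section CLT

variable {μ : Measure ℝ} {G : (ℤ → ℝ) → ℝ}

lemma variance_normSum (l : ℕ) : Var[normSum G l; iidLaw ℤ μ] =
    Var[partSum G (Finset.Icc 1 (l : ℤ)); iidLaw ℤ μ] / l := by
  have : normSum G l = fun x => (1 / √(l : ℝ)) * partSum G (Finset.Icc 1 (l : ℤ)) x := rfl
  rw [this, variance_const_mul, div_pow, one_pow, Real.sq_sqrt (Nat.cast_nonneg l)]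
  ring

variable [IsProbabilityMeasure μ]

lemma tendsto_variance_normSum (hG : Measurable G) (hG2 : MemLp G 2 (iidLaw ℤ μ))
    (hD : totalDep μ G ≠ ⊤) :
    Tendsto (fun l : ℕ => Var[normSum G l; iidLaw ℤ μ]) atTop (𝓝 (∑' t, autoCov μ G t)) := by
  simp_rw [variance_normSum]
  exact tendsto_variance_partSum hG hG2 hD

lemma tsum_autoCov_nonneg (hG : Measurable G) (hG2 : MemLp G 2 (iidLaw ℤ μ))
    (hD : totalDep μ G ≠ ⊤) : 0 ≤ ∑' t, autoCov μ G t :=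
  ge_of_tendsto' (tendsto_variance_normSum hG hG2 hD) fun _ => variance_nonneg _ _

lemma variance_normSum_le (hG : Measurable G) (hG2 : MemLp G 2 (iidLaw ℤ μ))
    (hD : totalDep μ G ≠ ⊤) (l : ℕ) :
    Var[normSum G l; iidLaw ℤ μ] ≤ ∑' t, |autoCov μ G t| := by
  rw [variance_normSum]
  have h := variance_partSum_le hG hG2 hD (Finset.Icc 1 (l : ℤ))
  rw [Int.card_Icc, add_sub_cancel_right, Int.toNat_natCast] at h
  refine div_le_of_le_mul₀ (Nat.cast_nonneg l) (tsum_nonneg fun _ => abs_nonneg _) ?_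
  rwa [mul_comm]

lemma lpNorm_normSum_sq (hG2 : MemLp G 2 (iidLaw ℤ μ)) (h0 : ∫ x, G x ∂(iidLaw ℤ μ) = 0)
    (l : ℕ) : lpNorm (normSum G l) 2 (iidLaw ℤ μ) ^ 2 = Var[normSum G l; iidLaw ℤ μ] := by
  have : normSum G l = fun x => (1 / √(l : ℝ)) * partSum G (Finset.Icc 1 (l : ℤ)) x := rfl
  rw [this, lpNorm_const_mul, variance_const_mul, mul_pow, sq_abs, lpNorm_partSum_sq hG2 h0]

lemma normSum_add {G₁ G₂ : (ℤ → ℝ) → ℝ} (h : ∀ x, G x = G₁ x + G₂ x) (l : ℕ) :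
    normSum G l = normSum G₁ l + normSum G₂ l := by
  funext x
  simp only [normSum, partSum, Pi.add_apply, h, Finset.sum_add_distrib, mul_add]

/-- **Central limit theorem** for Bernoulli shifts. -/
theorem tendsto_charFun_normSum (hG : Measurable G) (hG2 : MemLp G 2 (iidLaw ℤ μ))
    (h0 : ∫ x, G x ∂(iidLaw ℤ μ) = 0) (hD : totalDep μ G ≠ ⊤) (t : ℝ) :
    Tendsto (fun l : ℕ => charFun ((iidLaw ℤ μ).map (normSum G l)) t) atTop
      (𝓝 (Complex.exp (-((∑' s, autoCov μ G s) * t ^ 2 / 2 : ℝ)))) := by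
  set m : ℕ → ℝ := fun K => ∫ x, clip K (G x) ∂(iidLaw ℤ μ) with hm
  set G₁ : ℕ → (ℤ → ℝ) → ℝ := fun K x => clip K (G x) - m K with hG₁
  -- As `G` is centred, the remainder `G - clip K G` has mean `-(m K)`, which is subtracted here.
  set G₂ : ℕ → (ℤ → ℝ) → ℝ := fun K x => (G x - clip K (G x)) - -(m K) with hG₂
  have hK0 : ∀ K : ℕ, (0 : ℝ) ≤ K := fun K => Nat.cast_nonneg K
  have hadd : ∀ K x, G x = G₁ K x + G₂ K x := fun K x => by simp only [hG₁, hG₂]; ring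
  have hm₁ : ∀ K, Measurable (G₁ K) := fun K => by fun_prop
  have hm₂ : ∀ K, Measurable (G₂ K) := fun K => by fun_prop
  have hclip2 : ∀ K : ℕ, MemLp (fun x => clip K (G x)) 2 (iidLaw ℤ μ) := fun K =>
    MemLp.of_bound (Measurable.aestronglyMeasurable (by fun_prop)) K
      (ae_of_all _ fun x => abs_clip_le (hK0 K) _)
  have hsub2 : ∀ K : ℕ, MemLp (fun x => G x - clip K (G x)) 2 (iidLaw ℤ μ) := fun K =>
    hG2.sub (hclip2 K)
  have h₁2 : ∀ K, MemLp (G₁ K) 2 (iidLaw ℤ μ) := fun K => (hclip2 K).sub (memLp_const _)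
  have h₂2 : ∀ K, MemLp (G₂ K) 2 (iidLaw ℤ μ) := fun K => (hsub2 K).sub (memLp_const _)
  have h₁0 : ∀ K, ∫ x, G₁ K x ∂(iidLaw ℤ μ) = 0 := fun K => by
    rw [integral_sub ((hclip2 K).integrable (by norm_num)) (integrable_const _)]
    simp [hm]
  have h₂0 : ∀ K, ∫ x, G₂ K x ∂(iidLaw ℤ μ) = 0 := fun K => by
    rw [integral_sub ((hsub2 K).integrable (by norm_num)) (integrable_const _),
      integral_sub (hG2.integrable (by norm_num)) ((hclip2 K).integrable (by norm_num)), h0]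
    simp [hm]
  have hD₁ : ∀ K, totalDep μ (G₁ K) ≠ ⊤ := fun K => ne_top_of_le_ne_top hD
    (totalDep_comp_le (φ := fun y => clip K y - m K) fun x y => by
      simpa using abs_clip_sub_clip_le (hK0 K) x y)
  have hD₂le : ∀ K : ℕ, totalDep μ (fun x => G x - clip K (G x)) ≤ totalDep μ G := fun K =>
    totalDep_comp_le (φ := fun y => y - clip K y) (abs_sub_clip_sub_le (hK0 K))
  have hD₂' : ∀ K : ℕ, totalDep μ (fun x => G x - clip K (G x)) ≠ ⊤ := fun K =>
    ne_top_of_le_ne_top hD (hD₂le K)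
  have hD₂ : ∀ K, totalDep μ (G₂ K) ≠ ⊤ := fun K => ne_top_of_le_ne_top hD
    (totalDep_comp_le (φ := fun y => (y - clip K y) - -(m K)) fun x y => by
      simpa using abs_sub_clip_sub_le (hK0 K) x y)
  -- the remainder is uniformly small
  set δ : ℕ → ℝ := fun K => ∑' s, |autoCov μ (G₂ K) s| with hδ
  have hδlim : Tendsto δ atTop (𝓝 0) := by
    -- The autocovariance sum of the remainder is at most its `L²` norm times a factor that stays
    -- bounded, since truncation does not increase `totalDep`.
    have hlim := tendsto_lpNorm_sub_clip hG hG2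
    have hup := hlim.mul (hlim.add_const
      (8 * (totalDep μ G).toReal * ∑' s : ℤ, 1 / (s : ℝ) ^ 2))
    rw [zero_mul] at hup
    refine squeeze_zero (fun K => tsum_nonneg fun _ => abs_nonneg _) (fun K => ?_) hup
    simp only [hδ, hG₂]
    simp_rw [autoCov_sub_const (hsub2 K)]
    refine (tsum_abs_autoCov_le (by fun_prop) (hsub2 K) (hD₂' K)).trans ?_
    refine mul_le_mul_of_nonneg_left ?_ lpNorm_nonneg
    gcongr
    exact hD₂le K
  set v := ∑' s, autoCov μ G s with hv
  have hv0 : 0 ≤ v := tsum_autoCov_nonneg hG hG2 hD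
  set vK : ℕ → ℝ := fun K => ∑' s, autoCov μ (G₁ K) s with hvK
  have hvK0 : ∀ K, 0 ≤ vK K := fun K => tsum_autoCov_nonneg (hm₁ K) (h₁2 K) (hD₁ K)
  -- For every `l` the standard deviations of the full and the truncated normalised sums differ by
  -- at most that of the remainder; the bound survives the limit in `l`.
  have hsd : ∀ K, |√(vK K) - √v| ≤ √(δ K) := by
    intro K
    have hl1 := (tendsto_variance_normSum (hm₁ K) (h₁2 K) (hD₁ K)).sqrt
    have hl2 := (tendsto_variance_normSum hG hG2 hD).sqrt
    refine le_of_tendsto' (hl1.sub hl2).abs fun l => ?_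
    have hrem : √(Var[normSum (G₂ K) l; iidLaw ℤ μ]) ≤ √(δ K) :=
      Real.sqrt_le_sqrt (variance_normSum_le (hm₂ K) (h₂2 K) (hD₂ K) l)
    have ha := abs_sqrt_variance_sub_le (memLp_normSum (h₁2 K) l) (memLp_normSum (h₂2 K) l)
    rw [← normSum_add (hadd K)] at ha
    have hb := abs_sqrt_variance_sub_le (memLp_normSum hG2 l) (memLp_normSum (h₂2 K) l).neg
    have hbb : normSum G l + -normSum (G₂ K) l = normSum (G₁ K) l := by
      rw [normSum_add (hadd K)]; simp
    rw [hbb, variance_neg] at hb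
    rw [abs_le]
    constructor <;> linarith
  have hvlim : Tendsto vK atTop (𝓝 v) := by
    have h1 : Tendsto (fun K => √(vK K)) atTop (𝓝 √v) := by
      rw [tendsto_iff_dist_tendsto_zero]
      refine squeeze_zero (fun _ => dist_nonneg) hsd ?_
      simpa using hδlim.sqrt
    have h2 := h1.pow 2
    rw [Real.sq_sqrt hv0] at h2
    exact h2.congr fun K => Real.sq_sqrt (hvK0 K)
  have hexp : Tendsto (fun K => Complex.exp (-((vK K) * t ^ 2 / 2 : ℝ))) atTop
      (𝓝 (Complex.exp (-(v * t ^ 2 / 2 : ℝ)))) := by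
    refine (Complex.continuous_exp.tendsto _).comp ?_
    refine Tendsto.neg ?_
    exact (Complex.continuous_ofReal.tendsto _).comp ((hvlim.mul_const _).div_const _)
  have hsmall : Tendsto (fun K => |t| * √(δ K) + dist (Complex.exp (-((vK K) * t ^ 2 / 2 : ℝ)))
      (Complex.exp (-(v * t ^ 2 / 2 : ℝ)))) atTop (𝓝 0) := by
    have h1 := (hδlim.sqrt.const_mul |t|).add (tendsto_iff_dist_tendsto_zero.mp hexp)
    simpa using h1
  rw [Metric.tendsto_atTop']
  intro η hη
  -- The truncation level is fixed before `l` grows; this is possible because the remainder is small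
  -- uniformly in `l`.
  obtain ⟨K, hK⟩ := (hsmall.eventually_lt_const (half_pos hη)).exists
  have hbdd : ∀ x, |G₁ K x| ≤ K + |m K| := fun x =>
    (abs_sub _ _).trans (add_le_add (abs_clip_le (hK0 K) _) le_rfl)
  obtain ⟨N, hN⟩ := Metric.tendsto_atTop'.mp
    (tendsto_charFun_normSum_of_bounded (hm₁ K) hbdd (h₁0 K) (hD₁ K) t) (η / 2) (half_pos hη)
  refine ⟨N, fun l hl => ?_⟩
  have h1 : dist (charFun ((iidLaw ℤ μ).map (normSum G l)) t)
      (charFun ((iidLaw ℤ μ).map (normSum (G₁ K) l)) t) ≤ |t| * √(δ K) := by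
    rw [dist_eq_norm]
    refine (norm_charFun_map_sub_le (memLp_normSum hG2 l) (memLp_normSum (h₁2 K) l) t).trans ?_
    refine mul_le_mul_of_nonneg_left ?_ (abs_nonneg t)
    rw [normSum_add (hadd K), add_sub_cancel_left]
    refine Real.le_sqrt_of_sq_le ?_
    rw [lpNorm_normSum_sq (h₂2 K) (h₂0 K)]
    exact variance_normSum_le (hm₂ K) (h₂2 K) (hD₂ K) l
  have h2 := hN l hl
  calc _ ≤ dist (charFun ((iidLaw ℤ μ).map (normSum G l)) t)
        (charFun ((iidLaw ℤ μ).map (normSum (G₁ K) l)) t) +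
      dist (charFun ((iidLaw ℤ μ).map (normSum (G₁ K) l)) t)
        (Complex.exp (-((vK K) * t ^ 2 / 2 : ℝ))) +
      dist (Complex.exp (-((vK K) * t ^ 2 / 2 : ℝ))) (Complex.exp (-(v * t ^ 2 / 2 : ℝ))) :=
        dist_triangle4 _ _ _ _
    _ < η := by linarith

end CLT

end BlockUStat

namespace BlockUStat

open scoped ENNReal

/-! ### Weak convergence and integrals of unbounded functions -/

section WeakConvergence

variable {E : Type*} [MeasurableSpace E] [TopologicalSpace E] [OpensMeasurableSpace E]
  [HasOuterApproxClosed E]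

/-- The portmanteau inequality for open sets, integrated over the levels of `f`: the integral of a
nonnegative continuous function is lower semicontinuous under weak convergence. -/
lemma eventually_sub_lt_integral {ρ : ProbabilityMeasure E} {ρs : ℕ → ProbabilityMeasure E}
    (hρ : Tendsto ρs atTop (𝓝 ρ)) {f : E → ℝ} (hf : Continuous f) (hf0 : 0 ≤ f)
    (hint : Integrable f (ρ : Measure E)) (hints : ∀ n, Integrable f (ρs n : Measure E)) {ε : ℝ}
    (hε : 0 < ε) :
    ∀ᶠ n in atTop, ∫ x, f x ∂(ρ : Measure E) - ε < ∫ x, f x ∂(ρs n : Measure E) := by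
  have h0 : ∀ n, 0 ≤ ∫ x, f x ∂(ρs n : Measure E) := fun n => integral_nonneg hf0
  rcases lt_or_ge (∫ x, f x ∂(ρ : Measure E) - ε) 0 with hneg | hpos
  · exact Eventually.of_forall fun n => hneg.trans_le (h0 n)
  have key := lintegral_le_liminf_lintegral_of_forall_isOpen_measure_le_liminf_measure
    (μ := (ρ : Measure E)) (μs := fun n => (ρs n : Measure E)) hf hf0
    fun G hG => ProbabilityMeasure.le_liminf_measure_open_of_tendsto hρ hG
  rw [← ofReal_integral_eq_lintegral_ofReal hint (ae_of_all _ hf0)] at key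
  have hlt : ENNReal.ofReal (∫ x, f x ∂(ρ : Measure E) - ε) <
      ENNReal.ofReal (∫ x, f x ∂(ρ : Measure E)) :=
    (ENNReal.ofReal_lt_ofReal_iff (by linarith)).mpr (by linarith)
  filter_upwards [eventually_lt_of_lt_liminf (hlt.trans_le key)] with n hn
  rw [← ofReal_integral_eq_lintegral_ofReal (hints n) (ae_of_all _ hf0)] at hn
  exact (ENNReal.ofReal_lt_ofReal_iff_of_nonneg hpos).mp hn

/-- Weak convergence together with convergence of the integrals of a dominating continuous
function gives convergence of integrals. -/
theorem tendsto_integral_of_dominating {ρ : ProbabilityMeasure E} {ρs : ℕ → ProbabilityMeasure E}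
    (hρ : Tendsto ρs atTop (𝓝 ρ)) {φ ψ : E → ℝ} (hφ : Continuous φ) (hψ : Continuous ψ)
    (hle : ∀ x, |φ x| ≤ ψ x) (hint : Integrable ψ (ρ : Measure E))
    (hints : ∀ n, Integrable ψ (ρs n : Measure E))
    (hlim : Tendsto (fun n => ∫ x, ψ x ∂(ρs n : Measure E)) atTop
      (𝓝 (∫ x, ψ x ∂(ρ : Measure E)))) :
    Tendsto (fun n => ∫ x, φ x ∂(ρs n : Measure E)) atTop (𝓝 (∫ x, φ x ∂(ρ : Measure E))) := by
  have hφi : Integrable φ (ρ : Measure E) :=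
    hint.mono' hφ.measurable.aestronglyMeasurable (ae_of_all _ hle)
  have hφis : ∀ n, Integrable φ (ρs n : Measure E) := fun n =>
    (hints n).mono' hφ.measurable.aestronglyMeasurable (ae_of_all _ hle)
  rw [Metric.tendsto_nhds]
  intro ε hε
  -- Lower semicontinuity is applied to the nonnegative functions `ψ + φ` and `ψ - φ`; convergence
  -- for `ψ` turns the two lower bounds into a two-sided one.
  have h1 := eventually_sub_lt_integral hρ (f := fun x => ψ x + φ x) (by fun_prop)
    (fun x => by have := (abs_le.mp (hle x)).1; change 0 ≤ ψ x + φ x; linarith)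
    (hint.add hφi) (fun n => (hints n).add (hφis n)) (half_pos hε)
  have h2 := eventually_sub_lt_integral hρ (f := fun x => ψ x - φ x) (by fun_prop)
    (fun x => by have := (abs_le.mp (hle x)).2; change 0 ≤ ψ x - φ x; linarith)
    (hint.sub hφi) (fun n => (hints n).sub (hφis n)) (half_pos hε)
  have h3 := (Metric.tendsto_nhds.mp hlim) (ε / 2) (half_pos hε)
  filter_upwards [h1, h2, h3] with n a b c
  rw [integral_add hint hφi, integral_add (hints n) (hφis n)] at a
  rw [integral_sub hint hφi, integral_sub (hints n) (hφis n)] at b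
  rw [Real.dist_eq, abs_lt] at c ⊢
  constructor <;> linarith [c.1, c.2]

end WeakConvergence

/-! ### Hoeffding's decomposition of a Lipschitz kernel -/

section Kernel

/-- The centring `∫∫ h dν dν`. -/
noncomputable def kernelMean (h : ℝ → ℝ → ℝ) (ν : Measure ℝ) : ℝ :=
  ∫ p : ℝ × ℝ, h p.1 p.2 ∂(ν.prod ν)

/-- The first-order term of Hoeffding's decomposition. -/
noncomputable def kernelProj (h : ℝ → ℝ → ℝ) (ν : Measure ℝ) (y : ℝ) : ℝ :=
  ∫ x, h x y ∂ν - kernelMean h ν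

/-- The degenerate term of Hoeffding's decomposition. -/
noncomputable def kernelDegen (h : ℝ → ℝ → ℝ) (ν : Measure ℝ) (x y : ℝ) : ℝ :=
  h x y - kernelProj h ν x - kernelProj h ν y - kernelMean h ν

/-- Lipschitz continuity of a function of two real variables. -/
def KernelLip (K : ℝ) (h : ℝ → ℝ → ℝ) : Prop :=
  ∀ x y x' y', |h x y - h x' y'| ≤ K * (|x - x'| + |y - y'|)

variable {K : ℝ} {h : ℝ → ℝ → ℝ}

lemma kernelLip_of_lipschitzWith {K : NNReal}
    (hK : LipschitzWith K (fun p : ℝ × ℝ => h p.1 p.2)) : KernelLip K h := by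
  intro x y x' y'
  have := hK.dist_le_mul (x, y) (x', y')
  rw [Real.dist_eq, Prod.dist_eq] at this
  refine this.trans (mul_le_mul_of_nonneg_left ?_ K.2)
  simp only [Real.dist_eq]
  exact max_le (by linarith [abs_nonneg (y - y')]) (by linarith [abs_nonneg (x - x')])

lemma KernelLip.nonneg (hL : KernelLip K h) : 0 ≤ K := by
  have := (abs_nonneg _).trans (hL 1 0 0 0)
  simpa using this

lemma KernelLip.continuous (hL : KernelLip K h) : Continuous (fun p : ℝ × ℝ => h p.1 p.2) := by
  have : LipschitzWith (Real.toNNReal (2 * K)) (fun p : ℝ × ℝ => h p.1 p.2) := by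
    refine LipschitzWith.of_dist_le_mul fun p q => ?_
    rw [Real.coe_toNNReal _ (by have := hL.nonneg; positivity), Real.dist_eq, Prod.dist_eq]
    refine (hL _ _ _ _).trans ?_
    have h1 := le_max_left (dist p.1 q.1) (dist p.2 q.2)
    have h2 := le_max_right (dist p.1 q.1) (dist p.2 q.2)
    rw [Real.dist_eq] at h1 h2
    rw [mul_comm 2 K, mul_assoc]
    refine mul_le_mul_of_nonneg_left ?_ hL.nonneg
    rw [Real.dist_eq, Real.dist_eq] at *
    linarith
  exact this.continuous

lemma KernelLip.measurable (hL : KernelLip K h) : Measurable (fun p : ℝ × ℝ => h p.1 p.2) :=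
  hL.continuous.measurable

lemma KernelLip.abs_le (hL : KernelLip K h) (x y : ℝ) :
    |h x y| ≤ |h 0 0| + K * (|x| + |y|) := by
  have h1 := hL x y 0 0
  rw [sub_zero, sub_zero] at h1
  have h2 := abs_sub_abs_le_abs_sub (h x y) (h 0 0)
  linarith

variable {ν : Measure ℝ}

lemma kernelDegen_symm (h_symm : ∀ x y, h x y = h y x) (x y : ℝ) :
    kernelDegen h ν x y = kernelDegen h ν y x := by
  simp only [kernelDegen, h_symm x y]; ring

variable [IsProbabilityMeasure ν]

lemma integrable_abs_of_memLp (hν : MemLp id 2 ν) : Integrable (fun x : ℝ => |x|) ν :=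
  (hν.integrable (by norm_num)).abs

lemma KernelLip.memLp_prod (hL : KernelLip K h) (hν : MemLp id 2 ν) :
    MemLp (fun p : ℝ × ℝ => h p.1 p.2) 2 (ν.prod ν) := by
  have h1 : MemLp (fun p : ℝ × ℝ => |h 0 0| + K * (|p.1| + |p.2|)) 2 (ν.prod ν) := by
    have ha : MemLp (fun p : ℝ × ℝ => p.1) 2 (ν.prod ν) := hν.comp_fst ν
    have hb : MemLp (fun p : ℝ × ℝ => p.2) 2 (ν.prod ν) := hν.comp_snd ν
    have ha' : MemLp (fun p : ℝ × ℝ => |p.1|) 2 (ν.prod ν) := ha.abs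
    have hb' : MemLp (fun p : ℝ × ℝ => |p.2|) 2 (ν.prod ν) := hb.abs
    have hab : MemLp (fun p : ℝ × ℝ => |p.1| + |p.2|) 2 (ν.prod ν) := ha'.add hb'
    have hK : MemLp (fun p : ℝ × ℝ => K * (|p.1| + |p.2|)) 2 (ν.prod ν) := hab.const_mul K
    have hc : MemLp (fun _ : ℝ × ℝ => |h 0 0|) 2 (ν.prod ν) := memLp_const _
    exact hc.add hK
  refine h1.mono hL.measurable.aestronglyMeasurable (ae_of_all _ fun p => ?_)
  rw [Real.norm_eq_abs, Real.norm_eq_abs]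
  exact (hL.abs_le _ _).trans (le_abs_self _)

lemma KernelLip.integrable_left (hL : KernelLip K h) (hν : MemLp id 2 ν) (y : ℝ) :
    Integrable (fun x => h x y) ν := by
  have h1 : Integrable (fun x : ℝ => |h 0 0| + K * (|x| + |y|)) ν :=
    (integrable_const _).add (((integrable_abs_of_memLp hν).add (integrable_const _)).const_mul K)
  refine h1.mono' ?_ (ae_of_all _ fun x => hL.abs_le x y)
  exact (hL.continuous.comp (by fun_prop : Continuous fun x : ℝ => (x, y))).aestronglyMeasurable

lemma KernelLip.abs_kernelProj_sub_le (hL : KernelLip K h) (hν : MemLp id 2 ν) (y y' : ℝ) :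
    |kernelProj h ν y - kernelProj h ν y'| ≤ K * |y - y'| := by
  have h1 : kernelProj h ν y - kernelProj h ν y' = ∫ x, (h x y - h x y') ∂ν := by
    rw [integral_sub (hL.integrable_left hν y) (hL.integrable_left hν y')]
    simp only [kernelProj]; ring
  rw [h1]
  refine abs_integral_le_integral_abs.trans ?_
  have h2 : ∫ _, K * |y - y'| ∂ν = K * |y - y'| := by simp
  rw [← h2]
  refine integral_mono ((hL.integrable_left hν y).sub (hL.integrable_left hν y')).abs
    (integrable_const _) fun x => ?_
  have := hL x y x y'
  simpa using this

lemma KernelLip.continuous_kernelProj (hL : KernelLip K h) (hν : MemLp id 2 ν) :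
    Continuous (kernelProj h ν) := by
  have : LipschitzWith (Real.toNNReal K) (kernelProj h ν) := by
    refine LipschitzWith.of_dist_le_mul fun y y' => ?_
    rw [Real.coe_toNNReal _ hL.nonneg, Real.dist_eq, Real.dist_eq]
    exact hL.abs_kernelProj_sub_le hν y y'
  exact this.continuous

lemma KernelLip.integrable_kernelProj (hL : KernelLip K h) (hν : MemLp id 2 ν) :
    Integrable (kernelProj h ν) ν := by
  have h1 : Integrable (fun y : ℝ => |kernelProj h ν 0| + K * |y|) ν :=
    (integrable_const _).add ((integrable_abs_of_memLp hν).const_mul K)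
  refine h1.mono' (hL.continuous_kernelProj hν).aestronglyMeasurable (ae_of_all _ fun y => ?_)
  have h2 := hL.abs_kernelProj_sub_le hν y 0
  rw [sub_zero] at h2
  have h3 := abs_sub_abs_le_abs_sub (kernelProj h ν y) (kernelProj h ν 0)
  rw [Real.norm_eq_abs]
  linarith

lemma KernelLip.integral_kernelProj (hL : KernelLip K h) (hν : MemLp id 2 ν) :
    ∫ y, kernelProj h ν y ∂ν = 0 := by
  have hi := (hL.memLp_prod hν).integrable (by norm_num : (1 : ℝ≥0∞) ≤ 2)
  have h1 : ∫ y, ∫ x, h x y ∂ν ∂ν = kernelMean h ν :=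
    (integral_prod_symm (fun p : ℝ × ℝ => h p.1 p.2) hi).symm
  have h2 : Integrable (fun y => ∫ x, h x y ∂ν) ν := hi.integral_prod_right
  simp only [kernelProj]
  rw [integral_sub h2 (integrable_const _), h1]
  simp

/-- The projection has mean zero, so its value at `y` is the mean of its increments to an
independent point. The bound involves `ν` only through its first absolute moment and is therefore
uniform along the sequence of laws. -/
lemma KernelLip.abs_kernelProj_le (hL : KernelLip K h) (hν : MemLp id 2 ν) (y : ℝ) :
    |kernelProj h ν y| ≤ K * (|y| + ∫ z, |z| ∂ν) := by
  have hi := hL.integrable_kernelProj hν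
  have h1 : kernelProj h ν y = ∫ z, (kernelProj h ν y - kernelProj h ν z) ∂ν := by
    rw [integral_sub (integrable_const _) hi, hL.integral_kernelProj hν]; simp
  have h2 : ∫ z, K * (|y| + |z|) ∂ν = K * (|y| + ∫ z, |z| ∂ν) := by
    rw [integral_const_mul, integral_add (integrable_const _) (integrable_abs_of_memLp hν)]
    simp
  rw [h1, ← h2]
  refine abs_integral_le_integral_abs.trans ?_
  refine integral_mono ((integrable_const _).sub hi).abs
    (((integrable_const _).add (integrable_abs_of_memLp hν)).const_mul K) fun z => ?_
  exact (hL.abs_kernelProj_sub_le hν y z).trans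
    (mul_le_mul_of_nonneg_left (abs_sub _ _) hL.nonneg)

lemma KernelLip.measurable_kernelProj (hL : KernelLip K h) (hν : MemLp id 2 ν) :
    Measurable (kernelProj h ν) := (hL.continuous_kernelProj hν).measurable

lemma KernelLip.measurable_kernelDegen (hL : KernelLip K h) (hν : MemLp id 2 ν) :
    Measurable (fun p : ℝ × ℝ => kernelDegen h ν p.1 p.2) := by
  have h1 := hL.measurable
  have h2 := hL.measurable_kernelProj hν
  unfold kernelDegen
  fun_prop

lemma KernelLip.integral_kernelDegen (hL : KernelLip K h) (hν : MemLp id 2 ν) (y : ℝ) :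
    ∫ x, kernelDegen h ν x y ∂ν = 0 := by
  have h1 := hL.integrable_left hν y
  have h2 := hL.integrable_kernelProj hν
  have h3 : Integrable (fun x => h x y - kernelProj h ν x) ν := h1.sub h2
  have h4 : Integrable (fun x => h x y - kernelProj h ν x - kernelProj h ν y) ν :=
    h3.sub (integrable_const _)
  simp only [kernelDegen]
  rw [integral_sub h4 (integrable_const _), integral_sub h3 (integrable_const _),
    integral_sub h1 h2, hL.integral_kernelProj hν]
  simp [kernelProj]

/-- Again by centring, now in the second variable: the kernel and its projection are both
`K`-Lipschitz there, whence `2K`. The bound does not depend on `x`. -/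
lemma KernelLip.abs_kernelDegen_le (hL : KernelLip K h) (h_symm : ∀ x y, h x y = h y x)
    (hν : MemLp id 2 ν) (x y : ℝ) :
    |kernelDegen h ν x y| ≤ 2 * K * (|y| + ∫ z, |z| ∂ν) := by
  have hd : ∀ z, |kernelDegen h ν x y - kernelDegen h ν x z| ≤ 2 * K * (|y| + |z|) := by
    intro z
    have h1 := hL x y x z
    have h2 := hL.abs_kernelProj_sub_le hν y z
    rw [sub_self, abs_zero, zero_add] at h1
    have h3 : kernelDegen h ν x y - kernelDegen h ν x z =
        (h x y - h x z) - (kernelProj h ν y - kernelProj h ν z) := by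
      simp only [kernelDegen]; ring
    have h4 : K * |y - z| ≤ K * (|y| + |z|) :=
      mul_le_mul_of_nonneg_left (abs_sub _ _) hL.nonneg
    rw [h3]
    refine (abs_sub _ _).trans ?_
    linarith
  have hzero : ∫ z, kernelDegen h ν x z ∂ν = 0 := by
    simp_rw [fun z => kernelDegen_symm (ν := ν) h_symm x z]
    exact hL.integral_kernelDegen hν x
  have hi : Integrable (fun z => kernelDegen h ν x z) ν := by
    have h1 : Integrable (fun z => h x z) ν := by
      simp_rw [h_symm x]; exact hL.integrable_left hν x
    have h2 := hL.integrable_kernelProj hν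
    exact ((h1.sub (integrable_const _)).sub h2).sub (integrable_const _)
  have h1 : kernelDegen h ν x y = ∫ z, (kernelDegen h ν x y - kernelDegen h ν x z) ∂ν := by
    rw [integral_sub (integrable_const _) hi, hzero]; simp
  have h2 : ∫ z, 2 * K * (|y| + |z|) ∂ν = 2 * K * (|y| + ∫ z, |z| ∂ν) := by
    rw [integral_const_mul, integral_add (integrable_const _) (integrable_abs_of_memLp hν)]
    simp
  rw [h1, ← h2]
  refine abs_integral_le_integral_abs.trans ?_
  exact integral_mono ((integrable_const _).sub hi).abs
    (((integrable_const _).add (integrable_abs_of_memLp hν)).const_mul _) hd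

end Kernel

end BlockUStat

namespace BlockUStat

lemma integral_comp_measurePreserving {α β : Type*} [MeasurableSpace α] [MeasurableSpace β]
    {η : Measure β} {ν : Measure α} {φ : β → α} (hφ : MeasurePreserving φ η ν) {X : α → ℝ}
    (hX : Measurable X) : ∫ x, X (φ x) ∂η = ∫ x, X x ∂ν := by
  rw [← hφ.map_eq, integral_map hφ.measurable.aemeasurable hX.aestronglyMeasurable]

/-! ### The variance of the projection as a covariance -/

section KernelLimits

/-- The variance of the first-order term of Hoeffding's decomposition. -/
noncomputable def kernelVar (h : ℝ → ℝ → ℝ) (ν : Measure ℝ) : ℝ :=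
  ∫ y, kernelProj h ν y ^ 2 ∂ν

variable {K : ℝ} {h : ℝ → ℝ → ℝ}

lemma kernelVar_nonneg (ν : Measure ℝ) : 0 ≤ kernelVar h ν :=
  integral_nonneg fun _ => sq_nonneg _

lemma KernelLip.abs_le_sq (hL : KernelLip K h) (x y : ℝ) :
    |h x y| ≤ (|h 0 0| + K) * (1 + x ^ 2 + y ^ 2) := by
  have h1 := hL.abs_le x y
  have h2 : |x| + |y| ≤ 1 + x ^ 2 + y ^ 2 := by
    nlinarith [sq_nonneg (|x| - 1), sq_nonneg (|y| - 1), sq_abs x, sq_abs y]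
  have h3 : K * (|x| + |y|) ≤ K * (1 + x ^ 2 + y ^ 2) := mul_le_mul_of_nonneg_left h2 hL.nonneg
  have h4 : |h 0 0| * 1 ≤ |h 0 0| * (1 + x ^ 2 + y ^ 2) :=
    mul_le_mul_of_nonneg_left (by nlinarith [sq_nonneg x, sq_nonneg y]) (abs_nonneg _)
  linarith

lemma KernelLip.sq_le (hL : KernelLip K h) (x y : ℝ) :
    h x y ^ 2 ≤ 3 * (h 0 0 ^ 2 + K ^ 2 * x ^ 2 + K ^ 2 * y ^ 2) := by
  have h1 : h x y ^ 2 ≤ (|h 0 0| + K * (|x| + |y|)) ^ 2 := by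
    rw [← sq_abs (h x y)]
    exact pow_le_pow_left₀ (abs_nonneg _) (hL.abs_le x y) 2
  nlinarith [sq_abs x, sq_abs y, sq_abs (h 0 0), sq_nonneg (|h 0 0| - K * |x|),
    sq_nonneg (|h 0 0| - K * |y|), sq_nonneg (K * |x| - K * |y|)]

lemma KernelLip.abs_mul_le (hL : KernelLip K h) (x y z : ℝ) :
    |h y x * h z x| ≤ 3 * (h 0 0 ^ 2 + K ^ 2) * (1 + x ^ 2 + y ^ 2 + z ^ 2) := by
  have h1 := hL.sq_le y x
  have h2 := hL.sq_le z x
  have h3 : |h y x * h z x| ≤ (h y x ^ 2 + h z x ^ 2) / 2 := by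
    rw [abs_mul]
    nlinarith [sq_nonneg (|h y x| - |h z x|), sq_abs (h y x), sq_abs (h z x)]
  have h4 : 0 ≤ h 0 0 ^ 2 * (x ^ 2 + y ^ 2 + z ^ 2) := by positivity
  have h5 : 0 ≤ K ^ 2 * (2 + y ^ 2 + z ^ 2) := by positivity
  linarith

variable {ν : Measure ℝ} [IsProbabilityMeasure ν]

lemma KernelLip.memLp_kernelProj (hL : KernelLip K h) (hν : MemLp id 2 ν) :
    MemLp (kernelProj h ν) 2 ν := by
  have h1 : MemLp (fun y : ℝ => |y|) 2 ν := hν.abs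
  have h2 : MemLp (fun _ : ℝ => ∫ z, |z| ∂ν) 2 ν := memLp_const _
  have h3 : MemLp (fun y : ℝ => |y| + ∫ z, |z| ∂ν) 2 ν := h1.add h2
  have h4 : MemLp (fun y : ℝ => K * (|y| + ∫ z, |z| ∂ν)) 2 ν := h3.const_mul K
  refine h4.mono (hL.measurable_kernelProj hν).aestronglyMeasurable (ae_of_all _ fun y => ?_)
  rw [Real.norm_eq_abs, Real.norm_eq_abs]
  exact (hL.abs_kernelProj_le hν y).trans (le_abs_self _)

lemma KernelLip.memLp_snd_fst (hL : KernelLip K h) (hν : MemLp id 2 ν) :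
    MemLp (fun p : ℝ × ℝ × ℝ => h p.2.1 p.1) 2 (ν.prod (ν.prod ν)) := by
  have h1 : MeasurePreserving (fun p : ℝ × ℝ × ℝ => (p.2.1, p.1)) (ν.prod (ν.prod ν))
      (ν.prod ν) :=
    Measure.measurePreserving_swap.comp
      ((MeasurePreserving.id ν).prod (measurePreserving_fst (μ := ν) (ν := ν)))
  exact (hL.memLp_prod hν).comp_measurePreserving h1

lemma KernelLip.memLp_snd_snd (hL : KernelLip K h) (hν : MemLp id 2 ν) :
    MemLp (fun p : ℝ × ℝ × ℝ => h p.2.2 p.1) 2 (ν.prod (ν.prod ν)) := by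
  have h1 : MeasurePreserving (fun p : ℝ × ℝ × ℝ => (p.2.2, p.1)) (ν.prod (ν.prod ν))
      (ν.prod ν) :=
    Measure.measurePreserving_swap.comp
      ((MeasurePreserving.id ν).prod (measurePreserving_snd (μ := ν) (ν := ν)))
  exact (hL.memLp_prod hν).comp_measurePreserving h1

/-- Given the shared coordinate `p.1 = y`, the two factors are independent with common mean
`kernelProj h ν y + kernelMean h ν`. -/
lemma KernelLip.integral_mul_eq (hL : KernelLip K h) (hν : MemLp id 2 ν) :
    ∫ p : ℝ × ℝ × ℝ, h p.2.1 p.1 * h p.2.2 p.1 ∂(ν.prod (ν.prod ν)) =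
      kernelVar h ν + kernelMean h ν ^ 2 := by
  have hi : Integrable (fun p : ℝ × ℝ × ℝ => h p.2.1 p.1 * h p.2.2 p.1)
      (ν.prod (ν.prod ν)) := (hL.memLp_snd_fst hν).integrable_mul (hL.memLp_snd_snd hν)
  rw [integral_prod _ hi]
  have h1 : ∀ y, ∫ q : ℝ × ℝ, h q.1 y * h q.2 y ∂(ν.prod ν) =
      kernelProj h ν y ^ 2 + 2 * kernelMean h ν * kernelProj h ν y + kernelMean h ν ^ 2 := by
    intro y
    rw [integral_prod_mul (fun x => h x y) (fun x => h x y)]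
    simp only [kernelProj]; ring
  simp_rw [h1]
  have h2 : Integrable (fun y => kernelProj h ν y ^ 2) ν := (hL.memLp_kernelProj hν).integrable_sq
  have h3 := hL.integrable_kernelProj hν
  have h4 : Integrable (fun y => 2 * kernelMean h ν * kernelProj h ν y) ν := h3.const_mul _
  have h5 : Integrable (fun y => kernelProj h ν y ^ 2 + 2 * kernelMean h ν * kernelProj h ν y) ν :=
    h2.add h4
  rw [integral_add h5 (integrable_const _), integral_add h2 h4, integral_const_mul,
    hL.integral_kernelProj hν]
  simp [kernelVar]

theorem KernelLip.covariance_eq_kernelVar (hL : KernelLip K h) (h_symm : ∀ x y, h x y = h y x)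
    (hν : MemLp id 2 ν) :
    cov[fun p : ℝ × ℝ × ℝ => h p.2.1 p.1, fun p => h p.1 p.2.2; ν.prod (ν.prod ν)] =
      kernelVar h ν := by
  simp_rw [fun p : ℝ × ℝ × ℝ => h_symm p.1 p.2.2]
  have h2 : MeasurePreserving (fun p : ℝ × ℝ × ℝ => (p.2.2, p.1)) (ν.prod (ν.prod ν))
      (ν.prod ν) :=
    Measure.measurePreserving_swap.comp
      ((MeasurePreserving.id ν).prod (measurePreserving_snd (μ := ν) (ν := ν)))
  have h1 : MeasurePreserving (fun p : ℝ × ℝ × ℝ => (p.2.1, p.1)) (ν.prod (ν.prod ν))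
      (ν.prod ν) :=
    Measure.measurePreserving_swap.comp
      ((MeasurePreserving.id ν).prod (measurePreserving_fst (μ := ν) (ν := ν)))
  have hm := hL.measurable
  have e1 : ∫ p : ℝ × ℝ × ℝ, h p.2.1 p.1 ∂(ν.prod (ν.prod ν)) = kernelMean h ν := by
    exact integral_comp_measurePreserving h1 hm
  have e2 : ∫ p : ℝ × ℝ × ℝ, h p.2.2 p.1 ∂(ν.prod (ν.prod ν)) = kernelMean h ν := by
    exact integral_comp_measurePreserving h2 hm
  rw [covariance_eq_sub (hL.memLp_snd_fst hν) (hL.memLp_snd_snd hν), e1, e2]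
  have := hL.integral_mul_eq hν
  simp only [Pi.mul_apply]
  rw [this]; ring

theorem KernelLip.gammaSq_eq_kernelVar (hL : KernelLip K h) (h_symm : ∀ x y, h x y = h y x)
    {v : NNReal} : gammaSq h (√(v : ℝ)) = kernelVar h (gaussianReal 0 v) := by
  have hs : MeasurePreserving (fun x : ℝ => √(v : ℝ) * x) (gaussianReal 0 1)
      (gaussianReal 0 v) := by
    refine ⟨by fun_prop, ?_⟩
    rw [gaussianReal_map_const_mul]
    congr 1
    · simp
    · ext; simp
  -- Coordinate `1` is the variable shared by both kernels, so it is the one moved to the front.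
  have h3 := (measurePreserving_piFinSuccAbove (fun _ : Fin 3 => gaussianReal 0 1) 1)
  have h2 := (measurePreserving_piFinTwo (fun _ : Fin 2 => gaussianReal 0 1))
  have hφ : MeasurePreserving (fun x : Fin 3 → ℝ =>
      (√(v : ℝ) * x 1, √(v : ℝ) * x 0, √(v : ℝ) * x 2)) (Measure.pi fun _ => gaussianReal 0 1)
      ((gaussianReal 0 v).prod ((gaussianReal 0 v).prod (gaussianReal 0 v))) := by
    have := (hs.prod (hs.prod hs)).comp (((MeasurePreserving.id _).prod h2).comp h3)
    exact this
  have hm := hL.measurable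
  rw [← hL.covariance_eq_kernelVar h_symm (memLp_id_gaussianReal 2)]
  exact covariance_comp_measurePreserving hφ (X := fun p : ℝ × ℝ × ℝ => h p.2.1 p.1)
    (Y := fun p : ℝ × ℝ × ℝ => h p.1 p.2.2) (by fun_prop) (by fun_prop)

end KernelLimits

/-! ### Continuity of mean and variance of the kernel along weakly convergent laws -/

section WeakKernelLimits

variable {K : ℝ} {h : ℝ → ℝ → ℝ} {ρ : ProbabilityMeasure ℝ} {ρs : ℕ → ProbabilityMeasure ℝ}

/-- The product laws converge weakly, and `h` is dominated by a quadratic polynomial whose integral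
depends on the law through its second moment only. -/
theorem KernelLip.tendsto_kernelMean (hL : KernelLip K h) (hρ : Tendsto ρs atTop (𝓝 ρ))
    (h2 : MemLp id 2 (ρ : Measure ℝ)) (h2s : ∀ n, MemLp id 2 (ρs n : Measure ℝ))
    (hsq : Tendsto (fun n => ∫ x, x ^ 2 ∂(ρs n : Measure ℝ)) atTop
      (𝓝 (∫ x, x ^ 2 ∂(ρ : Measure ℝ)))) :
    Tendsto (fun n => kernelMean h (ρs n)) atTop (𝓝 (kernelMean h ρ)) := by
  have hprod : Tendsto (fun n => (ρs n).prod (ρs n)) atTop (𝓝 (ρ.prod ρ)) :=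
    (ProbabilityMeasure.continuous_prod.tendsto (ρ, ρ)).comp (hρ.prodMk_nhds hρ)
  have ha : ∀ η : ProbabilityMeasure ℝ, MemLp id 2 (η : Measure ℝ) →
      Integrable (fun p : ℝ × ℝ => p.1 ^ 2) (η.prod η : Measure (ℝ × ℝ)) := fun η hη =>
    MemLp.integrable_sq (hη.comp_fst (η : Measure ℝ))
  have hb : ∀ η : ProbabilityMeasure ℝ, MemLp id 2 (η : Measure ℝ) →
      Integrable (fun p : ℝ × ℝ => p.2 ^ 2) (η.prod η : Measure (ℝ × ℝ)) := fun η hη =>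
    MemLp.integrable_sq (hη.comp_snd (η : Measure ℝ))
  have hc : ∀ η : ProbabilityMeasure ℝ, MemLp id 2 (η : Measure ℝ) →
      Integrable (fun p : ℝ × ℝ => 1 + p.1 ^ 2) (η.prod η : Measure (ℝ × ℝ)) := fun η hη =>
    (integrable_const _).add (ha η hη)
  have hd : ∀ η : ProbabilityMeasure ℝ, MemLp id 2 (η : Measure ℝ) →
      Integrable (fun p : ℝ × ℝ => (|h 0 0| + K) * (1 + p.1 ^ 2 + p.2 ^ 2))
        (η.prod η : Measure (ℝ × ℝ)) := fun η hη =>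
    ((hc η hη).add (hb η hη)).const_mul _
  have he : ∀ η : ProbabilityMeasure ℝ, MemLp id 2 (η : Measure ℝ) →
      ∫ p : ℝ × ℝ, (|h 0 0| + K) * (1 + p.1 ^ 2 + p.2 ^ 2) ∂(η.prod η : Measure (ℝ × ℝ)) =
        (|h 0 0| + K) * (1 + 2 * ∫ x, x ^ 2 ∂(η : Measure ℝ)) := fun η hη => by
    rw [integral_const_mul, integral_add (hc η hη) (hb η hη),
      integral_add (integrable_const _) (ha η hη), ProbabilityMeasure.toMeasure_prod,
      integral_comp_measurePreserving (X := fun x : ℝ => x ^ 2) measurePreserving_fst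
        (by fun_prop),
      integral_comp_measurePreserving (X := fun x : ℝ => x ^ 2) measurePreserving_snd
        (by fun_prop)]
    simp only [integral_const, probReal_univ, one_smul]; ring
  refine tendsto_integral_of_dominating hprod hL.continuous
    (ψ := fun p => (|h 0 0| + K) * (1 + p.1 ^ 2 + p.2 ^ 2)) (by fun_prop)
    (fun p => hL.abs_le_sq _ _) (hd ρ h2) (fun n => hd _ (h2s n)) ?_
  rw [he ρ h2]
  simp_rw [fun n => he _ (h2s n)]
  exact ((hsq.const_mul 2).const_add 1).const_mul _

/-- The integrand `kernelProj h ν ^ 2` itself varies with the law. Written as a triple integral of a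
fixed continuous function of quadratic growth, minus the squared mean, the variance becomes
accessible to weak convergence. -/
theorem KernelLip.tendsto_kernelVar (hL : KernelLip K h) (hρ : Tendsto ρs atTop (𝓝 ρ))
    (h2 : MemLp id 2 (ρ : Measure ℝ)) (h2s : ∀ n, MemLp id 2 (ρs n : Measure ℝ))
    (hsq : Tendsto (fun n => ∫ x, x ^ 2 ∂(ρs n : Measure ℝ)) atTop
      (𝓝 (∫ x, x ^ 2 ∂(ρ : Measure ℝ)))) :
    Tendsto (fun n => kernelVar h (ρs n)) atTop (𝓝 (kernelVar h ρ)) := by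
  have hprod : Tendsto (fun n => (ρs n).prod ((ρs n).prod (ρs n))) atTop
      (𝓝 (ρ.prod (ρ.prod ρ))) :=
    (ProbabilityMeasure.continuous_prod.tendsto (ρ, ρ.prod ρ)).comp (hρ.prodMk_nhds
      ((ProbabilityMeasure.continuous_prod.tendsto (ρ, ρ)).comp (hρ.prodMk_nhds hρ)))
  set C : ℝ := 3 * (h 0 0 ^ 2 + K ^ 2) with hC
  have ha : ∀ η : ProbabilityMeasure ℝ, MemLp id 2 (η : Measure ℝ) →
      Integrable (fun p : ℝ × ℝ × ℝ => p.1 ^ 2)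
        (η.prod (η.prod η) : Measure (ℝ × ℝ × ℝ)) := fun η hη =>
    MemLp.integrable_sq (hη.comp_fst (η.prod η : Measure (ℝ × ℝ)))
  have hb : ∀ η : ProbabilityMeasure ℝ, MemLp id 2 (η : Measure ℝ) →
      Integrable (fun p : ℝ × ℝ × ℝ => p.2.1 ^ 2)
        (η.prod (η.prod η) : Measure (ℝ × ℝ × ℝ)) := fun η hη =>
    MemLp.integrable_sq ((hη.comp_fst (η : Measure ℝ)).comp_snd (η : Measure ℝ))
  have hb' : ∀ η : ProbabilityMeasure ℝ, MemLp id 2 (η : Measure ℝ) →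
      Integrable (fun p : ℝ × ℝ × ℝ => p.2.2 ^ 2)
        (η.prod (η.prod η) : Measure (ℝ × ℝ × ℝ)) := fun η hη =>
    MemLp.integrable_sq ((hη.comp_snd (η : Measure ℝ)).comp_snd (η : Measure ℝ))
  have hc : ∀ η : ProbabilityMeasure ℝ, MemLp id 2 (η : Measure ℝ) →
      Integrable (fun p : ℝ × ℝ × ℝ => 1 + p.1 ^ 2)
        (η.prod (η.prod η) : Measure (ℝ × ℝ × ℝ)) := fun η hη =>
    (integrable_const _).add (ha η hη)
  have hc' : ∀ η : ProbabilityMeasure ℝ, MemLp id 2 (η : Measure ℝ) →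
      Integrable (fun p : ℝ × ℝ × ℝ => 1 + p.1 ^ 2 + p.2.1 ^ 2)
        (η.prod (η.prod η) : Measure (ℝ × ℝ × ℝ)) := fun η hη =>
    (hc η hη).add (hb η hη)
  have hd : ∀ η : ProbabilityMeasure ℝ, MemLp id 2 (η : Measure ℝ) →
      Integrable (fun p : ℝ × ℝ × ℝ => C * (1 + p.1 ^ 2 + p.2.1 ^ 2 + p.2.2 ^ 2))
        (η.prod (η.prod η) : Measure (ℝ × ℝ × ℝ)) := fun η hη =>
    ((hc' η hη).add (hb' η hη)).const_mul _
  have he : ∀ η : ProbabilityMeasure ℝ, MemLp id 2 (η : Measure ℝ) →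
      ∫ p : ℝ × ℝ × ℝ, C * (1 + p.1 ^ 2 + p.2.1 ^ 2 + p.2.2 ^ 2)
        ∂(η.prod (η.prod η) : Measure (ℝ × ℝ × ℝ)) =
        C * (1 + 3 * ∫ x, x ^ 2 ∂(η : Measure ℝ)) := fun η hη => by
    rw [integral_const_mul, integral_add (hc' η hη) (hb' η hη),
      integral_add (hc η hη) (hb η hη),
      integral_add (integrable_const _) (ha η hη), ProbabilityMeasure.toMeasure_prod,
      ProbabilityMeasure.toMeasure_prod,
      integral_comp_measurePreserving (X := fun x : ℝ => x ^ 2) measurePreserving_fst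
        (by fun_prop),
      integral_comp_measurePreserving (X := fun x : ℝ × ℝ => x.1 ^ 2) measurePreserving_snd
        (by fun_prop),
      integral_comp_measurePreserving (X := fun x : ℝ × ℝ => x.2 ^ 2) measurePreserving_snd
        (by fun_prop),
      integral_comp_measurePreserving (X := fun x : ℝ => x ^ 2) measurePreserving_fst
        (by fun_prop),
      integral_comp_measurePreserving (X := fun x : ℝ => x ^ 2) measurePreserving_snd
        (by fun_prop)]
    simp only [integral_const, probReal_univ, one_smul]; ring
  have hcont := hL.continuous
  have key := tendsto_integral_of_dominating hprod
    (φ := fun p : ℝ × ℝ × ℝ => h p.2.1 p.1 * h p.2.2 p.1)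
    (ψ := fun p => C * (1 + p.1 ^ 2 + p.2.1 ^ 2 + p.2.2 ^ 2)) (by fun_prop) (by fun_prop)
    (fun p => hL.abs_mul_le _ _ _) (hd ρ h2) (fun n => hd _ (h2s n)) (by
      rw [he ρ h2]
      simp_rw [fun n => he _ (h2s n)]
      exact ((hsq.const_mul 3).const_add 1).const_mul _)
  have e : ∀ η : ProbabilityMeasure ℝ, MemLp id 2 (η : Measure ℝ) →
      kernelVar h η = ∫ p : ℝ × ℝ × ℝ, h p.2.1 p.1 * h p.2.2 p.1
        ∂(η.prod (η.prod η) : Measure (ℝ × ℝ × ℝ)) - kernelMean h η ^ 2 := fun η hη => by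
    have := hL.integral_mul_eq hη
    simp only [ProbabilityMeasure.toMeasure_prod]
    rw [this]; ring
  rw [e ρ h2]
  simp_rw [fun n => e _ (h2s n)]
  exact key.sub ((hL.tendsto_kernelMean hρ h2 h2s hsq).pow 2)

/-- Uniform integrability of the squares under weak convergence with second moments. -/
theorem tendsto_setIntegral_tail_sq (hρ : Tendsto ρs atTop (𝓝 ρ))
    (h2 : MemLp id 2 (ρ : Measure ℝ)) (h2s : ∀ n, MemLp id 2 (ρs n : Measure ℝ))
    (hsq : Tendsto (fun n => ∫ x, x ^ 2 ∂(ρs n : Measure ℝ)) atTop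
      (𝓝 (∫ x, x ^ 2 ∂(ρ : Measure ℝ)))) {a M : ℝ} (ha : 0 ≤ a) {H : ℕ → ℝ → ℝ}
    (hH : ∀ n, Measurable (H n)) (hHle : ∀ n z, H n z ^ 2 ≤ a * (z ^ 2 + M ^ 2)) {c : ℕ → ℝ}
    (hc : Tendsto c atTop atTop) :
    Tendsto (fun n => ∫ z in {z | c n < |H n z|}, H n z ^ 2 ∂(ρs n : Measure ℝ)) atTop
      (𝓝 0) := by
  set q : ℝ → ℝ := fun z => a * (z ^ 2 + M ^ 2) with hq
  have hq0 : ∀ z, 0 ≤ q z := fun z => by positivity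
  have hqi : ∀ η : ProbabilityMeasure ℝ, MemLp id 2 (η : Measure ℝ) →
      Integrable q (η : Measure ℝ) := fun η hη => by
    have h1 : Integrable (fun z : ℝ => z ^ 2) (η : Measure ℝ) := hη.integrable_sq
    exact (h1.add (integrable_const _)).const_mul a
  have hqc : Continuous q := by fun_prop
  have hql : Tendsto (fun n => ∫ z, q z ∂(ρs n : Measure ℝ)) atTop
      (𝓝 (∫ z, q z ∂(ρ : Measure ℝ))) := by
    have e : ∀ η : ProbabilityMeasure ℝ, MemLp id 2 (η : Measure ℝ) →
        ∫ z, q z ∂(η : Measure ℝ) = a * (∫ z, z ^ 2 ∂(η : Measure ℝ) + M ^ 2) := fun η hη => by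
      have h1 : Integrable (fun z : ℝ => z ^ 2) (η : Measure ℝ) := hη.integrable_sq
      rw [hq, integral_const_mul, integral_add h1 (integrable_const _)]
      simp
    rw [e ρ h2]
    simp_rw [fun n => e _ (h2s n)]
    exact (hsq.add_const _).const_mul _
  have hA : Tendsto (fun A : ℕ => ∫ z, (q z - min (q z) A) ∂(ρ : Measure ℝ)) atTop (𝓝 0) := by
    have := tendsto_integral_of_dominated_convergence (μ := (ρ : Measure ℝ)) (bound := q)
      (F := fun (A : ℕ) z => q z - min (q z) A) (f := fun _ => 0)
      (fun A => Measurable.aestronglyMeasurable (by fun_prop)) (hqi ρ h2)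
      (fun A => ae_of_all _ fun z => by
        rw [Real.norm_eq_abs, abs_of_nonneg (by linarith [min_le_left (q z) (A : ℝ)])]
        have : 0 ≤ min (q z) (A : ℝ) := le_min (hq0 z) (Nat.cast_nonneg A)
        linarith)
      (ae_of_all _ fun z => by
        refine tendsto_const_nhds.congr' ?_
        filter_upwards [eventually_ge_atTop ⌈q z⌉₊] with A hA
        rw [min_eq_left (Nat.ceil_le.mp hA), sub_self])
    simpa using this
  rw [Metric.tendsto_nhds]
  intro ε hε
  obtain ⟨A, hAε⟩ := ((Metric.tendsto_nhds.mp hA) (ε / 4) (by positivity)).exists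
  have hlimA := tendsto_integral_of_dominating hρ (φ := fun z => q z - min (q z) A) (ψ := q)
    (by fun_prop) hqc (fun z => by
        rw [abs_of_nonneg (by linarith [min_le_left (q z) (A : ℝ)])]
        have : 0 ≤ min (q z) (A : ℝ) := le_min (hq0 z) (Nat.cast_nonneg A)
        linarith) (hqi ρ h2) (fun n => hqi _ (h2s n)) hql
  filter_upwards [(Metric.tendsto_nhds.mp hlimA) (ε / 4) (by positivity),
    hc.eventually_ge_atTop (2 * A + 1)] with n hn hcn
  rw [Real.dist_eq] at hn hAε ⊢
  rw [sub_zero] at hAε ⊢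
  have hms : MeasurableSet {z | c n < |H n z|} := measurableSet_lt measurable_const (hH n).abs
  have hid : Integrable (fun z => q z - min (q z) (A : ℝ)) (ρs n : Measure ℝ) := by
    refine (hqi _ (h2s n)).mono' (Measurable.aestronglyMeasurable (by fun_prop))
      (ae_of_all _ fun z => ?_)
    rw [Real.norm_eq_abs, abs_of_nonneg (by linarith [min_le_left (q z) (A : ℝ)])]
    have : 0 ≤ min (q z) (A : ℝ) := le_min (hq0 z) (Nat.cast_nonneg A)
    linarith
  have hle : ∫ z in {z | c n < |H n z|}, H n z ^ 2 ∂(ρs n : Measure ℝ) ≤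
      ∫ z, 2 * (q z - min (q z) (A : ℝ)) ∂(ρs n : Measure ℝ) := by
    rw [← integral_indicator hms]
    have hi2 : Integrable (fun z => 2 * (q z - min (q z) (A : ℝ))) (ρs n : Measure ℝ) :=
      hid.const_mul 2
    refine integral_mono_of_nonneg (ae_of_all _ fun z => ?_) hi2 (ae_of_all _ fun z => ?_)
    · exact Set.indicator_nonneg (fun _ _ => sq_nonneg _) _
    · by_cases hz : c n < |H n z|
      · rw [Set.indicator_of_mem (by exact hz)]
        have h3 := hHle n z
        -- On the tail `q ≥ H² ≥ 2A`, so that `q ≤ 2(q - A)`; the excess of `q` over the level `A`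
        -- has small integral uniformly for large `n`.
        have h4 : 2 * (A : ℝ) ≤ H n z ^ 2 := by
          rw [← sq_abs]
          have hA0 : (0 : ℝ) ≤ A := Nat.cast_nonneg A
          nlinarith
        have h5 := min_le_right (q z) (A : ℝ)
        change H n z ^ 2 ≤ q z at h3
        change _ ≤ 2 * (q z - min (q z) (A : ℝ))
        linarith
      · rw [Set.indicator_of_notMem (by exact hz)]
        have := min_le_left (q z) (A : ℝ)
        change 0 ≤ 2 * (q z - min (q z) (A : ℝ))
        linarith
  rw [integral_const_mul] at hle
  rw [abs_of_nonneg (integral_nonneg fun z => sq_nonneg _)]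
  have h6 := (abs_lt.mp hn).2
  have h7 := (abs_lt.mp hAε).2
  linarith

end WeakKernelLimits

end BlockUStat

namespace BlockUStat

/-! ### U-statistics of numbers: stability and Hoeffding's decomposition -/

section UAverage

lemma sum_offDiag_fst {α : Type*} [DecidableEq α] (s : Finset α) (φ : α → ℝ) :
    ∑ p ∈ s.offDiag, φ p.1 = ((s.card : ℝ) - 1) * ∑ i ∈ s, φ i := by
  have h1 : ∑ p ∈ s ×ˢ s, φ p.1 = s.card * ∑ i ∈ s, φ i := by
    rw [Finset.sum_product]
    simp [Finset.mul_sum]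
  rw [← Finset.diag_union_offDiag, Finset.sum_union s.disjoint_diag_offDiag,
    Finset.sum_diag] at h1
  linarith

lemma sum_offDiag_snd {α : Type*} [DecidableEq α] (s : Finset α) (φ : α → ℝ) :
    ∑ p ∈ s.offDiag, φ p.2 = ((s.card : ℝ) - 1) * ∑ i ∈ s, φ i := by
  have h1 : ∑ p ∈ s ×ˢ s, φ p.2 = s.card * ∑ i ∈ s, φ i := by
    rw [Finset.sum_product]
    simp
  rw [← Finset.diag_union_offDiag, Finset.sum_union s.disjoint_diag_offDiag,
    Finset.sum_diag] at h1
  linarith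

lemma card_offDiag_cast {α : Type*} [DecidableEq α] (s : Finset α) :
    (s.offDiag.card : ℝ) = s.card * ((s.card : ℝ) - 1) := by
  have h1 := sum_offDiag_fst s (fun _ => (1 : ℝ))
  simp only [Finset.sum_const, nsmul_eq_mul, mul_one] at h1
  rw [h1]; ring

/-- The U-statistic of order two with kernel `h` of the numbers `w 1, …, w b`. -/
noncomputable def uAvg (h : ℝ → ℝ → ℝ) (b : ℕ) (w : ℤ → ℝ) : ℝ :=
  (1 / ((b : ℝ) * ((b : ℝ) - 1))) *
    ∑ p ∈ (Finset.Icc (1 : ℤ) (b : ℤ)).offDiag, h (w p.1) (w p.2)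

variable {K : ℝ} {h : ℝ → ℝ → ℝ}

lemma card_Icc_one (b : ℕ) : (Finset.Icc (1 : ℤ) (b : ℤ)).card = b := by simp

lemma KernelLip.abs_uAvg_sub_le (hL : KernelLip K h) (b : ℕ) (w w' : ℤ → ℝ) :
    |uAvg h b w - uAvg h b w'| ≤
      2 * K / b * ∑ j ∈ Finset.Icc (1 : ℤ) (b : ℤ), |w j - w' j| := by
  set s := Finset.Icc (1 : ℤ) (b : ℤ) with hs
  have hcard : (s.card : ℝ) = b := by rw [hs, card_Icc_one]
  have hK := hL.nonneg
  have hS : 0 ≤ ∑ j ∈ s, |w j - w' j| := Finset.sum_nonneg fun _ _ => abs_nonneg _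
  -- For fewer than two indices the normalising denominator is zero, and so is the statistic by
  -- convention.
  rcases Nat.lt_or_ge b 2 with hb | hb
  · have h0 : (b : ℝ) * ((b : ℝ) - 1) = 0 := by interval_cases b <;> simp
    simp only [uAvg, h0, div_zero, zero_mul, sub_self, abs_zero]
    positivity
  have hb1 : (1 : ℝ) ≤ (b : ℝ) - 1 := by
    have : (2 : ℝ) ≤ b := by exact_mod_cast hb
    linarith
  have hb0 : (0 : ℝ) < b := by linarith
  rw [uAvg, uAvg, ← mul_sub, ← Finset.sum_sub_distrib, abs_mul,
    abs_of_nonneg (by positivity : (0 : ℝ) ≤ 1 / ((b : ℝ) * ((b : ℝ) - 1)))]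
  -- Each index occurs in `b - 1` ordered pairs at either position.
  have h1 : |∑ p ∈ s.offDiag, (h (w p.1) (w p.2) - h (w' p.1) (w' p.2))| ≤
      K * (2 * ((b : ℝ) - 1) * ∑ j ∈ s, |w j - w' j|) := by
    calc _ ≤ ∑ p ∈ s.offDiag, |h (w p.1) (w p.2) - h (w' p.1) (w' p.2)| :=
          Finset.abs_sum_le_sum_abs _ _
      _ ≤ ∑ p ∈ s.offDiag, K * (|w p.1 - w' p.1| + |w p.2 - w' p.2|) :=
          Finset.sum_le_sum fun p _ => hL _ _ _ _
      _ = _ := by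
          rw [← Finset.mul_sum, Finset.sum_add_distrib,
            sum_offDiag_fst s (fun j => |w j - w' j|), sum_offDiag_snd s (fun j => |w j - w' j|),
            hcard]
          ring
  calc _ ≤ 1 / ((b : ℝ) * ((b : ℝ) - 1)) * (K * (2 * ((b : ℝ) - 1) * ∑ j ∈ s, |w j - w' j|)) :=
        mul_le_mul_of_nonneg_left h1 (by positivity)
    _ = _ := by field_simp

/-- Every index occurs in `2(b - 1)` positions of ordered pairs, so the projections enter with
weight `2 / b`, and with `2 / √b` after scaling. -/
lemma sqrt_mul_uAvg_sub_eq (h : ℝ → ℝ → ℝ) (ν : Measure ℝ) {b : ℕ} (hb : 2 ≤ b) (w : ℤ → ℝ) :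
    √(b : ℝ) * (uAvg h b w - kernelMean h ν) =
      ∑ j ∈ Finset.Icc (1 : ℤ) (b : ℤ), 2 / √(b : ℝ) * kernelProj h ν (w j) +
      √(b : ℝ) / ((b : ℝ) * ((b : ℝ) - 1)) *
        ∑ p ∈ (Finset.Icc (1 : ℤ) (b : ℤ)).offDiag, kernelDegen h ν (w p.1) (w p.2) := by
  set s := Finset.Icc (1 : ℤ) (b : ℤ) with hs
  have hcard : (s.card : ℝ) = b := by rw [hs, card_Icc_one]
  have hb1 : (1 : ℝ) ≤ (b : ℝ) - 1 := by
    have : (2 : ℝ) ≤ b := by exact_mod_cast hb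
    linarith
  have hb0 : (0 : ℝ) < b := by linarith
  have hsum : ∑ p ∈ s.offDiag, kernelDegen h ν (w p.1) (w p.2) =
      ∑ p ∈ s.offDiag, h (w p.1) (w p.2) -
        2 * (((b : ℝ) - 1) * ∑ j ∈ s, kernelProj h ν (w j)) -
        (b : ℝ) * ((b : ℝ) - 1) * kernelMean h ν := by
    simp only [kernelDegen, Finset.sum_sub_distrib]
    rw [sum_offDiag_fst s (fun j => kernelProj h ν (w j)),
      sum_offDiag_snd s (fun j => kernelProj h ν (w j)), hcard, Finset.sum_const, nsmul_eq_mul,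
      card_offDiag_cast, hcard]
    ring
  have hsq : √(b : ℝ) * √(b : ℝ) = b := Real.mul_self_sqrt hb0.le
  have hs0 : √(b : ℝ) ≠ 0 := by positivity
  have hdiv : 2 / √(b : ℝ) = 2 * √(b : ℝ) / b := by
    rw [div_eq_div_iff hs0 hb0.ne', mul_assoc, hsq]
  rw [← Finset.mul_sum, hsum, hdiv, uAvg]
  have hb2 : (b : ℝ) - 1 ≠ 0 := by linarith
  field_simp
  ring

end UAverage

/-! ### Orthogonality of the degenerate part -/

section IID

variable {Ω : Type*} [MeasurableSpace Ω] {Q : Measure Ω} [IsProbabilityMeasure Q]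
  {K : ℝ} {h : ℝ → ℝ → ℝ} {ν : Measure ℝ} [IsProbabilityMeasure ν]

/-- Fubini's theorem, integrating over `X` first. Integrability is not needed: without it the
integral is zero by convention. -/
lemma integral_eq_zero_of_indepFun {β : Type*} [MeasurableSpace β] {X : Ω → ℝ} {Y : Ω → β}
    (hX : Measurable X) (hY : Measurable Y) (hXY : IndepFun X Y Q) {Φ : ℝ → β → ℝ}
    (hΦ : Measurable (fun p : ℝ × β => Φ p.1 p.2)) (hzero : ∀ y, ∫ x, Φ x y ∂(Q.map X) = 0) :
    ∫ ω, Φ (X ω) (Y ω) ∂Q = 0 := by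
  have := Measure.isProbabilityMeasure_map (μ := Q) hX.aemeasurable
  have := Measure.isProbabilityMeasure_map (μ := Q) hY.aemeasurable
  have h1 : ∫ ω, Φ (X ω) (Y ω) ∂Q = ∫ p : ℝ × β, Φ p.1 p.2 ∂((Q.map X).prod (Q.map Y)) := by
    rw [← (indepFun_iff_map_prod_eq_prod_map_map hX.aemeasurable hY.aemeasurable).mp hXY,
      integral_map (hX.prodMk hY).aemeasurable hΦ.aestronglyMeasurable]
  rw [h1]
  by_cases hi : Integrable (fun p : ℝ × β => Φ p.1 p.2) ((Q.map X).prod (Q.map Y))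
  · rw [integral_prod_symm _ hi]
    simp [hzero]
  · exact integral_undef hi

variable {ζ : ℤ → Ω → ℝ}

/-- The index `i` occurs only once, so integrating over `ζ i` alone annihilates the product by
degeneracy. -/
lemma KernelLip.integral_kernelDegen_mul_eq_zero (hL : KernelLip K h) (hν : MemLp id 2 ν)
    (hζ : ∀ j, MeasurePreserving (ζ j) Q ν) (hind : iIndepFun ζ Q) {i j k l : ℤ} (hij : i ≠ j)
    (hik : i ≠ k) (hil : i ≠ l) :
    ∫ ω, kernelDegen h ν (ζ i ω) (ζ j ω) * kernelDegen h ν (ζ k ω) (ζ l ω) ∂Q = 0 := by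
  have hm := fun j => (hζ j).measurable
  set T : Finset ℤ := {j, k, l} with hT
  have hjT : j ∈ T := by simp [hT]
  have hkT : k ∈ T := by simp [hT]
  have hlT : l ∈ T := by simp [hT]
  have hdis : Disjoint ({i} : Finset ℤ) T := by
    simp [hT, hij, hik, hil]
  have h0 := hind.indepFun_finset {i} T hdis hm
  have h1 : IndepFun (ζ i) (fun ω => (ζ j ω, ζ k ω, ζ l ω)) Q :=
    h0.comp (φ := fun a : ({i} : Finset ℤ) → ℝ => a ⟨i, Finset.mem_singleton_self i⟩)
      (ψ := fun a : T → ℝ => (a ⟨j, hjT⟩, a ⟨k, hkT⟩, a ⟨l, hlT⟩)) (by fun_prop) (by fun_prop)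
  have hD := hL.measurable_kernelDegen hν
  refine integral_eq_zero_of_indepFun (hm i) (by fun_prop) h1
    (Φ := fun x y => kernelDegen h ν x y.1 * kernelDegen h ν y.2.1 y.2.2) ?_ fun y => ?_
  · fun_prop
  · rw [(hζ i).map_eq, integral_mul_const, hL.integral_kernelDegen hν, zero_mul]

lemma KernelLip.memLp_kernelDegen (hL : KernelLip K h) (h_symm : ∀ x y, h x y = h y x)
    (hν : MemLp id 2 ν) (hζ : ∀ j, MeasurePreserving (ζ j) Q ν) (i j : ℤ) :
    MemLp (fun ω => kernelDegen h ν (ζ i ω) (ζ j ω)) 2 Q := by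
  have hD := hL.measurable_kernelDegen hν
  have hi := (hζ i).measurable
  have hj := (hζ j).measurable
  have h0 : MemLp (ζ j) 2 Q := hν.comp_measurePreserving (hζ j)
  have h1 : MemLp (fun ω => |ζ j ω|) 2 Q := h0.abs
  have h2 : MemLp (fun _ : Ω => ∫ z, |z| ∂ν) 2 Q := memLp_const _
  have h3 : MemLp (fun ω => |ζ j ω| + ∫ z, |z| ∂ν) 2 Q := h1.add h2
  have h4 : MemLp (fun ω => 2 * K * (|ζ j ω| + ∫ z, |z| ∂ν)) 2 Q := h3.const_mul _
  refine h4.mono (Measurable.aestronglyMeasurable (by fun_prop)) (ae_of_all _ fun ω => ?_)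
  rw [Real.norm_eq_abs, Real.norm_eq_abs]
  exact (hL.abs_kernelDegen_le h_symm hν _ _).trans (le_abs_self _)

lemma sq_integral_abs_le (hν : MemLp id 2 ν) : (∫ z, |z| ∂ν) ^ 2 ≤ ∫ z, z ^ 2 ∂ν := by
  have h1 : ∫ z, |z| ∂ν ≤ lpNorm id 2 ν := integral_abs_le_lpNorm_two hν
  have h2 : lpNorm (id : ℝ → ℝ) 2 ν ^ 2 = ∫ z, z ^ 2 ∂ν := lpNorm_two_sq hν
  rw [← h2]
  exact pow_le_pow_left₀ (integral_nonneg fun z => abs_nonneg z) h1 2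

lemma KernelLip.integral_kernelDegen_sq_le (hL : KernelLip K h) (h_symm : ∀ x y, h x y = h y x)
    (hν : MemLp id 2 ν) (hζ : ∀ j, MeasurePreserving (ζ j) Q ν) (i j : ℤ) :
    ∫ ω, kernelDegen h ν (ζ i ω) (ζ j ω) ^ 2 ∂Q ≤ 16 * K ^ 2 * ∫ z, z ^ 2 ∂ν := by
  have h0 : MemLp (ζ j) 2 Q := hν.comp_measurePreserving (hζ j)
  have h1 : Integrable (fun ω => ζ j ω ^ 2) Q := h0.integrable_sq
  have h2 : ∫ ω, 8 * K ^ 2 * (ζ j ω ^ 2 + (∫ z, |z| ∂ν) ^ 2) ∂Q =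
      8 * K ^ 2 * (∫ z, z ^ 2 ∂ν + (∫ z, |z| ∂ν) ^ 2) := by
    rw [integral_const_mul, integral_add h1 (integrable_const _),
      integral_comp_measurePreserving (hζ j) (X := fun z => z ^ 2) (by fun_prop)]
    simp
  have h3 : ∫ ω, kernelDegen h ν (ζ i ω) (ζ j ω) ^ 2 ∂Q ≤
      ∫ ω, 8 * K ^ 2 * (ζ j ω ^ 2 + (∫ z, |z| ∂ν) ^ 2) ∂Q := by
    refine integral_mono (hL.memLp_kernelDegen h_symm hν hζ i j).integrable_sq
      ((h1.add (integrable_const _)).const_mul _) fun ω => ?_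
    have h4 := hL.abs_kernelDegen_le h_symm hν (ζ i ω) (ζ j ω)
    have h5 := pow_le_pow_left₀ (abs_nonneg _) h4 2
    rw [sq_abs, mul_pow] at h5
    refine h5.trans ?_
    have h6 : (|ζ j ω| + ∫ z, |z| ∂ν) ^ 2 ≤ 2 * (ζ j ω ^ 2 + (∫ z, |z| ∂ν) ^ 2) := by
      nlinarith [sq_nonneg (|ζ j ω| - ∫ z, |z| ∂ν), sq_abs (ζ j ω)]
    have h7 := mul_le_mul_of_nonneg_left h6 (by positivity : 0 ≤ (2 * K) ^ 2)
    refine h7.trans (le_of_eq ?_)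
    ring
  rw [h2] at h3
  have h8 := mul_le_mul_of_nonneg_left (sq_integral_abs_le hν) (by positivity : 0 ≤ 8 * K ^ 2)
  linarith

/-- In the expanded square only the products of a pair with itself or with its swap can survive;
this gives the factor `2` and a bound of order `b²` instead of `b⁴`. -/
theorem KernelLip.lpNorm_sum_kernelDegen_sq_le (hL : KernelLip K h)
    (h_symm : ∀ x y, h x y = h y x) (hν : MemLp id 2 ν)
    (hζ : ∀ j, MeasurePreserving (ζ j) Q ν) (hind : iIndepFun ζ Q) (s : Finset ℤ) :
    lpNorm (fun ω => ∑ p ∈ s.offDiag, kernelDegen h ν (ζ p.1 ω) (ζ p.2 ω)) 2 Q ^ 2 ≤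
      s.card * ((s.card : ℝ) - 1) * (2 * (16 * K ^ 2 * ∫ z, z ^ 2 ∂ν)) := by
  have hmem := fun p : ℤ × ℤ => hL.memLp_kernelDegen h_symm hν hζ p.1 p.2
  set M : ℝ := 16 * K ^ 2 * ∫ z, z ^ 2 ∂ν with hM
  set D : ℤ × ℤ → Ω → ℝ := fun p ω => kernelDegen h ν (ζ p.1 ω) (ζ p.2 ω) with hD
  rw [lpNorm_two_sq (memLp_finsetSum _ fun p _ => hmem p)]
  have hint : ∀ p q, Integrable (fun ω => D p ω * D q ω) Q := fun p q =>
    (hmem p).integrable_mul (hmem q)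
  have hcross : ∀ p ∈ s.offDiag, ∀ q ∈ s.offDiag, ∫ ω, D p ω * D q ω ∂Q ≤
      (if q = p then M else 0) + (if q = p.swap then M else 0) := by
    rintro ⟨i, j⟩ hp ⟨k, l⟩ hq
    simp only [Finset.mem_offDiag] at hp hq
    have hM0 : 0 ≤ M := by positivity
    have hdiag : ∫ ω, D (i, j) ω * D (i, j) ω ∂Q ≤ M := by
      simp_rw [← pow_two]
      exact hL.integral_kernelDegen_sq_le h_symm hν hζ i j
    have hsw : D (j, i) = D (i, j) := by
      funext ω; exact kernelDegen_symm h_symm _ _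
    have hrhs : 0 ≤ (if ((k, l) : ℤ × ℤ) = (i, j) then M else 0) +
        (if ((k, l) : ℤ × ℤ) = (i, j).swap then M else 0) := by
      positivity
    by_cases hi : i ≠ k ∧ i ≠ l
    · refine (hL.integral_kernelDegen_mul_eq_zero hν hζ hind hp.2.2 hi.1 hi.2).le.trans hrhs
    by_cases hj : j ≠ k ∧ j ≠ l
    · rw [← hsw]
      refine (hL.integral_kernelDegen_mul_eq_zero hν hζ hind hp.2.2.symm hj.1 hj.2).le.trans hrhs
    -- Each of `i` and `j` now occurs among `k` and `l`; as `i ≠ j` and `k ≠ l`, the pairs agree up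
    -- to order.
    have hcases : (k = i ∧ l = j) ∨ (k = j ∧ l = i) := by
      obtain ⟨-, -, hp3⟩ := hp
      obtain ⟨-, -, hq3⟩ := hq
      omega
    rcases hcases with ⟨rfl, rfl⟩ | ⟨rfl, rfl⟩
    · refine hdiag.trans ?_
      rw [if_pos rfl]
      have h9 : 0 ≤ (if ((k, l) : ℤ × ℤ) = (k, l).swap then M else 0) := by positivity
      linarith
    · rw [hsw]
      refine hdiag.trans ?_
      rw [if_pos (show ((k, l) : ℤ × ℤ) = (l, k).swap from rfl)]
      have : 0 ≤ (if ((k, l) : ℤ × ℤ) = (l, k) then M else 0) := by positivity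
      linarith
  have hexp : ∫ ω, (∑ p ∈ s.offDiag, D p ω) ^ 2 ∂Q =
      ∑ p ∈ s.offDiag, ∑ q ∈ s.offDiag, ∫ ω, D p ω * D q ω ∂Q := by
    simp_rw [pow_two, Finset.sum_mul_sum]
    rw [integral_finsetSum _ fun p _ => integrable_finsetSum _ fun q _ => hint p q]
    exact Finset.sum_congr rfl fun p _ => integral_finsetSum _ fun q _ => hint p q
  rw [hexp]
  have hM0 : 0 ≤ M := by positivity
  calc _ ≤ ∑ p ∈ s.offDiag, ∑ q ∈ s.offDiag,
        ((if q = p then M else 0) + (if q = p.swap then M else 0)) :=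
        Finset.sum_le_sum fun p hp => Finset.sum_le_sum fun q hq => hcross p hp q hq
    _ ≤ ∑ p ∈ s.offDiag, (2 * M) := by
        refine Finset.sum_le_sum fun p _ => ?_
        rw [Finset.sum_add_distrib, Finset.sum_ite_eq', Finset.sum_ite_eq']
        have h1 : (if p ∈ s.offDiag then M else 0) ≤ M := by split_ifs; exact le_rfl
        have h2 : (if p.swap ∈ s.offDiag then M else 0) ≤ M := by split_ifs <;> first | exact le_rfl | exact hM0
        linarith
    _ = _ := by rw [Finset.sum_const, nsmul_eq_mul, card_offDiag_cast]

end IID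

/-! ### Central limit theorem for U-statistics of i.i.d. arrays -/

section CentralLimit

variable {Ω : Type*} [MeasurableSpace Ω] {Q : Measure Ω} [IsProbabilityMeasure Q]
  {K : ℝ} {h : ℝ → ℝ → ℝ} {ρ : ProbabilityMeasure ℝ} {ρs : ℕ → ProbabilityMeasure ℝ}
  {b : ℕ → ℕ}

/-- Lindeberg's theorem with row length `b`: since `b (2 / √b)² = 4`, the row variances are `4 *
kernelVar h (ρs n)`. -/
lemma tendsto_charFun_iid_sum_kernelProj (hL : KernelLip K h) (hρ : Tendsto ρs atTop (𝓝 ρ))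
    (h2 : MemLp id 2 (ρ : Measure ℝ)) (h2s : ∀ n, MemLp id 2 (ρs n : Measure ℝ))
    (hsq : Tendsto (fun n => ∫ x, x ^ 2 ∂(ρs n : Measure ℝ)) atTop
      (𝓝 (∫ x, x ^ 2 ∂(ρ : Measure ℝ)))) (hb : Tendsto b atTop atTop) (t : ℝ) :
    Tendsto (fun n => charFun ((ρs n : Measure ℝ).map
      fun z => 2 / √(b n : ℝ) * kernelProj h (ρs n) z) t ^ b n) atTop
      (𝓝 (Complex.exp (-(4 * kernelVar h ρ * t ^ 2 / 2 : ℝ)))) := by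
  set H : ℕ → ℝ → ℝ := fun n => kernelProj h (ρs n) with hH
  have hHm : ∀ n, Measurable (H n) := fun n => hL.measurable_kernelProj (h2s n)
  have hm : ∀ n, Measurable fun z => 2 / √(b n : ℝ) * H n z := fun n => (hHm n).const_mul _
  have hprob : ∀ n, IsProbabilityMeasure ((ρs n : Measure ℝ).map
      fun z => 2 / √(b n : ℝ) * H n z) := fun n =>
    Measure.isProbabilityMeasure_map (hm n).aemeasurable
  have hb1 : ∀ᶠ n in atTop, 1 ≤ b n := hb.eventually_ge_atTop 1
  have hbn : ∀ n, 1 ≤ b n → (b n : ℝ) * (2 / √(b n : ℝ)) ^ 2 = 4 := by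
    intro n hn
    have h0 : (0 : ℝ) < b n := by exact_mod_cast hn
    rw [div_pow, Real.sq_sqrt h0.le]
    field_simp
    norm_num
  refine tendsto_charFun_pow_of_lindeberg b (fun n => ?_) (fun n => ?_) ?_ (fun ε hε => ?_) t
  · rw [integral_map (f := fun x => x) (hm n).aemeasurable measurable_id.aestronglyMeasurable,
      integral_const_mul,
      hL.integral_kernelProj (h2s n), mul_zero]
  · rw [memLp_map_measure_iff measurable_id.aestronglyMeasurable (hm n).aemeasurable]
    exact (hL.memLp_kernelProj (h2s n)).const_mul _
  · have h3 : Tendsto (fun n => 4 * kernelVar h (ρs n)) atTop (𝓝 (4 * kernelVar h ρ)) :=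
      (hL.tendsto_kernelVar hρ h2 h2s hsq).const_mul 4
    refine h3.congr' ?_
    filter_upwards [hb1] with n hn
    rw [integral_map (hm n).aemeasurable (Measurable.aestronglyMeasurable (by fun_prop))]
    simp_rw [mul_pow]
    rw [integral_const_mul, ← mul_assoc, hbn n hn]
    rfl
  -- The second moments are bounded by some `R`, which gives a quadratic bound on the projections
  -- uniform in `n`. The tail event for the scaled variable is `|H| > ε√b / 2`, a level tending to
  -- infinity.
  · obtain ⟨R, hR⟩ := hsq.bddAbove_range
    have hR' : ∀ n, ∫ x, x ^ 2 ∂(ρs n : Measure ℝ) ≤ R := fun n => hR ⟨n, rfl⟩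
    have hR0 : 0 ≤ R := (integral_nonneg fun x : ℝ => sq_nonneg x).trans (hR' 0)
    have hle : ∀ n z, H n z ^ 2 ≤ 2 * K ^ 2 * (z ^ 2 + √R ^ 2) := by
      intro n z
      have h4 := pow_le_pow_left₀ (abs_nonneg _) (hL.abs_kernelProj_le (h2s n) z) 2
      rw [sq_abs, mul_pow] at h4
      have h5 := (sq_integral_abs_le (h2s n)).trans (hR' n)
      have h6 : (|z| + ∫ y, |y| ∂(ρs n : Measure ℝ)) ^ 2 ≤ 2 * (z ^ 2 + R) := by
        nlinarith [sq_nonneg (|z| - ∫ y, |y| ∂(ρs n : Measure ℝ)), sq_abs z]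
      have h7 := mul_le_mul_of_nonneg_left h6 (sq_nonneg K)
      rw [Real.sq_sqrt hR0]
      refine (h4.trans h7).trans (le_of_eq ?_)
      ring
    have hc : Tendsto (fun n => ε / 2 * √(b n : ℝ)) atTop atTop :=
      Tendsto.const_mul_atTop (by positivity)
        (Real.tendsto_sqrt_atTop.comp (tendsto_natCast_atTop_atTop.comp hb))
    have h8 := (tendsto_setIntegral_tail_sq hρ h2 h2s hsq (by positivity : 0 ≤ 2 * K ^ 2) hHm hle
      hc).const_mul 4
    rw [mul_zero] at h8
    refine h8.congr' ?_
    filter_upwards [hb1] with n hn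
    have h0 : (0 : ℝ) < √(b n : ℝ) := Real.sqrt_pos.mpr (by exact_mod_cast hn)
    have hset : (fun z => 2 / √(b n : ℝ) * H n z) ⁻¹' {x | ε < |x|} =
        {z | ε / 2 * √(b n : ℝ) < |H n z|} := by
      ext z
      simp only [Set.mem_preimage, Set.mem_ofPred_eq]
      rw [abs_mul, abs_of_pos (by positivity : 0 < 2 / √(b n : ℝ)), div_mul_eq_mul_div,
        lt_div_iff₀ h0]
      constructor <;> intro h9 <;> linarith
    rw [setIntegral_map (measurableSet_lt measurable_const (by fun_prop))
      (Measurable.aestronglyMeasurable (by fun_prop)) (hm n).aemeasurable, hset]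
    simp_rw [mul_pow]
    rw [integral_const_mul, ← mul_assoc, hbn n hn]

/-- The central limit theorem for a triangular array of U-statistics of i.i.d. variables whose laws
converge weakly together with their second moments. -/
theorem tendsto_charFun_uAvg (hL : KernelLip K h) (h_symm : ∀ x y, h x y = h y x)
    (hρ : Tendsto ρs atTop (𝓝 ρ))
    (h2 : MemLp id 2 (ρ : Measure ℝ)) (h2s : ∀ n, MemLp id 2 (ρs n : Measure ℝ))
    (hsq : Tendsto (fun n => ∫ x, x ^ 2 ∂(ρs n : Measure ℝ)) atTop
      (𝓝 (∫ x, x ^ 2 ∂(ρ : Measure ℝ)))) (hb : Tendsto b atTop atTop) {ζ : ℕ → ℤ → Ω → ℝ}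
    (hζ : ∀ n j, MeasurePreserving (ζ n j) Q (ρs n)) (hind : ∀ n, iIndepFun (ζ n) Q) (t : ℝ) :
    Tendsto (fun n => charFun (Q.map fun ω =>
      √(b n : ℝ) * (uAvg h (b n) (fun j => ζ n j ω) - kernelMean h (ρs n))) t) atTop
      (𝓝 (Complex.exp (-(4 * kernelVar h ρ * t ^ 2 / 2 : ℝ)))) := by
  set A : ℕ → Ω → ℝ := fun n ω =>
    √(b n : ℝ) * (uAvg h (b n) (fun j => ζ n j ω) - kernelMean h (ρs n)) with hA
  set B : ℕ → Ω → ℝ := fun n ω => ∑ j ∈ Finset.Icc (1 : ℤ) (b n : ℤ),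
    2 / √(b n : ℝ) * kernelProj h (ρs n) (ζ n j ω) with hB
  set R : ℕ → Ω → ℝ := fun n ω => ∑ p ∈ (Finset.Icc (1 : ℤ) (b n : ℤ)).offDiag,
    kernelDegen h (ρs n) (ζ n p.1 ω) (ζ n p.2 ω) with hR
  have hHm : ∀ n, Measurable (kernelProj h (ρs n)) := fun n => hL.measurable_kernelProj (h2s n)
  have hζm : ∀ n j, Measurable (ζ n j) := fun n j => (hζ n j).measurable
  have hBL : ∀ n, MemLp (B n) 2 Q := fun n => memLp_finsetSum _ fun j _ =>
    ((hL.memLp_kernelProj (h2s n)).comp_measurePreserving (hζ n j)).const_mul _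
  have hRL : ∀ n, MemLp (R n) 2 Q := fun n => memLp_finsetSum _ fun p _ =>
    hL.memLp_kernelDegen h_symm (h2s n) (hζ n) p.1 p.2
  have hBchar : ∀ n, charFun (Q.map (B n)) t = charFun ((ρs n : Measure ℝ).map
      fun z => 2 / √(b n : ℝ) * kernelProj h (ρs n) z) t ^ b n := by
    intro n
    have hm1 : Measurable fun z => 2 / √(b n : ℝ) * kernelProj h (ρs n) z := (hHm n).const_mul _
    have hi : iIndepFun (fun j ω => 2 / √(b n : ℝ) * kernelProj h (ρs n) (ζ n j ω)) Q :=
      (hind n).comp (fun _ z => 2 / √(b n : ℝ) * kernelProj h (ρs n) z) fun _ => hm1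
    have h3 := iIndepFun.charFun_map_fun_finsetSum_eq_prod (s := Finset.Icc (1 : ℤ) (b n : ℤ))
      (fun j _ => (hm1.comp (hζm n j)).aemeasurable)
      (hi.precomp (g := ((↑) : Finset.Icc (1 : ℤ) (b n : ℤ) → ℤ)) Subtype.val_injective)
    have h4 := congrFun h3 t
    rw [hB]
    refine h4.trans ?_
    rw [Finset.prod_apply]
    have h5 : ∀ j, Q.map ((fun z => 2 / √(b n : ℝ) * kernelProj h (ρs n) z) ∘ ζ n j) =
        (ρs n : Measure ℝ).map fun z => 2 / √(b n : ℝ) * kernelProj h (ρs n) z := fun j => by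
      rw [← Measure.map_map hm1 (hζm n j), (hζ n j).map_eq]
    rw [Finset.prod_congr rfl fun j _ => by rw [h5 j], Finset.prod_const, card_Icc_one]
  have hlim := tendsto_charFun_iid_sum_kernelProj hL hρ h2 h2s hsq hb t
  have hb2 : ∀ᶠ n in atTop, 2 ≤ b n := hb.eventually_ge_atTop 2
  obtain ⟨S, hS⟩ := hsq.bddAbove_range
  have hS' : ∀ n, ∫ x, x ^ 2 ∂(ρs n : Measure ℝ) ≤ S := fun n => hS ⟨n, rfl⟩
  -- The scaled degenerate part has squared norm at most `b / (b(b-1))² * b(b-1) * 2M = 2M / (b-1)`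
  -- with `M = 16 K² S`.
  have hdiff : ∀ n, 2 ≤ b n → ‖charFun (Q.map (A n)) t - charFun (Q.map (B n)) t‖ ≤
      |t| * √(2 * (16 * K ^ 2 * S) / ((b n : ℝ) - 1)) := by
    intro n hn
    have hn1 : (1 : ℝ) ≤ (b n : ℝ) - 1 := by
      have : (2 : ℝ) ≤ b n := by exact_mod_cast hn
      linarith
    have hn0 : (0 : ℝ) < b n := by linarith
    have heq : A n = B n + fun ω => √(b n : ℝ) / ((b n : ℝ) * ((b n : ℝ) - 1)) * R n ω := by
      funext ω
      exact sqrt_mul_uAvg_sub_eq h (ρs n) hn fun j => ζ n j ω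
    have hAL : MemLp (A n) 2 Q := by
      rw [heq]; exact (hBL n).add ((hRL n).const_mul _)
    refine (norm_charFun_map_sub_le hAL (hBL n) t).trans
      (mul_le_mul_of_nonneg_left ?_ (abs_nonneg t))
    rw [heq, add_sub_cancel_left, lpNorm_const_mul]
    have h6 := hL.lpNorm_sum_kernelDegen_sq_le h_symm (h2s n) (hζ n) (hind n)
      (Finset.Icc (1 : ℤ) (b n : ℤ))
    rw [card_Icc_one] at h6
    refine Real.le_sqrt_of_sq_le ?_
    rw [mul_pow, sq_abs, div_pow, Real.sq_sqrt hn0.le]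
    have h7 : 16 * K ^ 2 * ∫ x, x ^ 2 ∂(ρs n : Measure ℝ) ≤ 16 * K ^ 2 * S :=
      mul_le_mul_of_nonneg_left (hS' n) (by positivity)
    calc _ ≤ (b n : ℝ) / ((b n : ℝ) * ((b n : ℝ) - 1)) ^ 2 *
          (b n * ((b n : ℝ) - 1) * (2 * (16 * K ^ 2 * S))) := by
          refine mul_le_mul_of_nonneg_left (h6.trans ?_) (by positivity)
          refine mul_le_mul_of_nonneg_left (by linarith) (by nlinarith)
      _ = _ := by
          have : (b n : ℝ) - 1 ≠ 0 := by linarith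
          field_simp
  have hzero : Tendsto (fun n => |t| * √(2 * (16 * K ^ 2 * S) / ((b n : ℝ) - 1))) atTop (𝓝 0) := by
    have h8 : Tendsto (fun n => (b n : ℝ) - 1) atTop atTop :=
      tendsto_atTop_add_const_right _ _ (tendsto_natCast_atTop_atTop.comp hb)
    have h9 := ((tendsto_const_nhds (x := 2 * (16 * K ^ 2 * S))).div_atTop h8).sqrt.const_mul |t|
    simpa using h9
  have hsub : Tendsto (fun n => charFun (Q.map (A n)) t - charFun (Q.map (B n)) t) atTop
      (𝓝 0) := by
    refine squeeze_zero_norm' ?_ hzero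
    filter_upwards [hb2] with n hn using hdiff n hn
  have := hsub.add (hlim.congr fun n => (hBchar n).symm)
  simpa using this

end CentralLimit

end BlockUStat

namespace BlockUStat

/-! ### U-statistics of the linear block sums -/

section LinearBlocks

/-- The normalised sum over the `j`-th block. -/
noncomputable def blockSum (G : (ℤ → ℝ) → ℝ) (l : ℕ) (j : ℤ) (x : ℤ → ℝ) : ℝ :=
  (1 / √(l : ℝ)) * partSum G (block l j) x

lemma blockSum_eq_normSum (G : (ℤ → ℝ) → ℝ) (l : ℕ) (j : ℤ) (x : ℤ → ℝ) :
    blockSum G l j x = normSum G l (shiftSeq ((j - 1) * l) x) := by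
  rw [blockSum, normSum, ← partSum_Icc_shift, block]
  congr 3
  ring

lemma block_disjoint (l : ℕ) : Pairwise fun i j => Disjoint (block l i) (block l j) := by
  intro i j hij
  wlog hlt : i < j generalizing i j
  · exact (this hij.symm (by omega)).symm
  rw [Finset.disjoint_left]
  intro u hu hv
  simp only [block, Finset.mem_Icc] at hu hv
  have h1 : i * (l : ℤ) ≤ (j - 1) * l := by
    apply mul_le_mul_of_nonneg_right <;> omega
  omega

lemma card_block (l : ℕ) (j : ℤ) : (block l j).card = l := by
  rw [block, Int.card_Icc, sub_mul, one_mul]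
  omega

variable {μ : Measure ℝ} [IsProbabilityMeasure μ] {G : (ℤ → ℝ) → ℝ} {K : ℝ} {h : ℝ → ℝ → ℝ}

/-- The law of the normalised partial sum. -/
noncomputable def normSumLaw (μ : Measure ℝ) (G : (ℤ → ℝ) → ℝ) (l : ℕ) : Measure ℝ :=
  (iidLaw ℤ μ).map (normSum G l)

lemma isProbabilityMeasure_normSumLaw (hG : Measurable G) (l : ℕ) :
    IsProbabilityMeasure (normSumLaw μ G l) :=
  Measure.isProbabilityMeasure_map (measurable_normSum hG l).aemeasurable

lemma memLp_normSumLaw (hG : Measurable G) (hG2 : MemLp G 2 (iidLaw ℤ μ)) (l : ℕ) :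
    MemLp id 2 (normSumLaw μ G l) := by
  rw [normSumLaw, memLp_map_measure_iff measurable_id.aestronglyMeasurable
    (measurable_normSum hG l).aemeasurable]
  exact memLp_normSum hG2 l

lemma integral_sq_normSumLaw (hG : Measurable G) (hG2 : MemLp G 2 (iidLaw ℤ μ))
    (h0 : ∫ x, G x ∂(iidLaw ℤ μ) = 0) (l : ℕ) :
    ∫ z, z ^ 2 ∂(normSumLaw μ G l) = Var[normSum G l; iidLaw ℤ μ] := by
  rw [normSumLaw, integral_map (measurable_normSum hG l).aemeasurable
    (Measurable.aestronglyMeasurable (by fun_prop)), ← lpNorm_normSum_sq hG2 h0,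
    lpNorm_two_sq (memLp_normSum hG2 l)]

lemma KernelLip.memLp_uAvg {Ω : Type*} [MeasurableSpace Ω] {Q : Measure Ω}
    [IsProbabilityMeasure Q] (hL : KernelLip K h) {ζ : ℤ → Ω → ℝ}
    (hζm : ∀ j, Measurable (ζ j)) (hζ : ∀ j, MemLp (ζ j) 2 Q) (b : ℕ) :
    MemLp (fun ω => uAvg h b fun j => ζ j ω) 2 Q := by
  suffices hmem : ∀ p : ℤ × ℤ, MemLp (fun ω => h (ζ p.1 ω) (ζ p.2 ω)) 2 Q by
    have hsum : MemLp (fun ω => ∑ p ∈ (Finset.Icc (1 : ℤ) (b : ℤ)).offDiag,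
      h (ζ p.1 ω) (ζ p.2 ω)) 2 Q := memLp_finsetSum _ fun p _ => hmem p
    exact hsum.const_mul (1 / ((b : ℝ) * ((b : ℝ) - 1)))
  intro p
  have hm := hL.measurable
  have h1 : MemLp (fun ω => |ζ p.1 ω|) 2 Q := (hζ p.1).abs
  have h2 : MemLp (fun ω => |ζ p.2 ω|) 2 Q := (hζ p.2).abs
  have h3 : MemLp (fun ω => |ζ p.1 ω| + |ζ p.2 ω|) 2 Q := h1.add h2
  have h4 : MemLp (fun ω => K * (|ζ p.1 ω| + |ζ p.2 ω|)) 2 Q := h3.const_mul K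
  have h5 : MemLp (fun _ : Ω => |h 0 0|) 2 Q := memLp_const _
  have h6 : MemLp (fun ω => |h 0 0| + K * (|ζ p.1 ω| + |ζ p.2 ω|)) 2 Q := h5.add h4
  have h7 := hζm p.1
  have h8 := hζm p.2
  refine h6.mono (Measurable.aestronglyMeasurable (by fun_prop)) (ae_of_all _ fun ω => ?_)
  rw [Real.norm_eq_abs, Real.norm_eq_abs]
  exact (hL.abs_le _ _).trans (le_abs_self _)

lemma lpNorm_sum_le {α : Type*} [MeasurableSpace α] {ν : Measure α} {ι : Type*} (s : Finset ι)
    {f : ι → α → ℝ} (hf : ∀ i, MemLp (f i) 2 ν) :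
    lpNorm (fun x => ∑ i ∈ s, |f i x|) 2 ν ≤ ∑ i ∈ s, lpNorm (f i) 2 ν := by
  classical
  induction s using Finset.induction_on with
  | empty => simp
  | insert i s hi ih =>
    simp_rw [Finset.sum_insert hi]
    have h1 : MemLp (fun x => |f i x|) 2 ν := (hf i).abs
    have h2 : MemLp (fun x => ∑ j ∈ s, |f j x|) 2 ν := memLp_finsetSum _ fun j _ => (hf j).abs
    refine (lpNorm_add_le h1 (by norm_num)).trans (add_le_add (le_of_eq ?_) ih)
    exact lpNorm_abs (hf i).aestronglyMeasurable 2

lemma KernelLip.lpNorm_uAvg_sub_le {Ω : Type*} [MeasurableSpace Ω] {Q : Measure Ω}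
    [IsProbabilityMeasure Q] (hL : KernelLip K h) {ζ ζ' : ℤ → Ω → ℝ}
    (hζ : ∀ j, MemLp (ζ j) 2 Q) (hζ' : ∀ j, MemLp (ζ' j) 2 Q) {d : ℝ} (hd : ∀ j, lpNorm (ζ j - ζ' j) 2 Q ≤ d) {b : ℕ}
    (hb : 1 ≤ b) :
    lpNorm ((fun ω => uAvg h b fun j => ζ j ω) - fun ω => uAvg h b fun j => ζ' j ω) 2 Q ≤
      2 * K * d := by
  set s := Finset.Icc (1 : ℤ) (b : ℤ) with hs
  have hK := hL.nonneg
  have hb0 : (0 : ℝ) < b := by exact_mod_cast hb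
  have hmem : MemLp (fun ω => ∑ j ∈ s, |(ζ j - ζ' j) ω|) 2 Q :=
    memLp_finsetSum _ fun j _ => ((hζ j).sub (hζ' j)).abs
  have h1 : lpNorm ((fun ω => uAvg h b fun j => ζ j ω) - fun ω => uAvg h b fun j => ζ' j ω) 2 Q ≤
      lpNorm (fun ω => 2 * K / b * ∑ j ∈ s, |(ζ j - ζ' j) ω|) 2 Q :=
    lpNorm_mono_real (hmem.const_mul _) fun ω => by
      rw [Real.norm_eq_abs]
      exact hL.abs_uAvg_sub_le b _ _
  refine h1.trans ?_
  rw [lpNorm_const_mul, abs_of_nonneg (by positivity)]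
  have h2 : lpNorm (fun ω => ∑ j ∈ s, |(ζ j - ζ' j) ω|) 2 Q ≤ b * d := by
    refine (lpNorm_sum_le s fun j => (hζ j).sub (hζ' j)).trans ?_
    refine (Finset.sum_le_sum fun j _ => hd j).trans ?_
    rw [Finset.sum_const, nsmul_eq_mul, hs, card_Icc_one]
  calc _ ≤ 2 * K / b * (b * d) := mul_le_mul_of_nonneg_left h2 (by positivity)
    _ = _ := by field_simp

/-- The limit law of the normalised partial sums. -/
noncomputable def limitLaw (μ : Measure ℝ) (G : (ℤ → ℝ) → ℝ) : Measure ℝ :=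
  gaussianReal 0 (Real.toNNReal (∑' s, autoCov μ G s))

variable {b l : ℕ → ℕ}

/-- The block sums are compared with an i.i.d. family of the same marginal law, and the central
limit theorem for arrays is applied to the latter. The common marginal makes the centring identical
on both sides. The comparison costs `2KD √(b/l)`. -/
theorem tendsto_charFun_uAvg_blockSum (hG : Measurable G) (hG2 : MemLp G 2 (iidLaw ℤ μ))
    (h0 : ∫ x, G x ∂(iidLaw ℤ μ) = 0) (hD : totalDep μ G ≠ ⊤) (hL : KernelLip K h)
    (h_symm : ∀ x y, h x y = h y x) (hb : Tendsto b atTop atTop) (hl : Tendsto l atTop atTop)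
    (hbl : Tendsto (fun n => (b n : ℝ) / (l n : ℝ)) atTop (𝓝 0)) (t : ℝ) :
    Tendsto (fun n => charFun ((iidLaw ℤ μ).map fun x => √(b n : ℝ) *
      (uAvg h (b n) (fun j => blockSum G (l n) j x) - kernelMean h (normSumLaw μ G (l n)))) t) atTop
      (𝓝 (Complex.exp (-(4 * kernelVar h (limitLaw μ G) * t ^ 2 / 2 : ℝ)))) := by
  have hσ0 := tsum_autoCov_nonneg hG hG2 hD
  set ρ : ProbabilityMeasure ℝ := ⟨limitLaw μ G, by unfold limitLaw; infer_instance⟩ with hρdef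
  set ρs : ℕ → ProbabilityMeasure ℝ := fun n =>
    ⟨normSumLaw μ G (l n), isProbabilityMeasure_normSumLaw hG (l n)⟩ with hρsdef
  have hρ : Tendsto ρs atTop (𝓝 ρ) := by
    rw [ProbabilityMeasure.tendsto_iff_tendsto_charFun]
    intro s
    have h1 := (tendsto_charFun_normSum hG hG2 h0 hD s).comp hl
    have h2 : charFun (ρ : Measure ℝ) s =
        Complex.exp (-((∑' s, autoCov μ G s) * s ^ 2 / 2 : ℝ)) := by
      change charFun (gaussianReal 0 (Real.toNNReal (∑' s, autoCov μ G s))) s = _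
      rw [charFun_gaussianReal, Real.coe_toNNReal _ hσ0]
      congr 1
      push_cast
      ring
    rw [h2]
    exact h1
  have h2 : MemLp id 2 (ρ : Measure ℝ) := memLp_id_gaussianReal 2
  have h2s : ∀ n, MemLp id 2 (ρs n : Measure ℝ) := fun n => memLp_normSumLaw hG hG2 (l n)
  have hsq : Tendsto (fun n => ∫ x, x ^ 2 ∂(ρs n : Measure ℝ)) atTop
      (𝓝 (∫ x, x ^ 2 ∂(ρ : Measure ℝ))) := by
    have h3 : ∫ x, x ^ 2 ∂(ρ : Measure ℝ) = ∑' s, autoCov μ G s := by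
      have h4 := variance_id_gaussianReal (μ := 0) (v := Real.toNNReal (∑' s, autoCov μ G s))
      rw [variance_of_integral_eq_zero aemeasurable_id (by
        change ∫ x, x ∂(gaussianReal 0 _) = 0
        rw [integral_id_gaussianReal]), Real.coe_toNNReal _ hσ0] at h4
      exact h4
    rw [h3]
    refine ((tendsto_variance_normSum hG hG2 hD).comp hl).congr fun n => ?_
    exact (integral_sq_normSumLaw hG hG2 h0 (l n)).symm
  set Q := iidLaw (Option ℤ × ℤ) μ with hQ
  set ζ : ℕ → ℤ → (Option ℤ × ℤ → ℝ) → ℝ := fun n j ω =>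
    blockSum G (l n) j (fun u => ω (blockIndex (block (l n)) j u)) with hζdef
  set ξ : ℕ → ℤ → (Option ℤ × ℤ → ℝ) → ℝ := fun n j ω =>
    blockSum G (l n) j (fun u => ω (mainIndex ℤ u)) with hξdef
  have hBm : ∀ n j, Measurable (blockSum G (l n) j) := fun n j => by
    unfold blockSum; fun_prop
  have hBL : ∀ n j, MemLp (blockSum G (l n) j) 2 (iidLaw ℤ μ) := fun n j =>
    (memLp_partSum hG2 _).const_mul _
  have hmpζ : ∀ n j, MeasurePreserving
      (fun (ω : Option ℤ × ℤ → ℝ) u => ω (blockIndex (block (l n)) j u)) Q (iidLaw ℤ μ) :=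
    fun n j => measurePreserving_reindex (blockIndex_injective _ j)
  have hmpξ : MeasurePreserving (fun (ω : Option ℤ × ℤ → ℝ) u => ω (mainIndex ℤ u)) Q
      (iidLaw ℤ μ) := measurePreserving_reindex mainIndex_injective
  have hζ : ∀ n j, MeasurePreserving (ζ n j) Q (ρs n) := by
    intro n j
    have h3 : MeasurePreserving (blockSum G (l n) j) (iidLaw ℤ μ) (ρs n) := by
      have h4 : MeasurePreserving (normSum G (l n)) (iidLaw ℤ μ) (ρs n) :=
        ⟨measurable_normSum hG _, rfl⟩
      have h5 : blockSum G (l n) j = fun x => normSum G (l n) (shiftSeq ((j - 1) * (l n : ℤ)) x) :=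
        funext fun x => blockSum_eq_normSum G (l n) j x
      rw [h5]
      exact h4.comp (measurePreserving_shiftSeq _)
    exact h3.comp (hmpζ n j)
  have hind : ∀ n, iIndepFun (ζ n) Q := fun n =>
    (iIndepFun_reindex_family (μ := μ) (blockIndex (block (l n)))
      (blockIndex_uncurry_injective (block_disjoint (l n)))).comp
      (fun j => blockSum G (l n) j) (hBm n)
  have hclt := tendsto_charFun_uAvg hL h_symm hρ h2 h2s hsq hb hζ hind t
  have hζm : ∀ n j, Measurable (ζ n j) := fun n j => (hζ n j).measurable
  have hξm : ∀ n j, Measurable (ξ n j) := fun n j => (hBm n j).comp hmpξ.measurable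
  have hζL : ∀ n j, MemLp (ζ n j) 2 Q := fun n j => (hBL n j).comp_measurePreserving (hmpζ n j)
  have hξL : ∀ n j, MemLp (ξ n j) 2 Q := fun n j => (hBL n j).comp_measurePreserving hmpξ
  set D := (totalDep μ G).toReal with hDdef
  have hd : ∀ n j, lpNorm (ξ n j - ζ n j) 2 Q ≤ D / √(l n : ℝ) := by
    intro n j
    -- Margin `g = 0`: each block keeps exactly its own innovations, so adjacent blocks become
    -- independent and the unnormalised error is at most `D`.
    have h3 := lpNorm_block_coupling_le hG hG2 hD (block (l n)) j ((j - 1) * (l n : ℤ) + 1)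
      (j * (l n : ℤ)) 0 (by simp [block])
    have h4 : ξ n j - ζ n j = fun ω => (1 / √(l n : ℝ)) *
        (partSum G (block (l n) j) (fun u => ω (mainIndex ℤ u)) -
          partSum G (block (l n) j) (fun u => ω (blockIndex (block (l n)) j u))) := by
      funext ω
      simp only [hξdef, hζdef, blockSum, Pi.sub_apply]
      ring
    rw [h4, lpNorm_const_mul, abs_of_nonneg (by positivity), div_eq_mul_one_div D, mul_comm D]
    refine mul_le_mul_of_nonneg_left ?_ (by positivity)
    exact h3.trans (le_of_eq (by simp [hDdef]))
  set θ : ℕ → ℝ := fun n => kernelMean h (ρs n) with hθ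
  set A : ℕ → (Option ℤ × ℤ → ℝ) → ℝ := fun n ω =>
    √(b n : ℝ) * (uAvg h (b n) (fun j => ξ n j ω) - θ n) with hA
  set B : ℕ → (Option ℤ × ℤ → ℝ) → ℝ := fun n ω =>
    √(b n : ℝ) * (uAvg h (b n) (fun j => ζ n j ω) - θ n) with hB
  have hAL : ∀ n, MemLp (A n) 2 Q := fun n =>
    ((hL.memLp_uAvg (hξm n) (hξL n) (b n)).sub (memLp_const (θ n))).const_mul _
  have hBL' : ∀ n, MemLp (B n) 2 Q := fun n =>
    ((hL.memLp_uAvg (hζm n) (hζL n) (b n)).sub (memLp_const (θ n))).const_mul _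
  have hAB : ∀ n, 1 ≤ b n → ‖charFun (Q.map (A n)) t - charFun (Q.map (B n)) t‖ ≤
      |t| * (2 * K * D * √((b n : ℝ) / (l n : ℝ))) := by
    intro n hn
    refine (norm_charFun_map_sub_le (hAL n) (hBL' n) t).trans
      (mul_le_mul_of_nonneg_left ?_ (abs_nonneg t))
    have h5 : A n - B n = fun ω => √(b n : ℝ) *
        (((fun ω => uAvg h (b n) fun j => ξ n j ω) - fun ω => uAvg h (b n) fun j => ζ n j ω) ω) := by
      funext ω
      simp only [hA, hB, Pi.sub_apply]
      ring
    rw [h5, lpNorm_const_mul, abs_of_nonneg (Real.sqrt_nonneg _)]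
    have h6 := hL.lpNorm_uAvg_sub_le (hξL n) (hζL n) (hd n) hn
    calc _ ≤ √(b n : ℝ) * (2 * K * (D / √(l n : ℝ))) :=
          mul_le_mul_of_nonneg_left h6 (Real.sqrt_nonneg _)
      _ = _ := by
          rw [Real.sqrt_div (Nat.cast_nonneg _)]
          ring
  have hzero : Tendsto (fun n => |t| * (2 * K * D * √((b n : ℝ) / (l n : ℝ)))) atTop (𝓝 0) := by
    have h7 := (hbl.sqrt.const_mul (2 * K * D)).const_mul |t|
    simpa using h7
  have hsub : Tendsto (fun n => charFun (Q.map (A n)) t - charFun (Q.map (B n)) t) atTop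
      (𝓝 0) := by
    refine squeeze_zero_norm' ?_ hzero
    filter_upwards [hb.eventually_ge_atTop 1] with n hn using hAB n hn
  have hlim : Tendsto (fun n => charFun (Q.map (A n)) t) atTop
      (𝓝 (Complex.exp (-(4 * kernelVar h ρ * t ^ 2 / 2 : ℝ)))) := by
    have h8 := hsub.add hclt
    rw [zero_add] at h8
    exact h8.congr fun n => sub_add_cancel _ _
  refine hlim.congr fun n => ?_
  have hum : Measurable fun x => √(b n : ℝ) *
      (uAvg h (b n) (fun j => blockSum G (l n) j x) - kernelMean h (normSumLaw μ G (l n))) := by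
    have hm := hL.measurable
    have hBmn := hBm n
    unfold uAvg
    fun_prop
  rw [← hmpξ.map_eq, Measure.map_map hum hmpξ.measurable]
  rfl

end LinearBlocks

end BlockUStat

namespace BlockUStat

/-! ### Second-order Taylor bound -/

section Linearisation

variable {m : ℕ} {g : (Fin m → ℝ) → ℝ} {v : Fin m → ℝ}

lemma fderiv_apply_eq_sum_partialDeriv {x : Fin m → ℝ} (hg : DifferentiableAt ℝ g x)
    (u : Fin m → ℝ) : fderiv ℝ g x u = ∑ k, partialDeriv g k x * u k := by
  have h1 := LinearMap.pi_apply_eq_sum_univ (fderiv ℝ g x : (Fin m → ℝ) →ₗ[ℝ] ℝ) u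
  change fderiv ℝ g x u = _ at h1
  rw [h1]
  refine Finset.sum_congr rfl fun k _ => ?_
  rw [partialDeriv, hg.lineDeriv_eq_fderiv, smul_eq_mul, mul_comm]
  have h2 : (fun j => if k = j then (1 : ℝ) else 0) = Pi.single k 1 := by
    funext j
    by_cases hj : k = j
    · subst hj; simp
    · simp [hj, Ne.symm hj]
  rw [h2]
  rfl

/-- Second-order Taylor bound for a function whose partial derivatives are differentiable at the
point of expansion. -/
theorem exists_abs_sub_linear_le {a : ℝ} (ha : 0 < a)
    (hg : ∀ x : Fin m → ℝ, (∀ k, x k ∈ Set.Ioo (v k - a) (v k + a)) → DifferentiableAt ℝ g x)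
    (hg2 : ∀ k, DifferentiableAt ℝ (partialDeriv g k) v) :
    ∃ r > 0, ∃ C ≥ 0, ∀ x : Fin m → ℝ, (∀ k, |x k - v k| ≤ r) →
      |g x - g v - ∑ k, partialDeriv g k v * (x k - v k)| ≤ C * ∑ k, (x k - v k) ^ 2 := by
  have h1 : ∀ k, ∃ c, ∀ᶠ x in 𝓝 v, |partialDeriv g k x - partialDeriv g k v| ≤ c * ‖x - v‖ := by
    intro k
    obtain ⟨c, hc⟩ := (hg2 k).isBigO_sub.bound
    exact ⟨c, hc⟩
  choose c hc using h1
  obtain ⟨r₀, hr₀, hball⟩ := Metric.eventually_nhds_iff.mp (eventually_all.mpr hc)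
  set M : ℝ := ∑ k, |c k| with hM
  have hM0 : 0 ≤ M := Finset.sum_nonneg fun _ _ => abs_nonneg _
  -- Half of the minimum keeps the closed ball inside both the ball of radius `r₀`, where the
  -- difference quotients are controlled, and the box of differentiability.
  refine ⟨min r₀ a / 2, by positivity, M, hM0, fun x hx => ?_⟩
  have hr₁ : min r₀ a / 2 < r₀ := by
    have := min_le_left r₀ a
    have : 0 < min r₀ a := by positivity
    linarith
  have hr₂ : min r₀ a / 2 < a := by
    have := min_le_right r₀ a
    have : 0 < min r₀ a := by positivity
    linarith
  set s := ‖x - v‖ with hs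
  have hs0 : 0 ≤ s := norm_nonneg _
  have hsr : s ≤ min r₀ a / 2 := (pi_norm_le_iff_of_nonneg (by positivity)).mpr fun k => hx k
  have hdiff : ∀ y ∈ Metric.closedBall v s, DifferentiableAt ℝ g y := by
    intro y hy
    refine hg y fun k => ?_
    have h2 : |y k - v k| ≤ s := by
      rw [Metric.mem_closedBall, dist_eq_norm] at hy
      exact (norm_le_pi_norm (y - v) k).trans hy
    have h3 := abs_le.mp h2
    constructor <;> linarith [h3.1, h3.2]
  have hderiv : ∀ y ∈ Metric.closedBall v s,
      HasFDerivWithinAt (fun y => g y - fderiv ℝ g v y) (fderiv ℝ g y - fderiv ℝ g v)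
        (Metric.closedBall v s) y := fun y hy =>
    ((hdiff y hy).hasFDerivAt.sub (fderiv ℝ g v).hasFDerivAt).hasFDerivWithinAt
  have hv : v ∈ Metric.closedBall v s := Metric.mem_closedBall_self hs0
  have hx' : x ∈ Metric.closedBall v s := by rw [Metric.mem_closedBall, dist_eq_norm]
  -- On the ball of radius `s = ‖x - v‖` the derivative of `g` minus its linear part is at most `M
  -- s`; the mean value inequality then yields `M s²`.
  have hbound : ∀ y ∈ Metric.closedBall v s, ‖fderiv ℝ g y - fderiv ℝ g v‖ ≤ M * s := by
    intro y hy
    refine ContinuousLinearMap.opNorm_le_bound _ (by positivity) fun u => ?_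
    rw [_root_.sub_apply, fderiv_apply_eq_sum_partialDeriv (hdiff y hy),
      fderiv_apply_eq_sum_partialDeriv (hdiff v hv), ← Finset.sum_sub_distrib, hM, Finset.sum_mul,
      Finset.sum_mul]
    refine (norm_sum_le _ _).trans (Finset.sum_le_sum fun k _ => ?_)
    rw [← sub_mul, norm_mul]
    have hys : ‖y - v‖ ≤ s := by rwa [Metric.mem_closedBall, dist_eq_norm] at hy
    have h4 : |partialDeriv g k y - partialDeriv g k v| ≤ |c k| * s := by
      have h5 : dist y v < r₀ := by rw [dist_eq_norm]; linarith
      refine (hball h5 k).trans ?_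
      exact mul_le_mul (le_abs_self _) hys (norm_nonneg _) (abs_nonneg _)
    exact mul_le_mul h4 (norm_le_pi_norm u k) (norm_nonneg _) (by positivity)
  have h6 := (convex_closedBall v s).norm_image_sub_le_of_norm_hasFDerivWithin_le hderiv hbound hv
    hx'
  have h7 : (g x - fderiv ℝ g v x) - (g v - fderiv ℝ g v v) =
      g x - g v - ∑ k, partialDeriv g k v * (x k - v k) := by
    have h8 := fderiv_apply_eq_sum_partialDeriv (hdiff v hv) (x - v)
    rw [map_sub] at h8
    simp only [Pi.sub_apply] at h8
    rw [← h8]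
    ring
  rw [h7, Real.norm_eq_abs] at h6
  refine h6.trans ?_
  rw [← hs, mul_assoc, ← pow_two]
  refine mul_le_mul_of_nonneg_left ?_ hM0
  have hS : 0 ≤ ∑ k, (x k - v k) ^ 2 := Finset.sum_nonneg fun _ _ => sq_nonneg _
  have h9 : s ≤ √(∑ k, (x k - v k) ^ 2) := by
    refine (pi_norm_le_iff_of_nonneg (Real.sqrt_nonneg _)).mpr fun k => ?_
    rw [Real.norm_eq_abs]
    refine Real.abs_le_sqrt ?_
    exact Finset.single_le_sum (f := fun k => (x k - v k) ^ 2) (fun _ _ => sq_nonneg _)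
      (Finset.mem_univ k)
  calc s ^ 2 ≤ √(∑ k, (x k - v k) ^ 2) ^ 2 := pow_le_pow_left₀ hs0 h9 2
    _ = _ := Real.sq_sqrt hS

end Linearisation

/-! ### Replacing the block statistics by their linear parts -/

section Blocks

variable {μ : Measure ℝ} [IsProbabilityMeasure μ] {K : ℝ} {h : ℝ → ℝ → ℝ} {m : ℕ}
  {g : (Fin m → ℝ) → ℝ} {F : Fin m → (ℤ → ℝ) → ℝ} {v : Fin m → ℝ} {c : Fin m → ℝ}

/-- The vector of block averages. -/
noncomputable def blockMean (F : Fin m → (ℤ → ℝ) → ℝ) (l : ℕ) (j : ℤ) (x : ℤ → ℝ) : Fin m → ℝ :=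
  fun k => (1 / (l : ℝ)) * partSum (F k) (block l j) x

/-- The linear combination of the centred processes. -/
def linComb (c v : Fin m → ℝ) (F : Fin m → (ℤ → ℝ) → ℝ) (x : ℤ → ℝ) : ℝ :=
  ∑ k, c k * (F k x - v k)

lemma sum_mul_blockMean_sub {l : ℕ} (hl : 1 ≤ l) (j : ℤ) (x : ℤ → ℝ) :
    √(l : ℝ) * ∑ k, c k * (blockMean F l j x k - v k) = blockSum (linComb c v F) l j x := by
  have hl0 : (0 : ℝ) < l := by exact_mod_cast hl
  have hsq : √(l : ℝ) * √(l : ℝ) = l := Real.mul_self_sqrt hl0.le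
  have hs0 : √(l : ℝ) ≠ 0 := by positivity
  have h1 : partSum (linComb c v F) (block l j) x =
      ∑ k, c k * (l * (blockMean F l j x k - v k)) := by
    simp only [partSum, linComb, blockMean]
    rw [Finset.sum_comm]
    refine Finset.sum_congr rfl fun k _ => ?_
    rw [← Finset.mul_sum, Finset.sum_sub_distrib, Finset.sum_const, card_block, nsmul_eq_mul]
    congr 1
    field_simp
  rw [blockSum, h1, Finset.mul_sum, Finset.mul_sum]
  refine Finset.sum_congr rfl fun k _ => ?_
  rw [one_div, eq_inv_mul_iff_mul_eq₀ hs0, ← mul_assoc, hsq]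
  ring

lemma integral_blockMean_sub_sq_le (hF : ∀ k, Measurable (F k))
    (hF2 : ∀ k, MemLp (F k) 2 (iidLaw ℤ μ)) (hv : ∀ k, v k = ∫ x, F k x ∂(iidLaw ℤ μ))
    (hD : ∀ k, totalDep μ (F k) ≠ ⊤) {l : ℕ} (hl : 1 ≤ l) (j : ℤ) (k : Fin m) :
    ∫ x, (blockMean F l j x k - v k) ^ 2 ∂(iidLaw ℤ μ) ≤ (∑' t, |autoCov μ (F k) t|) / l := by
  have hl0 : (0 : ℝ) < l := by exact_mod_cast hl
  have h1 := variance_partSum_le (hF k) (hF2 k) (hD k) (block l j)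
  rw [card_block, variance_eq_integral (measurable_partSum (hF k) _).aemeasurable] at h1
  have h2 : ∫ x, partSum (F k) (block l j) x ∂(iidLaw ℤ μ) = l * v k := by
    simp only [partSum]
    rw [integral_finsetSum _ fun t _ => (memLp_shift (hF2 k) t).integrable (by norm_num)]
    rw [Finset.sum_congr rfl fun t _ =>
      integral_comp_measurePreserving (measurePreserving_shiftSeq (μ := μ) t) (hF k)]
    rw [Finset.sum_const, card_block, nsmul_eq_mul, hv k]
  rw [h2] at h1
  have h3 : ∀ x, (blockMean F l j x k - v k) ^ 2 =
      (1 / (l : ℝ) ^ 2) * (partSum (F k) (block l j) x - l * v k) ^ 2 := by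
    intro x
    simp only [blockMean]
    field_simp
  simp_rw [h3]
  rw [integral_const_mul]
  calc _ ≤ (1 / (l : ℝ) ^ 2) * (l * ∑' t, |autoCov μ (F k) t|) :=
        mul_le_mul_of_nonneg_left h1 (by positivity)
    _ = _ := by field_simp

lemma measurable_blockMean (hF : ∀ k, Measurable (F k)) (l : ℕ) (j : ℤ) :
    Measurable (blockMean F l j) := by
  refine measurable_pi_iff.mpr fun k => ?_
  have := hF k
  unfold blockMean
  fun_prop

/-- The sum over the first `b` blocks of the squared deviations of the block averages. -/
noncomputable def blockDev (v : Fin m → ℝ) (F : Fin m → (ℤ → ℝ) → ℝ) (b l : ℕ) (x : ℤ → ℝ) : ℝ :=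
  ∑ j ∈ Finset.Icc (1 : ℤ) (b : ℤ), ∑ k, (blockMean F l j x k - v k) ^ 2

lemma blockDev_nonneg (b l : ℕ) (x : ℤ → ℝ) : 0 ≤ blockDev v F b l x :=
  Finset.sum_nonneg fun _ _ => Finset.sum_nonneg fun _ _ => sq_nonneg _

lemma integrable_blockMean_sub_sq (hF2 : ∀ k, MemLp (F k) 2 (iidLaw ℤ μ)) (l : ℕ) (j : ℤ)
    (k : Fin m) : Integrable (fun x => (blockMean F l j x k - v k) ^ 2) (iidLaw ℤ μ) := by
  have h1 : MemLp (fun x => (1 / (l : ℝ)) * partSum (F k) (block l j) x) 2 (iidLaw ℤ μ) :=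
    (memLp_partSum (hF2 k) _).const_mul _
  have h2 : MemLp (fun _ : ℤ → ℝ => v k) 2 (iidLaw ℤ μ) := memLp_const _
  exact (h1.sub h2).integrable_sq

lemma integrable_blockDev (hF2 : ∀ k, MemLp (F k) 2 (iidLaw ℤ μ)) (b l : ℕ) :
    Integrable (blockDev v F b l) (iidLaw ℤ μ) :=
  integrable_finsetSum _ fun j _ => integrable_finsetSum _ fun k _ =>
    integrable_blockMean_sub_sq hF2 l j k

lemma integral_blockDev_le (hF : ∀ k, Measurable (F k))
    (hF2 : ∀ k, MemLp (F k) 2 (iidLaw ℤ μ)) (hv : ∀ k, v k = ∫ x, F k x ∂(iidLaw ℤ μ))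
    (hD : ∀ k, totalDep μ (F k) ≠ ⊤) (b : ℕ) {l : ℕ} (hl : 1 ≤ l) :
    ∫ x, blockDev v F b l x ∂(iidLaw ℤ μ) ≤
      (∑ k, ∑' t, |autoCov μ (F k) t|) * ((b : ℝ) / l) := by
  simp only [blockDev]
  rw [integral_finsetSum _ fun j _ => integrable_finsetSum _ fun k _ =>
    integrable_blockMean_sub_sq hF2 l j k]
  calc _ ≤ ∑ j ∈ Finset.Icc (1 : ℤ) (b : ℤ), ∑ k, (∑' t, |autoCov μ (F k) t|) / l := by
        refine Finset.sum_le_sum fun j _ => ?_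
        rw [integral_finsetSum _ fun k _ => integrable_blockMean_sub_sq hF2 l j k]
        exact Finset.sum_le_sum fun k _ => integral_blockMean_sub_sq_le hF hF2 hv hD hl j k
    _ = _ := by
        rw [Finset.sum_const, card_Icc_one, nsmul_eq_mul, ← Finset.sum_div]
        ring

variable {b l : ℕ → ℕ}

/-- No moment of `g` at the block averages is available, so the comparison is only in probability.
If the total squared deviation `S` is below `r²`, every block lies in the Taylor region and the
difference is at most a multiple of `S`. Markov's inequality bounds both the exceptional event and
this multiple. -/
theorem tendstoInMeasure_uAvg_linearisation (hF : ∀ k, Measurable (F k))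
    (hF2 : ∀ k, MemLp (F k) 2 (iidLaw ℤ μ)) (hv : ∀ k, v k = ∫ x, F k x ∂(iidLaw ℤ μ))
    (hD : ∀ k, totalDep μ (F k) ≠ ⊤) (hL : KernelLip K h) {r C : ℝ} (hr : 0 < r) (hC : 0 ≤ C)
    (hg : ∀ y : Fin m → ℝ, (∀ k, |y k - v k| ≤ r) →
      |g y - ∑ k, c k * (y k - v k)| ≤ C * ∑ k, (y k - v k) ^ 2)
    (hb : Tendsto b atTop atTop) (hl : Tendsto l atTop atTop)
    (hbl : Tendsto (fun n => (b n : ℝ) / (l n : ℝ)) atTop (𝓝 0)) (θ : ℕ → ℝ) :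
    TendstoInMeasure (iidLaw ℤ μ)
      ((fun n x => √(b n : ℝ) * (uAvg h (b n)
        (fun j => √(l n : ℝ) * g (blockMean F (l n) j x)) - θ n)) -
      fun n x => √(b n : ℝ) * (uAvg h (b n)
        (fun j => blockSum (linComb c v F) (l n) j x) - θ n)) atTop 0 := by
  set A : ℝ := ∑ k, ∑' t, |autoCov μ (F k) t| with hA
  set S : ℕ → (ℤ → ℝ) → ℝ := fun n => blockDev v F (b n) (l n) with hS
  have hK := hL.nonneg
  set a : ℕ → ℝ := fun n => √(b n : ℝ) * (2 * K / b n) * (√(l n : ℝ) * C) with ha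
  have ha0 : ∀ n, 0 ≤ a n := fun n => by positivity
  have hdet : ∀ n, 1 ≤ l n → ∀ x, S n x < r ^ 2 →
      |√(b n : ℝ) * (uAvg h (b n) (fun j => √(l n : ℝ) * g (blockMean F (l n) j x)) - θ n) -
        √(b n : ℝ) * (uAvg h (b n) (fun j => blockSum (linComb c v F) (l n) j x) - θ n)| ≤
        a n * S n x := by
    intro n hn x hx
    have h1 : ∀ j ∈ Finset.Icc (1 : ℤ) (b n : ℤ),
        |√(l n : ℝ) * g (blockMean F (l n) j x) - blockSum (linComb c v F) (l n) j x| ≤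
          √(l n : ℝ) * C * ∑ k, (blockMean F (l n) j x k - v k) ^ 2 := by
      intro j hj
      rw [← sum_mul_blockMean_sub hn, ← mul_sub, abs_mul, abs_of_nonneg (Real.sqrt_nonneg _),
        mul_assoc]
      refine mul_le_mul_of_nonneg_left (hg _ fun k => ?_) (Real.sqrt_nonneg _)
      -- One squared deviation is at most the total `S < r²`, so a single event controls all blocks
      -- and coordinates.
      refine abs_le_of_sq_le_sq (le_of_lt ?_) hr.le
      refine lt_of_le_of_lt ?_ hx
      refine (Finset.single_le_sum (f := fun k => (blockMean F (l n) j x k - v k) ^ 2)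
        (fun _ _ => sq_nonneg _) (Finset.mem_univ k)).trans ?_
      exact Finset.single_le_sum
        (f := fun j => ∑ k, (blockMean F (l n) j x k - v k) ^ 2)
        (fun _ _ => Finset.sum_nonneg fun _ _ => sq_nonneg _) hj
    rw [← mul_sub, sub_sub_sub_cancel_right, abs_mul, abs_of_nonneg (Real.sqrt_nonneg _)]
    have h2 := (hL.abs_uAvg_sub_le (b n) (fun j => √(l n : ℝ) * g (blockMean F (l n) j x))
      (fun j => blockSum (linComb c v F) (l n) j x)).trans
      (mul_le_mul_of_nonneg_left (Finset.sum_le_sum h1) (by positivity))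
    rw [← Finset.mul_sum] at h2
    calc _ ≤ √(b n : ℝ) * (2 * K / b n * (√(l n : ℝ) * C * S n x)) :=
          mul_le_mul_of_nonneg_left h2 (Real.sqrt_nonneg _)
      _ = _ := by simp only [ha]; ring
  have hS0 : ∀ n x, 0 ≤ S n x := fun n x => blockDev_nonneg _ _ _
  have hSint : ∀ n, Integrable (S n) (iidLaw ℤ μ) := fun n => integrable_blockDev hF2 _ _
  have hmarkov : ∀ n (ε : ℝ), 0 < ε → 1 ≤ l n →
      (iidLaw ℤ μ).real {x | ε ≤
        |√(b n : ℝ) * (uAvg h (b n) (fun j => √(l n : ℝ) * g (blockMean F (l n) j x)) - θ n) -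
        √(b n : ℝ) * (uAvg h (b n) (fun j => blockSum (linComb c v F) (l n) j x) - θ n)|} ≤
      A * ((b n : ℝ) / l n) / r ^ 2 + a n * (A * ((b n : ℝ) / l n)) / ε := by
    intro n ε hε hn
    have hES := integral_blockDev_le hF hF2 hv hD (b n) hn
    have hm1 := mul_meas_ge_le_integral_of_nonneg (ae_of_all _ (hS0 n)) (hSint n) (r ^ 2)
    have hm2 := mul_meas_ge_le_integral_of_nonneg
      (ae_of_all _ fun x => mul_nonneg (ha0 n) (hS0 n x)) ((hSint n).const_mul (a n)) ε
    rw [integral_const_mul] at hm2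
    have h3 : (iidLaw ℤ μ).real {x | r ^ 2 ≤ S n x} ≤ A * ((b n : ℝ) / l n) / r ^ 2 := by
      rw [le_div_iff₀ (by positivity), mul_comm]
      exact hm1.trans hES
    have h4 : (iidLaw ℤ μ).real {x | ε ≤ a n * S n x} ≤ a n * (A * ((b n : ℝ) / l n)) / ε := by
      rw [le_div_iff₀ hε, mul_comm]
      exact hm2.trans (mul_le_mul_of_nonneg_left hES (ha0 n))
    refine le_trans ?_ (add_le_add h3 h4)
    refine (measureReal_mono (fun x hx => ?_)).trans (measureReal_union_le _ _)
    by_cases hx2 : r ^ 2 ≤ S n x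
    · exact Or.inl hx2
    · exact Or.inr (le_trans hx (hdet n hn x (not_le.mp hx2)))
  -- The factor `a n` is of order `√(l/b)` and the mean of `S` of order `b/l`; their product is of
  -- order `√(b/l)`.
  have ha1 : ∀ n, 1 ≤ b n → 1 ≤ l n →
      a n * (A * ((b n : ℝ) / l n)) = 2 * K * C * A * √((b n : ℝ) / l n) := by
    intro n hb1 hl1
    have hb0 : (0 : ℝ) < b n := by exact_mod_cast hb1
    have hl0 : (0 : ℝ) < l n := by exact_mod_cast hl1
    have h5 : √(l n : ℝ) * √(l n : ℝ) = l n := Real.mul_self_sqrt hl0.le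
    have h6 : √(l n : ℝ) ≠ 0 := by positivity
    rw [Real.sqrt_div hb0.le]
    simp only [ha]
    rw [show (b n : ℝ) / (l n : ℝ) = b n / (√(l n : ℝ) * √(l n : ℝ)) by rw [h5]]
    field_simp
  rw [tendstoInMeasure_iff_measureReal_norm]
  intro ε hε
  have hlim : Tendsto (fun n => A * ((b n : ℝ) / l n) / r ^ 2 +
      2 * K * C * A * √((b n : ℝ) / l n) / ε) atTop (𝓝 0) := by
    have h7 := ((hbl.const_mul A).div_const (r ^ 2)).add
      ((hbl.sqrt.const_mul (2 * K * C * A)).div_const ε)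
    simpa using h7
  refine squeeze_zero' (Eventually.of_forall fun n => measureReal_nonneg) ?_ hlim
  filter_upwards [hb.eventually_ge_atTop 1, hl.eventually_ge_atTop 1] with n hb1 hl1
  have h8 := hmarkov n ε hε hl1
  rw [ha1 n hb1 hl1] at h8
  simpa using h8

end Blocks

end BlockUStat

namespace BlockUStat

open scoped ENNReal

/-! ### The limit theorem on the space of innovation sequences -/

section Canonical

variable {μ : Measure ℝ} {K : ℝ} {h : ℝ → ℝ → ℝ} {m : ℕ}
  {g : (Fin m → ℝ) → ℝ} {F : Fin m → (ℤ → ℝ) → ℝ} {v : Fin m → ℝ} {c : Fin m → ℝ}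

lemma dep_linComb_le (hF : ∀ k, Measurable (F k)) (i : ℤ) :
    dep μ (linComb c v F) i ≤ ∑ k, ‖c k‖ₑ * dep μ (F k) i := by
  have h1 : (fun p : (ℤ → ℝ) × ℝ => linComb c v F p.1 - linComb c v F (Function.update p.1 i p.2)) =
      ∑ k, c k • fun p : (ℤ → ℝ) × ℝ => F k p.1 - F k (Function.update p.1 i p.2) := by
    funext p
    simp only [linComb, Finset.sum_apply, Pi.smul_apply, smul_eq_mul]
    rw [← Finset.sum_sub_distrib]
    exact Finset.sum_congr rfl fun k _ => by ring
  have hm : ∀ k, Measurable fun p : (ℤ → ℝ) × ℝ => F k p.1 - F k (Function.update p.1 i p.2) := by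
    intro k
    have hup : Measurable fun p : (ℤ → ℝ) × ℝ => Function.update p.1 i p.2 := by
      refine measurable_pi_iff.mpr fun u => ?_
      by_cases hu : u = i
      · subst hu; simpa using measurable_snd
      · simp only [Function.update_of_ne hu]; fun_prop
    exact ((hF k).comp measurable_fst).sub ((hF k).comp hup)
  rw [dep, h1]
  refine (eLpNorm_sum_le (fun k _ => ((hm k).const_smul (c k)).aestronglyMeasurable)
    (by norm_num)).trans (Finset.sum_le_sum fun k _ => ?_)
  rw [eLpNorm_const_smul]
  rfl

lemma totalDep_linComb_ne_top (hF : ∀ k, Measurable (F k)) (hD : ∀ k, totalDep μ (F k) ≠ ⊤) :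
    totalDep μ (linComb c v F) ≠ ⊤ := by
  have h1 : totalDep μ (linComb c v F) ≤ ∑ k, ‖c k‖ₑ * totalDep μ (F k) := by
    calc totalDep μ (linComb c v F)
        ≤ ∑' i : ℤ, ∑ k, ‖c k‖ₑ * (ENNReal.ofReal ((i : ℝ) ^ 2) * dep μ (F k) i) := by
          refine ENNReal.tsum_le_tsum fun i => ?_
          refine (mul_le_mul_right (dep_linComb_le hF i) _).trans (le_of_eq ?_)
          rw [Finset.mul_sum]
          exact Finset.sum_congr rfl fun k _ => by ring
      _ = _ := by
          rw [Summable.tsum_finsetSum fun k _ => ENNReal.summable]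
          exact Finset.sum_congr rfl fun k _ => ENNReal.tsum_mul_left
  refine ne_top_of_le_ne_top ?_ h1
  exact ENNReal.sum_ne_top.mpr fun k _ => ENNReal.mul_ne_top enorm_ne_top (hD k)

lemma measurable_linComb (hF : ∀ k, Measurable (F k)) : Measurable (linComb c v F) := by
  unfold linComb; fun_prop

variable [IsProbabilityMeasure μ]

lemma memLp_linComb (hF2 : ∀ k, MemLp (F k) 2 (iidLaw ℤ μ)) :
    MemLp (linComb c v F) 2 (iidLaw ℤ μ) := by
  refine memLp_finsetSum _ fun k _ => ?_
  have h1 : MemLp (fun _ : ℤ → ℝ => v k) 2 (iidLaw ℤ μ) := memLp_const _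
  exact ((hF2 k).sub h1).const_mul _

lemma integral_linComb (hF2 : ∀ k, MemLp (F k) 2 (iidLaw ℤ μ))
    (hv : ∀ k, v k = ∫ x, F k x ∂(iidLaw ℤ μ)) : ∫ x, linComb c v F x ∂(iidLaw ℤ μ) = 0 := by
  have h1 : ∀ k, Integrable (F k) (iidLaw ℤ μ) := fun k => (hF2 k).integrable (by norm_num)
  simp only [linComb]
  have h2 : ∀ k, Integrable (fun x => c k * (F k x - v k)) (iidLaw ℤ μ) := fun k =>
    ((h1 k).sub (integrable_const _)).const_mul _
  rw [integral_finsetSum _ fun k _ => h2 k]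
  refine Finset.sum_eq_zero fun k _ => ?_
  rw [integral_const_mul, integral_sub (h1 k) (integrable_const _), ← hv k]
  simp

variable {b l : ℕ → ℕ}

/-- Slutsky's argument: the statistic of the linear block sums converges by its characteristic
functions, and the linearisation error vanishes in probability. -/
theorem tendstoInDistribution_uAvg (hF : ∀ k, Measurable (F k))
    (hF2 : ∀ k, MemLp (F k) 2 (iidLaw ℤ μ)) (hv : ∀ k, v k = ∫ x, F k x ∂(iidLaw ℤ μ))
    (hD : ∀ k, totalDep μ (F k) ≠ ⊤) (hL : KernelLip K h) (h_symm : ∀ x y, h x y = h y x)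
    (hgm : Measurable g) {r C : ℝ} (hr : 0 < r) (hC : 0 ≤ C)
    (hg : ∀ y : Fin m → ℝ, (∀ k, |y k - v k| ≤ r) →
      |g y - ∑ k, c k * (y k - v k)| ≤ C * ∑ k, (y k - v k) ^ 2)
    (hb : Tendsto b atTop atTop) (hl : Tendsto l atTop atTop)
    (hbl : Tendsto (fun n => (b n : ℝ) / (l n : ℝ)) atTop (𝓝 0)) :
    TendstoInDistribution
      (fun n x => √(b n : ℝ) * (uAvg h (b n) (fun j => √(l n : ℝ) * g (blockMean F (l n) j x)) -
        kernelMean h (normSumLaw μ (linComb c v F) (l n)))) atTop (id : ℝ → ℝ)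
      (fun _ => iidLaw ℤ μ)
      (gaussianReal 0 (Real.toNNReal (4 * kernelVar h (limitLaw μ (linComb c v F))))) := by
  have hm := hL.measurable
  have hG := measurable_linComb (c := c) (v := v) hF
  have hmeas1 : ∀ n, Measurable fun x => √(b n : ℝ) * (uAvg h (b n)
      (fun j => √(l n : ℝ) * g (blockMean F (l n) j x)) -
        kernelMean h (normSumLaw μ (linComb c v F) (l n))) := fun n => by
    have h1 := fun j => measurable_blockMean hF (l n) j
    unfold uAvg
    fun_prop
  have hmeas2 : ∀ n, Measurable fun x => √(b n : ℝ) * (uAvg h (b n)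
      (fun j => blockSum (linComb c v F) (l n) j x) -
        kernelMean h (normSumLaw μ (linComb c v F) (l n))) := fun n => by
    have h1 : ∀ j, Measurable (blockSum (linComb c v F) (l n) j) := fun j => by
      unfold blockSum; fun_prop
    unfold uAvg
    fun_prop
  refine tendstoInDistribution_of_tendstoInMeasure_sub _ _ ?_
    (tendstoInMeasure_uAvg_linearisation hF hF2 hv hD hL hr hC hg hb hl hbl
      fun n => kernelMean h (normSumLaw μ (linComb c v F) (l n)))
    fun n => (hmeas1 n).aemeasurable
  refine ⟨fun n => (hmeas2 n).aemeasurable, aemeasurable_id, ?_⟩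
  refine ProbabilityMeasure.tendsto_iff_tendsto_charFun.mpr fun t => ?_
  have h2 := tendsto_charFun_uAvg_blockSum hG (memLp_linComb hF2) (integral_linComb hF2 hv)
    (totalDep_linComb_ne_top hF hD) hL h_symm hb hl hbl t
  have h3 : charFun ((gaussianReal 0
      (Real.toNNReal (4 * kernelVar h (limitLaw μ (linComb c v F))))).map id) t =
      Complex.exp (-(4 * kernelVar h (limitLaw μ (linComb c v F)) * t ^ 2 / 2 : ℝ)) := by
    rw [Measure.map_id, charFun_gaussianReal,
      Real.coe_toNNReal _ (mul_nonneg (by norm_num) (kernelVar_nonneg _))]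
    congr 1
    push_cast
    ring
  change Tendsto _ _ (𝓝 (charFun ((gaussianReal 0
      (Real.toNNReal (4 * kernelVar h (limitLaw μ (linComb c v F))))).map id) t))
  rw [h3]
  exact h2

end Canonical

/-! ### Transfer from the given probability space -/

section Transfer

lemma tendstoInDistribution_comp_measurePreserving {α β γ : Type*} [MeasurableSpace α]
    [MeasurableSpace β] [MeasurableSpace γ] {P : Measure α} {Q : Measure β} {ν : Measure γ}
    [IsProbabilityMeasure P] [IsProbabilityMeasure Q] [IsProbabilityMeasure ν] {φ : α → β}
    (hφ : MeasurePreserving φ P Q) {T : ℕ → β → ℝ} {Z : γ → ℝ}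
    (hT : TendstoInDistribution T atTop Z (fun _ => Q) ν) :
    TendstoInDistribution (fun n ω => T n (φ ω)) atTop Z (fun _ => P) ν where
  forall_aemeasurable n := (hT.forall_aemeasurable n).comp_quasiMeasurePreserving hφ.quasiMeasurePreserving
  aemeasurable_limit := hT.aemeasurable_limit
  tendsto := by
    refine hT.tendsto.congr fun n => Subtype.ext ?_
    change Q.map (T n) = P.map (T n ∘ φ)
    rw [← hφ.map_eq, AEMeasurable.map_map_of_aemeasurable (by
      rw [hφ.map_eq]; exact hT.forall_aemeasurable n) hφ.measurable.aemeasurable]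

/-- The function `F` of the time-reversed sequence. -/
def reflect (F : (ℤ → ℝ) → ℝ) (x : ℤ → ℝ) : ℝ := F fun u => x (-u)

@[fun_prop]
lemma measurable_reflect {F : (ℤ → ℝ) → ℝ} (hF : Measurable F) : Measurable (reflect F) := by
  unfold reflect; fun_prop

/-- The process reads the innovations backwards from `t`, whereas `shiftSeq t` reads them forwards;
reversing the argument of `f` reconciles the two. -/
lemma shift_eq_reflect {Ω : Type*} (f : (ℤ → ℝ) → ℝ) (ε : ℤ → Ω → ℝ) (t : ℤ) (ω : Ω) :
    shift f ε t ω = reflect f (shiftSeq t fun u => ε u ω) := rfl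

variable {Ω : Type*} [MeasurableSpace Ω] {P : Measure Ω}
  {ε : ℤ → Ω → ℝ} {f : (ℤ → ℝ) → ℝ}

lemma measurePreserving_innovations (hε_meas : ∀ u, Measurable (ε u)) (hε_indep : iIndepFun ε P)
    (hε_ident : ∀ u, IdentDistrib (ε u) (ε 0) P P) :
    MeasurePreserving (fun ω u => ε u ω) P (iidLaw ℤ (P.map (ε 0))) := by
  refine ⟨measurable_pi_iff.mpr hε_meas, ?_⟩
  rw [hε_indep.map_fun_eq_infinitePi_map hε_meas, iidLaw]
  congr 1
  funext u
  exact (hε_ident u).map_eq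

variable [IsProbabilityMeasure P]

/-- Of the second copy of the innovations only the single variable `ε i` is read, so the product
space can be projected to a sequence and one further innovation. Reversal turns the replaced
position `-u = i` into `u = i`. -/
lemma physDep_eq_dep (hε_meas : ∀ u, Measurable (ε u)) (hε_indep : iIndepFun ε P)
    (hε_ident : ∀ u, IdentDistrib (ε u) (ε 0) P P) {F : (ℤ → ℝ) → ℝ} (hF : Measurable F) (i : ℤ) :
    physDep P ε F i = dep (P.map (ε 0)) (reflect F) i := by
  have := Measure.isProbabilityMeasure_map (μ := P) (hε_meas 0).aemeasurable
  have h1 := measurePreserving_innovations hε_meas hε_indep hε_ident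
  have h2 : MeasurePreserving (ε i) P (P.map (ε 0)) := ⟨hε_meas i, (hε_ident i).map_eq⟩
  have h3 := h1.prod h2
  have hup : Measurable fun p : (ℤ → ℝ) × ℝ => Function.update p.1 i p.2 := by
    refine measurable_pi_iff.mpr fun u => ?_
    by_cases hu : u = i
    · subst hu; simpa using measurable_snd
    · simp only [Function.update_of_ne hu]; fun_prop
  have hm : Measurable fun p : (ℤ → ℝ) × ℝ => reflect F p.1 - reflect F (Function.update p.1 i p.2) :=
    ((measurable_reflect hF).comp measurable_fst).sub ((measurable_reflect hF).comp hup)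
  rw [physDep, dep, ← eLpNorm_comp_measurePreserving hm.aestronglyMeasurable h3]
  congr 1
  funext p
  simp only [Function.comp_apply, reflect, Prod.map, Function.update_apply]

lemma totalDep_reflect_pow_ne_top (hε_meas : ∀ u, Measurable (ε u)) (hε_indep : iIndepFun ε P)
    (hε_ident : ∀ u, IdentDistrib (ε u) (ε 0) P P) (hf : Measurable f) {m : ℕ}
    (hδ : ∑' i : ℤ, ∑ k : Fin m, ENNReal.ofReal ((i : ℝ) ^ 2) *
      physDep P ε (fun x => f x ^ ((k : ℕ) + 1)) i < ⊤) (k : Fin m) :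
    totalDep (P.map (ε 0)) (fun x => reflect f x ^ ((k : ℕ) + 1)) ≠ ⊤ := by
  refine ne_top_of_le_ne_top hδ.ne (ENNReal.tsum_le_tsum fun i => ?_)
  have h1 := physDep_eq_dep hε_meas hε_indep hε_ident (hf.pow_const ((k : ℕ) + 1)) i
  change _ = dep _ (fun x => reflect f x ^ ((k : ℕ) + 1)) i at h1
  rw [← h1]
  exact Finset.single_le_sum (f := fun k : Fin m => ENNReal.ofReal ((i : ℝ) ^ 2) *
      physDep P ε (fun x => f x ^ ((k : ℕ) + 1)) i) (fun _ _ => zero_le) (Finset.mem_univ k)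

/-- For `k + 1 ≤ m` one has `F^{2(k+1)} ≤ 1 + F^{2m}`, separating the cases `F² ≤ 1` and `F² ≥ 1`.
-/
lemma memLp_pow_of_integrable {α : Type*} [MeasurableSpace α] {ν : Measure α}
    [IsProbabilityMeasure ν] {F : α → ℝ} (hF : Measurable F) {m : ℕ}
    (hint : Integrable (fun x => F x ^ (2 * m)) ν) {k : ℕ} (hk : k < m) :
    MemLp (fun x => F x ^ (k + 1)) 2 ν := by
  rw [memLp_two_iff_integrable_sq (hF.pow_const _).aestronglyMeasurable]
  refine ((integrable_const (1 : ℝ)).add hint).mono' (Measurable.aestronglyMeasurable (by fun_prop))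
    (ae_of_all _ fun x => ?_)
  rw [Real.norm_eq_abs, abs_of_nonneg (sq_nonneg _), ← pow_mul, mul_comm (k + 1) 2, pow_mul]
  change (F x ^ 2) ^ (k + 1) ≤ 1 + F x ^ (2 * m)
  rw [pow_mul]
  rcases le_total (F x ^ 2) 1 with h1 | h1
  · have h2 := pow_le_one₀ (n := k + 1) (sq_nonneg (F x)) h1
    have h3 : 0 ≤ (F x ^ 2) ^ m := by positivity
    linarith
  · exact (pow_le_pow_right₀ h1 (Nat.succ_le_of_lt hk)).trans (by linarith)

end Transfer

end BlockUStat

namespace BlockUStat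

/-! ### Moments, linear sums and long-run variance on the space of sequences -/

section Representation

variable {Ω : Type*} [MeasurableSpace Ω] {P : Measure Ω} {ε : ℤ → Ω → ℝ} {f : (ℤ → ℝ) → ℝ}

/-- The powers of a functional. -/
def powers (m : ℕ) (F : (ℤ → ℝ) → ℝ) (k : Fin m) (x : ℤ → ℝ) : ℝ := F x ^ ((k : ℕ) + 1)

lemma measurable_powers {m : ℕ} {F : (ℤ → ℝ) → ℝ} (hF : Measurable F) (k : Fin m) :
    Measurable (powers m F k) := hF.pow_const _

lemma linSum_shift {m : ℕ} (g : (Fin m → ℝ) → ℝ) (f : (ℤ → ℝ) → ℝ)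
    (ε : ℤ → Ω → ℝ) (l : ℕ) (ω : Ω) :
    linSum P g (shift f ε) l ω =
      normSum (linComb (fun k => partialDeriv g k (momentVec P m (shift f ε)))
        (momentVec P m (shift f ε)) (powers m (reflect f))) l fun u => ε u ω := by
  simp only [linSum, normSum, partSum, linComb, powers, Finset.mul_sum, shift_eq_reflect]
  rw [Finset.sum_comm]

variable [IsProbabilityMeasure P]

lemma momentVec_shift (hε_meas : ∀ u, Measurable (ε u)) (hε_indep : iIndepFun ε P)
    (hε_ident : ∀ u, IdentDistrib (ε u) (ε 0) P P) (hf : Measurable f) (m : ℕ) (k : Fin m) :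
    momentVec P m (shift f ε) k = ∫ x, powers m (reflect f) k x ∂(iidLaw ℤ (P.map (ε 0))) := by
  have := Measure.isProbabilityMeasure_map (μ := P) (hε_meas 0).aemeasurable
  have h1 := (measurePreserving_shiftSeq (μ := P.map (ε 0)) 1).comp
    (measurePreserving_innovations hε_meas hε_indep hε_ident)
  exact integral_comp_measurePreserving h1 (measurable_powers (measurable_reflect hf) k)

lemma integrable_reflect_pow (hε_meas : ∀ u, Measurable (ε u)) (hε_indep : iIndepFun ε P)
    (hε_ident : ∀ u, IdentDistrib (ε u) (ε 0) P P) (hf : Measurable f) {p : ℕ}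
    (hX : Integrable (fun ω => shift f ε 1 ω ^ p) P) :
    Integrable (fun x => reflect f x ^ p) (iidLaw ℤ (P.map (ε 0))) := by
  have := Measure.isProbabilityMeasure_map (μ := P) (hε_meas 0).aemeasurable
  have h1 := (measurePreserving_shiftSeq (μ := P.map (ε 0)) 1).comp
    (measurePreserving_innovations hε_meas hε_indep hε_ident)
  exact (h1.integrable_comp
    ((measurable_reflect hf).pow_const p).aestronglyMeasurable).mp hX

lemma sigmaSq_shift (hε_meas : ∀ u, Measurable (ε u)) (hε_indep : iIndepFun ε P)
    (hε_ident : ∀ u, IdentDistrib (ε u) (ε 0) P P) (hf : Measurable f) {m : ℕ}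
    (g : (Fin m → ℝ) → ℝ) (hF2 : ∀ k, MemLp (powers m (reflect f) k) 2 (iidLaw ℤ (P.map (ε 0)))) :
    sigmaSq P g (shift f ε) = ∑' t, autoCov (P.map (ε 0))
      (linComb (fun k => partialDeriv g k (momentVec P m (shift f ε)))
        (momentVec P m (shift f ε)) (powers m (reflect f))) t := by
  have := Measure.isProbabilityMeasure_map (μ := P) (hε_meas 0).aemeasurable
  set c : Fin m → ℝ := fun k => partialDeriv g k (momentVec P m (shift f ε)) with hc
  set v := momentVec P m (shift f ε) with hv
  set H : (ℤ → ℝ) → ℝ := fun x => ∑ k, c k * powers m (reflect f) k x with hH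
  have hHm : Measurable H := by
    have := fun k => measurable_powers (m := m) (measurable_reflect hf) k
    fun_prop
  have hH2 : MemLp H 2 (iidLaw ℤ (P.map (ε 0))) :=
    memLp_finsetSum _ fun k _ => (hF2 k).const_mul _
  have h1 := measurePreserving_innovations hε_meas hε_indep hε_ident
  -- The linear combination differs from the uncentred one by a constant, which does not affect
  -- covariances.
  have h2 : linComb c v (powers m (reflect f)) = fun x => H x - ∑ k, c k * v k := by
    funext x
    simp only [linComb, hH, mul_sub, Finset.sum_sub_distrib]
  rw [h2, sigmaSq]
  refine tsum_congr fun t => ?_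
  have h3 : linProc P g (shift f ε) 0 = fun ω => H fun u => ε u ω := by
    funext ω
    change H (shiftSeq 0 fun u => ε u ω) = _
    rw [shiftSeq_zero]
  rw [autoCov_sub_const hH2, autoCov, h3]
  exact covariance_comp_measurePreserving h1 hHm (hHm.comp (measurable_shiftSeq t))

end Representation

end BlockUStat

/-! ### Conclusion -/

theorem mainTheorem3
    {Ω : Type*} [MeasurableSpace Ω] (P : Measure Ω) [IsProbabilityMeasure P]
    -- the i.i.d. innovations and the Bernoulli shift
    (ε : ℤ → Ω → ℝ) (hε_meas : ∀ u, Measurable (ε u)) (hε_indep : iIndepFun ε P)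
    (hε_ident : ∀ u, IdentDistrib (ε u) (ε 0) P P)
    (f : (ℤ → ℝ) → ℝ) (hf : Measurable f)
    (X : ℤ → Ω → ℝ) (hX : X = BlockUStat.shift f ε)
    -- the kernel
    (h : ℝ → ℝ → ℝ) (h_symm : ∀ x y, h x y = h y x)
    (h_lip : ∃ K : NNReal, LipschitzWith K (fun p : ℝ × ℝ => h p.1 p.2))
    -- moments and dependence coefficients
    (m : ℕ) (hX_mom : Integrable (fun ω => X 1 ω ^ (2 * m)) P)
    (hδ : ∑' i : ℤ, ∑ k : Fin m, ENNReal.ofReal ((i : ℝ) ^ 2) *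
      BlockUStat.physDep P ε (fun x => f x ^ ((k : ℕ) + 1)) i < ⊤)
    -- the function `g` and the point `v₀`
    (g : (Fin m → ℝ) → ℝ) (hg_meas : Measurable g)
    (v₀ : Fin m → ℝ) (hv₀ : v₀ = BlockUStat.momentVec P m X)
    (hg_zero : g v₀ = 0)
    (hg_diff : ∃ a : ℝ, 0 < a ∧
      (∀ x : Fin m → ℝ, (∀ k, x k ∈ Set.Ioo (v₀ k - 2 * a) (v₀ k + 2 * a)) →
        DifferentiableAt ℝ g x) ∧
      ∃ C : ℝ, ∀ x : Fin m → ℝ, (∀ k, x k ∈ Set.Ioo (v₀ k - 2 * a) (v₀ k + 2 * a)) →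
        ∀ k, |BlockUStat.partialDeriv g k x| ≤ C)
    -- numbers of blocks and block lengths
    (b l : ℕ → ℕ) (hb : Tendsto b atTop atTop) (hl : Tendsto l atTop atTop)
    (hbl : Tendsto (fun n => (b n : ℝ) / (l n : ℝ)) atTop (𝓝 0))
    -- positivity of the long-run variance
    (hσ : 0 < BlockUStat.sigmaSq P g X)
    -- the additional assumptions: `g` is twice differentiable at `v₀`, and the conditions with `κ`
    (hg_two : ∀ k, DifferentiableAt ℝ (BlockUStat.partialDeriv g k) v₀)
    (κ : ℝ) (hκ : κ ∈ Set.Ioo (0 : ℝ) 1)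
    (hδκ : ∑' i : ℤ, ∑ k : Fin m, ENNReal.ofReal (|(i : ℝ)| ^ (1 / 2 + 1 / (2 * κ) : ℝ)) *
      BlockUStat.physDep P ε (fun x => f x ^ ((k : ℕ) + 1)) i < ⊤)
    (hblκ : Tendsto (fun n => (b n : ℝ) / (l n : ℝ) ^ (1 - κ)) atTop (𝓝 0)) :
    -- the centring exists: `Z_n` and its independent copy are `Z_n(p.1)` and `Z_n(p.2)`
    (∀ n, Integrable (fun p : Ω × Ω => h (BlockUStat.linSum P g X (l n) p.1)
      (BlockUStat.linSum P g X (l n) p.2)) (P.prod P)) ∧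
    -- the limit variance is not negative
    0 ≤ BlockUStat.gammaSq h (√(BlockUStat.sigmaSq P g X)) ∧
    -- convergence in distribution to `N(0, 4γ²)`
    TendstoInDistribution
      (fun n ω => √(b n : ℝ) * (BlockUStat.uStat h g X (b n) (l n) ω -
        ∫ p : Ω × Ω, h (BlockUStat.linSum P g X (l n) p.1)
          (BlockUStat.linSum P g X (l n) p.2) ∂(P.prod P)))
      atTop (id : ℝ → ℝ) (fun _ => P)
      (gaussianReal 0 (Real.toNNReal (4 * BlockUStat.gammaSq h (√(BlockUStat.sigmaSq P g X))))) := by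
  subst hX hv₀
  obtain ⟨K, hK⟩ := h_lip
  have hL := BlockUStat.kernelLip_of_lipschitzWith hK
  have := Measure.isProbabilityMeasure_map (μ := P) (hε_meas 0).aemeasurable
  set μ := P.map (ε 0) with hμ
  set v := BlockUStat.momentVec P m (BlockUStat.shift f ε) with hv
  set F := BlockUStat.powers m (BlockUStat.reflect f) with hFdef
  set c : Fin m → ℝ := fun k => BlockUStat.partialDeriv g k v with hc
  have hφ := BlockUStat.measurePreserving_innovations hε_meas hε_indep hε_ident
  have hF : ∀ k, Measurable (F k) :=
    BlockUStat.measurable_powers (BlockUStat.measurable_reflect hf)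
  have hF2 : ∀ k, MemLp (F k) 2 (BlockUStat.iidLaw ℤ μ) := fun k =>
    BlockUStat.memLp_pow_of_integrable (BlockUStat.measurable_reflect hf)
      (BlockUStat.integrable_reflect_pow hε_meas hε_indep hε_ident hf hX_mom) k.2
  have hvF : ∀ k, v k = ∫ x, F k x ∂(BlockUStat.iidLaw ℤ μ) :=
    BlockUStat.momentVec_shift hε_meas hε_indep hε_ident hf m
  have hD : ∀ k, BlockUStat.totalDep μ (F k) ≠ ⊤ :=
    BlockUStat.totalDep_reflect_pow_ne_top hε_meas hε_indep hε_ident hf hδ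
  set G := BlockUStat.linComb c v F with hGdef
  have hG : Measurable G := BlockUStat.measurable_linComb hF
  -- The law of `Z_n` is that of the normalised sum of the linearised functional, so its independent
  -- copies realise `kernelMean` as the centring.
  have hZ : ∀ n, MeasurePreserving (BlockUStat.linSum P g (BlockUStat.shift f ε) (l n)) P
      (BlockUStat.normSumLaw μ G (l n)) := by
    intro n
    have h1 : MeasurePreserving (BlockUStat.normSum G (l n)) (BlockUStat.iidLaw ℤ μ)
        (BlockUStat.normSumLaw μ G (l n)) := ⟨BlockUStat.measurable_normSum hG _, rfl⟩
    rw [funext (BlockUStat.linSum_shift (P := P) g f ε (l n))]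
    exact h1.comp hφ
  have hprob := fun n => BlockUStat.isProbabilityMeasure_normSumLaw (μ := μ) hG (l n)
  have hZZ := fun n => (hZ n).prod (hZ n)
  have hσG := BlockUStat.sigmaSq_shift hε_meas hε_indep hε_ident hf g hF2
  -- The limit law has variance `Real.toNNReal` of the long-run variance; nonnegativity of `σ²`
  -- makes this the square of the scale used in `gammaSq`.
  have hγ : BlockUStat.gammaSq h (√(BlockUStat.sigmaSq P g (BlockUStat.shift f ε))) =
      BlockUStat.kernelVar h (BlockUStat.limitLaw μ G) := by
    rw [BlockUStat.limitLaw, ← hL.gammaSq_eq_kernelVar h_symm, ← hσG,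
      Real.coe_toNNReal _ hσ.le]
  refine ⟨fun n => ?_, ?_, ?_⟩
  · have h2 := (hL.memLp_prod (BlockUStat.memLp_normSumLaw (μ := μ) hG
      (BlockUStat.memLp_linComb hF2) (l n))).integrable one_le_two
    exact (hZZ n).integrable_comp_of_integrable h2
  · rw [hγ]
    exact BlockUStat.kernelVar_nonneg _
  · obtain ⟨a, ha, hdiff, -⟩ := hg_diff
    obtain ⟨r, hr, C, hC, hlin⟩ := BlockUStat.exists_abs_sub_linear_le (a := 2 * a) (by positivity)
      hdiff hg_two
    simp only [hg_zero, sub_zero] at hlin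
    have hθ : ∀ n, ∫ p : Ω × Ω, h (BlockUStat.linSum P g (BlockUStat.shift f ε) (l n) p.1)
        (BlockUStat.linSum P g (BlockUStat.shift f ε) (l n) p.2) ∂(P.prod P) =
        BlockUStat.kernelMean h (BlockUStat.normSumLaw μ G (l n)) := fun n =>
      BlockUStat.integral_comp_measurePreserving (hZZ n) hL.measurable
    simp_rw [hθ]
    rw [hγ]
    exact BlockUStat.tendstoInDistribution_comp_measurePreserving hφ
      (BlockUStat.tendstoInDistribution_uAvg hF hF2 hvF hD hL h_symm hg_meas hr hC hlin hb hl hbl)
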